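/- Let $k$ be a field of characteristic $0$. A superspace is a topological space with a sheaf of supercommutative $k$-superalgebras (for instance a super scheme over $k$, or a complex superspace). Let $\pi:C\to S$ be a morphism of superspaces that is a relative super curve of dimension $1|2$: every point of $C$ has an open neighbourhood $U$ with relative coordinates $x=(z|\theta^1,\theta^2)$, that is, $z$ is an even function on $U$, $\theta^1,\theta^2$ are odd functions on $U$, and $\mathcal T_{C/S}=\mathrm{Der}_{\mathcal O_S}(\mathcal O_C)$ is free over $U$ with a basis $\partial_z|\partial_{\theta^1},\partial_{\theta^2}$ dual to $dz|d\theta^1,d\theta^2$. Let $\Delta$ be an even nonvanishing global section of $\mathrm{Ber}_{C/S}=\mathrm{Ber}(\Omega_{C/S})$, the invertible sheaf with local generators $[dx]=[dz|d\theta^1d\theta^2]$ and $[dy]=\mathrm{Ber}(\partial y/\partial x)[dx]$. Thus $(C,\Delta)$ is an $S(1|2)$-super curve. Coordinates $x$ are compatible with $\Delta$ if $\Delta=[dx]$. For a supercommutative $k$-superalgebra $R$ let $R[[1|2]]=R[[t]][\theta^1,\theta^2]$ with $\mathfrak m=(t,\theta^1,\theta^2)$, and let $\mathrm{Aut}^\delta(R[[1|2]])$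 be the group of automorphisms of the $R$-superalgebra $R[[1|2]]$ that preserve $\mathfrak m$ and whose Jacobian has Berezinian $1$. Let $S(1|2)$ be the Lie superalgebra of divergence free $R$-linear superderivations of $R[[1|2]]$, let $S(2)=[S(1|2),S(1|2)]$, and let $S(2)_+$ be the set of even $X\in S(2)$ with $X\mathfrak m\subseteq\mathfrak m^2$. Let $\mathrm{Aut}^\Delta(R[[1|2]])$ be the set of all $\exp(X)\circ T$ with $X\in S(2)_+$ and $T\in\mathrm{Aut}^\delta(R[[1|2]])$ linear in $(t|\theta^1,\theta^2)$. A change between compatible coordinates $x,y$ on $U$ is said to lie in $\mathrm{Aut}^\Delta[[1|2]]$ if its Taylor expansion $y(x+(t|\tau))-y(x)$ at the universal point of $U$ defines an element of $\mathrm{Aut}^\Delta(R[[1|2]])$, where $R=\mathcal O_C(U)$. The pair $(C,\Delta)$ is an $S(2)$-super curve if $C$ has an atlas of coordinates compatible with $\Delta$ such that all changes of coordinates, on the overlaps of the charts, lie in $\mathrm{Aut}^\Delta[[1|2]]$. Let $\mathrm{Aut}^\delta_C$ be the bundle of pairs $(p,x)$ of a point $p$ of $C$ and local coordinates $x$ around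 $p$ compatible with $\Delta$, and let $\mathrm{Aut}^\Delta[[1|2]]\backslash\mathrm{Aut}^\delta_C$ be its quotient by the relation that the change of coordinates lies in $\mathrm{Aut}^\Delta[[1|2]]$ near $p$; its sections are the families of classes that are locally represented by compatible coordinates. The group $\mathbb G_a\simeq\mathrm{Aut}^\delta[[1|2]]/\mathrm{Aut}^\Delta[[1|2]]$ acts on it, in the form of the sheaf of even relative constants (the even functions on $C$ annihilated by $\mathcal T_{C/S}$, i.e. the even part of $\pi^{-1}\mathcal O_S$ when functions that are constant along the fibres come locally from $S$), where $c$ acts by $(z|\theta^1,\theta^2)\mapsto(z+c\,\theta^1\theta^2|\theta^1,\theta^2)$. The torsor is trivial if its sheaf of sections is equivariantly isomorphic to the sheaf $\mathbb G_a$ acting on itself by translations. Then $(C,\Delta)$ is an $S(2)$-super curve if and only if the $\mathbb G_a$-torsor $\mathrm{Aut}^\Delta[[1|2]]\backslash\mathrm{Aut}^\delta_C\to C$ is trivial. -/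

import Mathlib

open CategoryTheory TopologicalSpace Opposite

universe u v

namespace SuperCurve

noncomputable section

/-! ### Superalgebras -/

/-- A `ℤ/2`-grading on a ring `A` in which `2` is invertible, given by its parity involution
`a₀ + a₁ ↦ a₀ - a₁`: the even and odd parts are the eigenspaces for `1` and `-1`. -/
class Parity (A : Type v) [Ring A] where
  inv : A →+* A
  inv_inv : ∀ a, inv (inv a) = a

/-- `a` is homogeneous of parity `j`. -/
def HasParity {A : Type v} [Ring A] [Parity A] (j : ZMod 2) (a : A) : Prop :=
  Parity.inv a = (-1) ^ j.val * a

/-- `ba = (-1)^{ij} ab` for homogeneous `a`, `b` of parities `i`, `j`. -/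
def IsSupercommutative (A : Type v) [Ring A] [Parity A] : Prop :=
  ∀ (i j : ZMod 2) (a b : A), HasParity i a → HasParity j b →
    b * a = (-1) ^ (i.val * j.val) * (a * b)

/-- `D` is a superderivation of parity `j`: it shifts the parity by `j`, and
`D(ab) = D(a) b + (-1)^{ij} a D(b)` for `a` of parity `i`. -/
structure IsSuperDerivation {k : Type u} {A : Type v} [Field k] [Ring A] [Module k A] [Parity A]
    (j : ZMod 2) (D : A →ₗ[k] A) : Prop where
  parity : ∀ a, Parity.inv (D a) = (-1) ^ j.val * D (Parity.inv a)
  leibniz : ∀ (i : ZMod 2) (a b : A), HasParity i a →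
    D (a * b) = D a * b + (-1) ^ (i.val * j.val) * (a * D b)

/-- The Berezinian `(A - B D⁻¹ C) det(D)⁻¹` of an even `1|2 × 1|2` matrix `[A, B; C, D]`, with
`D⁻¹ = det(D)⁻¹ adj(D)` for the `2 × 2` block `D`, whose entries are even. -/
def berezinian {A : Type v} [Ring A] (M : Matrix (Fin 3) (Fin 3) A) : A :=
  let dInv : A := Ring.inverse (M 1 1 * M 2 2 - M 1 2 * M 2 1)
  (M 0 0 - (M 0 1 * (dInv * (M 2 2 * M 1 0 - M 1 2 * M 2 0))
    + M 0 2 * (dInv * (M 1 1 * M 2 0 - M 2 1 * M 1 0)))) * dInv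

/-- The parities of the coordinates `(z | θ¹, θ²)`. -/
def par : Fin 3 → ZMod 2 := ![0, 1, 1]

/-! ### The superalgebra `R[[1|2]]` -/

/-- The Grassmann algebra `A[θ]` on one odd variable; the pair `(a, b)` is `a + b θ`. -/
@[ext]
structure Grassmann (A : Type v) where
  fst : A
  snd : A

namespace Grassmann

variable {A : Type v}

/-- The underlying pair of coefficients. -/
def equivProd : Grassmann A ≃ A × A where
  toFun f := (f.fst, f.snd)
  invFun p := ⟨p.1, p.2⟩
  left_inv _ := rfl
  right_inv _ := rfl

instance [AddCommGroup A] : AddCommGroup (Grassmann A) := equivProd.addCommGroup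

instance {k : Type u} [Field k] [AddCommGroup A] [Module k A] : Module k (Grassmann A) :=
  equivProd.module k

@[simp] theorem fst_zero [AddCommGroup A] : (0 : Grassmann A).fst = 0 := rfl
@[simp] theorem snd_zero [AddCommGroup A] : (0 : Grassmann A).snd = 0 := rfl
@[simp] theorem fst_add [AddCommGroup A] (f g : Grassmann A) : (f + g).fst = f.fst + g.fst := rfl
@[simp] theorem snd_add [AddCommGroup A] (f g : Grassmann A) : (f + g).snd = f.snd + g.snd := rfl
@[simp] theorem fst_neg [AddCommGroup A] (f : Grassmann A) : (-f).fst = -f.fst := rfl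
@[simp] theorem snd_neg [AddCommGroup A] (f : Grassmann A) : (-f).snd = -f.snd := rfl
@[simp] theorem fst_sub [AddCommGroup A] (f g : Grassmann A) : (f - g).fst = f.fst - g.fst := rfl
@[simp] theorem snd_sub [AddCommGroup A] (f g : Grassmann A) : (f - g).snd = f.snd - g.snd := rfl
@[simp] theorem fst_smul {k : Type u} [Field k] [AddCommGroup A] [Module k A] (c : k)
    (f : Grassmann A) : (c • f).fst = c • f.fst := rfl
@[simp] theorem snd_smul {k : Type u} [Field k] [AddCommGroup A] [Module k A] (c : k)
    (f : Grassmann A) : (c • f).snd = c • f.snd := rfl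

variable [Ring A]

instance : One (Grassmann A) := ⟨⟨1, 0⟩⟩

@[simp] theorem fst_one : (1 : Grassmann A).fst = 1 := rfl
@[simp] theorem snd_one : (1 : Grassmann A).snd = 0 := rfl

variable [Parity A]

/-- `(a + bθ)(c + dθ) = ac + (ad + b inv(c)) θ`, since `θ c = inv(c) θ` and `θ² = 0`. -/
instance : Mul (Grassmann A) :=
  ⟨fun f g => ⟨f.fst * g.fst, f.fst * g.snd + f.snd * Parity.inv g.fst⟩⟩

@[simp] theorem fst_mul (f g : Grassmann A) : (f * g).fst = f.fst * g.fst := rfl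
@[simp] theorem snd_mul (f g : Grassmann A) :
    (f * g).snd = f.fst * g.snd + f.snd * Parity.inv g.fst := rfl

instance : Ring (Grassmann A) :=
  { (inferInstance : AddCommGroup (Grassmann A)),
    (inferInstance : One (Grassmann A)),
    (inferInstance : Mul (Grassmann A)) with
    left_distrib := fun a b c => by
      ext <;> simp [mul_add]; abel
    right_distrib := fun a b c => by
      ext <;> simp [add_mul]; abel
    zero_mul := fun a => by ext <;> simp
    mul_zero := fun a => by ext <;> simp
    mul_assoc := fun a b c => by
      ext <;> simp [mul_add, add_mul, mul_assoc, add_assoc]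
    one_mul := fun a => by ext <;> simp
    mul_one := fun a => by ext <;> simp }

instance : Parity (Grassmann A) where
  inv :=
    { toFun := fun f => ⟨Parity.inv f.fst, -Parity.inv f.snd⟩
      map_one' := by ext <;> simp
      map_mul' := fun f g => by ext <;> simp [Parity.inv_inv]; abel
      map_zero' := by ext <;> simp
      map_add' := fun f g => by ext <;> simp; abel }
  inv_inv f := by ext <;> simp [Parity.inv_inv]

/-- The left derivative `∂/∂θ` on `A[θ]`: `∂(a + bθ) = inv(b)`. -/
def dTheta (f : Grassmann A) : Grassmann A := ⟨Parity.inv f.snd, 0⟩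

/-- The coefficientwise extension to `A[θ]` of an operator on `A`. -/
def lift (D : A → A) (f : Grassmann A) : Grassmann A := ⟨D f.fst, D f.snd⟩

end Grassmann

/-- The variable `t` of `R[[t]]` is even. -/
instance {R : Type v} [Ring R] [Parity R] : Parity (PowerSeries R) where
  inv := PowerSeries.map Parity.inv
  inv_inv f := by ext n; simp [Parity.inv_inv]

/-- `R[[1|2]] = R[[t]][θ¹][θ²]`, the functions on the formal superdisk of dimension `1|2`. -/
abbrev Disk (R : Type v) [Ring R] [Parity R] : Type v := Grassmann (Grassmann (PowerSeries R))

namespace Disk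

section

variable {R : Type v} [Ring R] [Parity R]

/-- The constants `R ⊆ R[[1|2]]`. -/
def const (r : R) : Disk R := ⟨⟨PowerSeries.C r, 0⟩, 0⟩

/-- The generators `(t | θ¹, θ²)`. -/
def gen : Fin 3 → Disk R :=
  ![⟨⟨PowerSeries.X, 0⟩, 0⟩, ⟨⟨0, 1⟩, 0⟩, ⟨0, 1⟩]

/-- The derivatives `∂_t`, `∂_{θ¹}`, `∂_{θ²}`. -/
def partialD : Fin 3 → Disk R → Disk R :=
  ![Grassmann.lift (Grassmann.lift fun f =>
      PowerSeries.mk fun n => ((n + 1 : ℕ) : R) * PowerSeries.coeff (n + 1) f),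
    Grassmann.lift Grassmann.dTheta, Grassmann.dTheta]

/-- The power `𝔪^N` of the ideal `𝔪 = (t, θ¹, θ²)`: all terms have total degree at least `N`. -/
def maxPow (N : ℕ) : Set (Disk R) :=
  {f | ∀ n : ℕ, (n < N → PowerSeries.coeff n f.fst.fst = 0) ∧
    (n + 1 < N → PowerSeries.coeff n f.fst.snd = 0 ∧ PowerSeries.coeff n f.snd.fst = 0) ∧
    (n + 2 < N → PowerSeries.coeff n f.snd.snd = 0)}

/-- Automorphisms of the `R`-superalgebra `R[[1|2]]` fixing the origin. -/
structure IsAut (Φ : Disk R ≃+* Disk R) : Prop where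
  even : ∀ f, Φ (Parity.inv f) = Parity.inv (Φ f)
  const : ∀ r : R, Φ (const r) = Disk.const r
  origin : ∀ f ∈ maxPow (R := R) 1, Φ f ∈ maxPow (R := R) 1

/-- The Berezinian of the Jacobian `(∂_i Φ(x_j))` of `Φ`. -/
def berJacobian (Φ : Disk R ≃+* Disk R) : Disk R :=
  berezinian (Matrix.of fun i j => partialD i (Φ (gen j)))

variable (R) in
/-- The group `Aut^δ(R[[1|2]])` of automorphisms with Berezinian `1`. -/
def autBer : Set (Disk R ≃+* Disk R) :=
  {Φ | IsAut Φ ∧ berJacobian Φ = 1}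

variable (R) in
/-- The linear automorphisms in `Aut^δ(R[[1|2]])`. -/
def autBerLinear : Set (Disk R ≃+* Disk R) :=
  {T | T ∈ autBer R ∧ ∀ j, ∃ a : Fin 3 → R, T (gen j) = ∑ i, const (a i) * gen i}

end

variable (k : Type u) (R : Type v) [Field k] [Ring R] [Module k R] [Parity R]

/-- The `R`-linear superderivations of `R[[1|2]]` of parity `j`. -/
def Der (j : ZMod 2) : Set (Module.End k (Disk R)) :=
  {X | IsSuperDerivation j X ∧ ∀ r : R, X (const r) = 0}

/-- The superdivergence `∂_t A₀ + (-1)^{|A₁|} ∂_{θ¹} A₁ + (-1)^{|A₂|} ∂_{θ²} A₂` of a vector field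
`X = A₀ ∂_t + A₁ ∂_{θ¹} + A₂ ∂_{θ²}` of parity `j`, so that `A₁` and `A₂` have parity `j + 1`. -/
def sdiv {k : Type u} {R : Type v} [Field k] [Ring R] [Module k R] [Parity R]
    (j : ZMod 2) (X : Module.End k (Disk R)) : Disk R :=
  partialD 0 (X (gen 0)) + (-1) ^ (j + 1).val * partialD 1 (X (gen 1))
    + (-1) ^ (j + 1).val * partialD 2 (X (gen 2))

/-- The homogeneous elements of parity `j` of the Lie superalgebra `S(1|2)` of divergence free
vector fields. -/
def S12 (j : ZMod 2) : Set (Module.End k (Disk R)) :=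
  {X | X ∈ Der k R j ∧ sdiv j X = 0}

/-- The derived algebra `S(2) = [S(1|2), S(1|2)]`. -/
def S2 : Submodule k (Module.End k (Disk R)) :=
  Submodule.span k {Z | ∃ (i j : ZMod 2) (X Y : Module.End k (Disk R)),
    X ∈ S12 k R i ∧ Y ∈ S12 k R j ∧ Z = X * Y - (-1) ^ (i.val * j.val) * (Y * X)}

/-- The even elements of `S(2)` that map `𝔪` to `𝔪²`, that is, those with an exponential in the
prounipotent group of automorphisms that are the identity modulo `𝔪²`. -/
def S2plus : Set (Module.End k (Disk R)) :=
  {X | X ∈ S2 k R ∧ X ∈ Der k R 0 ∧ ∀ f ∈ maxPow (R := R) 1, X f ∈ maxPow (R := R) 2}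

/-- `E = exp(X)`, the `𝔪`-adic sum of `Xⁿ / n!`, for `X` with `X 𝔪 ⊆ 𝔪²`: as `Xⁿ` takes values in
`𝔪ⁿ`, the first `N` terms determine the sum modulo `𝔪^N`. -/
def IsExp {k : Type u} {R : Type v} [Field k] [Ring R] [Module k R] [Parity R]
    (X : Module.End k (Disk R)) (E : Disk R ≃+* Disk R) : Prop :=
  ∀ (f : Disk R) (N : ℕ),
    E f - ∑ n ∈ Finset.range N, ((n.factorial : k)⁻¹ • (X ^ n) f) ∈ maxPow (R := R) N

/-- The group `Aut^Δ(R[[1|2]])` of automorphisms `exp(X) ∘ T` with `X ∈ S(2)₊` and `T` a linear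
automorphism of Berezinian `1`. -/
def autDelta : Set (Disk R ≃+* Disk R) :=
  {Φ | ∃ X ∈ S2plus k R, ∃ T ∈ autBerLinear R, ∃ E : Disk R ≃+* Disk R,
    IsAut E ∧ IsExp X E ∧ ∀ f, Φ f = E (T f)}

end Disk

/-! ### Superspaces and relative super curves -/

/-- A superspace over `k`: a topological space with a sheaf of supercommutative `k`-superalgebras.
Super schemes and complex superspaces are examples. -/
structure SuperSpace (k : Type u) [Field k] where
  top : TopCat.{u}
  sheaf : TopCat.Sheaf (AlgCat.{u} k) top
  /-- the parity involution of the structure sheaf -/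
  parity : sheaf.presheaf ⟶ sheaf.presheaf
  parity_comp : parity ≫ parity = 𝟙 _
  supercomm : ∀ U : Opens top,
    @IsSupercommutative (sheaf.presheaf.obj (op U)) _
      { inv := (parity.app (op U)).hom.toRingHom
        inv_inv := fun a => by
          have h := congrArg (fun φ => (φ.app (op U)).hom a) parity_comp
          exact h }

namespace SuperSpace

variable {k : Type u} [Field k] (C : SuperSpace k)

/-- The superalgebra `𝒪_C(U)`. -/
abbrev Sec (U : Opens C.top) : Type u := C.sheaf.presheaf.obj (op U)

instance (U : Opens C.top) : Parity (C.Sec U) where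
  inv := (C.parity.app (op U)).hom.toRingHom
  inv_inv a := by
    have h := congrArg (fun φ => (φ.app (op U)).hom a) C.parity_comp
    exact h

variable {C}

/-- Restriction of functions. -/
def res {U V : Opens C.top} (h : V ≤ U) : C.Sec U →ₐ[k] C.Sec V :=
  (C.sheaf.presheaf.map (homOfLE h).op).hom

theorem res_res {U V W : Opens C.top} (h : V ≤ U) (h' : W ≤ V) (f : C.Sec U) :
    res h' (res h f) = res (h'.trans h) f := by
  have := C.sheaf.presheaf.map_comp (homOfLE h).op (homOfLE h').op
  have h2 := congrArg (fun φ => φ.hom f) this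
  exact h2.symm

theorem res_inv {U V : Opens C.top} (h : V ≤ U) (f : C.Sec U) :
    res h (Parity.inv f) = Parity.inv (res h f) := by
  have := C.parity.naturality (homOfLE h).op
  have h2 := congrArg (fun φ => φ.hom f) this
  exact h2.symm

theorem res_hasParity {U V : Opens C.top} (h : V ≤ U) {j : ZMod 2} {f : C.Sec U}
    (hf : HasParity j f) : HasParity j (res h f) := by
  unfold HasParity at *
  rw [← res_inv, hf]
  simp

/-- A morphism of superspaces. -/
structure Hom (C S : SuperSpace k) where
  base : C.top ⟶ S.top
  comap : S.sheaf.presheaf ⟶ (TopCat.Presheaf.pushforward (AlgCat.{u} k) base).obj C.sheaf.presheaf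
  comap_parity : ∀ (W : Opens S.top) (s : S.Sec W),
    (comap.app (op W)).hom (Parity.inv s) =
      Parity.inv (A := C.Sec ((Opens.map base).obj W)) ((comap.app (op W)).hom s)

/-- The function `π^* s` on `π⁻¹(W)`, for a function `s` on `W ⊆ S`. -/
def Hom.pull {S : SuperSpace k} (π : Hom C S) {W : Opens S.top} (s : S.Sec W) :
    C.Sec ((Opens.map π.base).obj W) :=
  (π.comap.app (op W)).hom s

end SuperSpace

open SuperSpace

variable {k : Type u} [Field k] {C S : SuperSpace k}

/-- The homogeneous sections over `U` of parity `j` of the relative tangent sheaf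
`𝒯_{C/S} = Der_{𝒪_S}(𝒪_C)`. -/
structure VectorField (π : Hom C S) (U : Opens C.top) (j : ZMod 2) where
  app : ∀ V : Opens C.top, V ≤ U → (C.Sec V →ₗ[k] C.Sec V)
  app_res : ∀ (V W : Opens C.top) (hV : V ≤ U) (hW : W ≤ V) (f : C.Sec V),
    app W (hW.trans hV) (res hW f) = res hW (app V hV f)
  isSuperDerivation : ∀ (V : Opens C.top) (hV : V ≤ U), IsSuperDerivation j (app V hV)
  relative : ∀ (V : Opens C.top) (hV : V ≤ U) (W : Opens S.top)
    (hW : V ≤ (Opens.map π.base).obj W) (s : S.Sec W), app V hV (res hW (π.pull s)) = 0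

/-- Restriction of a vector field to a smaller open set. -/
def VectorField.restrict {π : Hom C S} {U : Opens C.top} {j : ZMod 2} (D : VectorField π U j)
    {V : Opens C.top} (h : V ≤ U) : VectorField π V j where
  app W hW := D.app W (hW.trans h)
  app_res _ _ hV hW f := D.app_res _ _ (hV.trans h) hW f
  isSuperDerivation _ hV := D.isSuperDerivation _ (hV.trans h)
  relative _ hV _ hW s := D.relative _ (hV.trans h) _ hW s

/-- A relative coordinate system `(z | θ¹, θ²)` on `U`: one even and two odd functions such that
`𝒯_{C/S}` is free over `U` with basis `∂_z | ∂_{θ¹}, ∂_{θ²}` dual to `dz | dθ¹, dθ²`. Freeness is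
expressed by the existence of the dual vector fields and by the fact that a vector field is
determined by its values on the coordinates, so that `D = ∑ D(xᵢ) ∂ᵢ`. -/
structure Coords (π : Hom C S) (U : Opens C.top) where
  x : Fin 3 → C.Sec U
  parity : ∀ i, HasParity (par i) (x i)
  partialD : ∀ i, VectorField π U (par i)
  dual : ∀ i j, (partialD i).app U le_rfl (x j) = if i = j then 1 else 0
  unique : ∀ (V : Opens C.top) (hV : V ≤ U) (j : ZMod 2) (D : VectorField π V j),
    (∀ i, D.app V le_rfl (res hV (x i)) = 0) →
      ∀ (W : Opens C.top) (hW : W ≤ V) (f : C.Sec W), D.app W hW f = 0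

/-- Restriction of coordinates to a smaller open set. -/
def Coords.restrict {π : Hom C S} {U : Opens C.top} (x : Coords π U) {V : Opens C.top}
    (h : V ≤ U) : Coords π V where
  x i := res h (x.x i)
  parity i := res_hasParity h (x.parity i)
  partialD i := (x.partialD i).restrict h
  dual i j := by
    have h1 := (x.partialD i).app_res U V le_rfl h (x.x j)
    rw [x.dual i j] at h1
    change (x.partialD i).app V _ (res h (x.x j)) = _
    rw [h1]
    split_ifs <;> simp
  unique W hW j D hD := by
    refine x.unique W (hW.trans h) j D fun i => ?_
    rw [← res_res h hW]
    exact hD i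

/-- `C → S` is a super curve of relative dimension `1|2`. -/
def IsSuperCurve (π : Hom C S) : Prop :=
  ∀ p : C.top, ∃ U : Opens C.top, p ∈ U ∧ Nonempty (Coords π U)

/-- The Berezinian `Ber(∂y/∂x)` of the Jacobian `(∂yⱼ/∂xᵢ)` of a change of coordinates. -/
def Coords.berJacobian {π : Hom C S} {U : Opens C.top} (x y : Coords π U) : C.Sec U :=
  berezinian (Matrix.of fun i j => (x.partialD i).app U le_rfl (y.x j))

/-- An even global section `Δ` of the Berezinian sheaf `Ber_{C/S} = Ber(Ω_{C/S})`, the invertible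
sheaf with local generators `[dz | dθ¹ dθ²]` and `[dy] = Ber(∂y/∂x) [dx]`: in any coordinates
`Δ = coeff x [dx]`. -/
structure BerSection (π : Hom C S) where
  coeff : ∀ {U : Opens C.top}, Coords π U → C.Sec U
  even : ∀ {U : Opens C.top} (x : Coords π U), HasParity 0 (coeff x)
  coeff_res : ∀ {U V : Opens C.top} (h : V ≤ U) (x : Coords π U),
    coeff (x.restrict h) = res h (coeff x)
  change : ∀ {U : Opens C.top} (x y : Coords π U), coeff x = coeff y * x.berJacobian y

variable {π : Hom C S}

/-- `Δ` is nonvanishing, that is, it trivializes the Berezinian sheaf. -/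
def BerSection.Nonvanishing (Δ : BerSection π) : Prop :=
  ∀ {U : Opens C.top} (x : Coords π U), IsUnit (Δ.coeff x)

/-- The coordinates on `U` compatible with `Δ`: those with `Δ = [dz | dθ¹ dθ²]`. -/
def BerSection.Compatible (Δ : BerSection π) (U : Opens C.top) : Type u :=
  {x : Coords π U // Δ.coeff x = 1}

/-- Restriction of compatible coordinates. -/
def BerSection.Compatible.restrict {Δ : BerSection π} {U V : Opens C.top}
    (x : Δ.Compatible U) (h : V ≤ U) : Δ.Compatible V :=
  ⟨x.1.restrict h, by rw [Δ.coeff_res, x.2, map_one]⟩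

/-! ### Changes of coordinates as formal automorphisms -/

/-- The Taylor expansion `f(z + t | θ¹ + τ¹, θ² + τ²)` of a function `f` on `U` in the coordinates
`x = (z | θ¹, θ²)`, as an element of `R[[1|2]]` with `R = 𝒪_C(U)`:
`∑ tⁿ/n! (∂_zⁿ f + τ¹ ∂_{θ¹} ∂_zⁿ f + τ² ∂_{θ²} ∂_zⁿ f + τ¹ τ² ∂_{θ²} ∂_{θ¹} ∂_zⁿ f)`.
Moving the odd `τⁱ` to the right of its coefficient applies the parity involution to it. -/
def Coords.taylor {U : Opens C.top} (x : Coords π U) (f : C.Sec U) : Disk (C.Sec U) :=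
  let d : Fin 3 → C.Sec U → C.Sec U := fun i => (x.partialD i).app U le_rfl
  let dn : ℕ → C.Sec U := fun n => (n.factorial : k)⁻¹ • (d 0)^[n] f
  ⟨⟨PowerSeries.mk dn, PowerSeries.mk fun n => Parity.inv (d 1 (dn n))⟩,
    ⟨PowerSeries.mk fun n => Parity.inv (d 2 (dn n)), PowerSeries.mk fun n => d 2 (d 1 (dn n))⟩⟩

/-- The change of coordinates `y ∘ x⁻¹`, expanded at every point of `U`, lies in `Aut^Δ[[1|2]]`.
The expansion is taken at the universal point of `U`, so it is the automorphism of `R[[1|2]]`,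
`R = 𝒪_C(U)`, that maps the `j`-th generator to the Taylor expansion `y_j(x + (t|τ)) - y_j(x)`. -/
def Coords.ChangeInAutDelta {U : Opens C.top} (x y : Coords π U) : Prop :=
  ∃ Φ ∈ Disk.autDelta k (C.Sec U), ∀ j, Φ (Disk.gen j) = x.taylor (y.x j) - Disk.const (y.x j)

/-- `(C, Δ)` is an `S(2)`-super curve: there is an atlas of coordinates compatible with `Δ` whose
changes of coordinates are in `Aut^Δ[[1|2]]`. -/
def IsS2SuperCurve (Δ : BerSection π) : Prop :=
  ∃ 𝒜 : Set (Σ U : Opens C.top, Δ.Compatible U),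
    (∀ p : C.top, ∃ a ∈ 𝒜, p ∈ a.1) ∧
    ∀ a ∈ 𝒜, ∀ b ∈ 𝒜,
      (a.2.restrict (inf_le_left : a.1 ⊓ b.1 ≤ a.1)).1.ChangeInAutDelta
        (b.2.restrict (inf_le_right : a.1 ⊓ b.1 ≤ b.1)).1

/-! ### The torsor `Aut^Δ[[1|2]] \ Aut^δ_C` -/

/-- The points over `p` of the bundle `Aut^δ_C` of coordinates: local coordinate systems around `p`
that are compatible with `Δ`. -/
def CoordsAt (Δ : BerSection π) (p : C.top) : Type u :=
  Σ U : {U : Opens C.top // p ∈ U}, Δ.Compatible U.1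

/-- Two coordinate systems around `p` differ by an element of `Aut^Δ[[1|2]]` near `p`. -/
def CoordsAt.Rel {Δ : BerSection π} {p : C.top} (a b : CoordsAt Δ p) : Prop :=
  ∃ (W : Opens C.top) (ha : W ≤ a.1.1) (hb : W ≤ b.1.1), p ∈ W ∧
    (a.2.restrict ha).1.ChangeInAutDelta (b.2.restrict hb).1

/-- The fibre over `p` of `Aut^Δ[[1|2]] \ Aut^δ_C`. -/
def Fibre (Δ : BerSection π) (p : C.top) : Type u :=
  Quot (CoordsAt.Rel (Δ := Δ) (p := p))

/-- The class at `p` of compatible coordinates. -/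
def BerSection.Compatible.germ {Δ : BerSection π} {U : Opens C.top} (x : Δ.Compatible U)
    {p : C.top} (hp : p ∈ U) : Fibre Δ p :=
  Quot.mk _ ⟨⟨U, hp⟩, x⟩

/-- The sections over `U` of `Aut^Δ[[1|2]] \ Aut^δ_C`: families of classes that are locally
represented by compatible coordinates. -/
def TorsorSection (Δ : BerSection π) (U : Opens C.top) : Type u :=
  {s : ∀ p : C.top, p ∈ U → Fibre Δ p // ∀ p ∈ U, ∃ (V : Opens C.top) (x : Δ.Compatible V),
    p ∈ V ∧ ∀ (q : C.top) (hV : q ∈ V) (hU : q ∈ U), s q hU = x.germ hV}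

/-- Restriction of sections. -/
def TorsorSection.restrict {Δ : BerSection π} {U : Opens C.top} (s : TorsorSection Δ U)
    {V : Opens C.top} (h : V ≤ U) : TorsorSection Δ V :=
  ⟨fun p hp => s.1 p (h hp), fun p hp => by
    obtain ⟨W, x, hpW, hx⟩ := s.2 p (h hp)
    exact ⟨W, x, hpW, fun q hW hV => hx q hW (h hV)⟩⟩

/-- The structure group `𝔾_a` of the torsor: the sheaf of even relative constants, the functions
annihilated by all relative vector fields. It is the even part of `π⁻¹𝒪_S` when functions on `C`
that are constant along the fibres locally come from `S`. -/
def relativeConstants (π : Hom C S) (U : Opens C.top) : AddSubgroup (C.Sec U) where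
  carrier := {f | HasParity 0 f ∧ ∀ (V : Opens C.top) (hV : V ≤ U) (j : ZMod 2)
    (D : VectorField π V j), D.app V le_rfl (res hV f) = 0}
  zero_mem' := ⟨by simp [HasParity], fun V hV j D => by simp⟩
  add_mem' := fun {a b} ha hb => by
    refine ⟨?_, fun V hV j D => by simp [ha.2 V hV j D, hb.2 V hV j D]⟩
    have h1 := ha.1
    have h2 := hb.1
    simp only [HasParity, ZMod.val_zero, pow_zero, one_mul] at *
    rw [map_add, h1, h2]
  neg_mem' := fun {a} ha => by
    refine ⟨?_, fun V hV j D => by simp [ha.2 V hV j D]⟩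
    have h1 := ha.1
    simp only [HasParity, ZMod.val_zero, pow_zero, one_mul] at *
    rw [map_neg, h1]

/-- Restriction of relative constants. -/
def restrictConstant {U V : Opens C.top} (h : V ≤ U) (c : relativeConstants π U) :
    relativeConstants π V :=
  ⟨res h c.1, res_hasParity h c.2.1, fun W hW j D => by
    rw [res_res]
    exact c.2.2 W (hW.trans h) j D⟩

/-- `s' = c • s` for the action of `𝔾_a = Aut^δ[[1|2]] / Aut^Δ[[1|2]]` on the torsor, in which the
constant `c` acts through `exp(c θ¹ θ² ∂_z)`: around every point there are coordinates
`(z | θ¹, θ²)` representing `s` such that `(z + c θ¹ θ² | θ¹, θ²)` represents `s'`. -/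
def IsTranslate {Δ : BerSection π} {U : Opens C.top} (c : relativeConstants π U)
    (s s' : TorsorSection Δ U) : Prop :=
  ∀ p ∈ U, ∃ (V : Opens C.top) (hV : V ≤ U) (x y : Δ.Compatible V), p ∈ V ∧
    (∀ (q : C.top) (hq : q ∈ V), s.1 q (hV hq) = x.germ hq ∧ s'.1 q (hV hq) = y.germ hq) ∧
    y.1.x 0 = x.1.x 0 + res hV c.1 * (x.1.x 1 * x.1.x 2) ∧
    y.1.x 1 = x.1.x 1 ∧ y.1.x 2 = x.1.x 2

/-- The `𝔾_a`-torsor `Aut^Δ[[1|2]] \ Aut^δ_C → C` is trivial: there is an equivariant isomorphism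
of sheaves from `𝔾_a`, acting on itself by translations, to the sheaf of its sections. -/
def IsTrivialTorsor (Δ : BerSection π) : Prop :=
  ∃ e : ∀ U : Opens C.top, relativeConstants π U → TorsorSection Δ U,
    (∀ U, Function.Bijective (e U)) ∧
    (∀ (U V : Opens C.top) (h : V ≤ U) (c : relativeConstants π U),
      e V (restrictConstant h c) = (e U c).restrict h) ∧
    ∀ (U : Opens C.top) (c d : relativeConstants π U), IsTranslate c (e U d) (e U (c + d))

end

end SuperCurve

/-! The obstruction for a change between compatible coordinates `x`, `y` to lie in `Aut^Δ` is one
function, the flux: the coefficient of `θ¹θ²`, in the coordinates `x`, of the `∂_{x₀}`-component of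
the field `y₀ ∂_{y₀}`. Extracting this coefficient is the Berezin integral `top = ∂_{θ²} ∂_{θ¹}`. It
annihilates odd derivatives, so `∂_z top(V x₀) = top(div V)` for every even field `V`.

Two facts turn the flux into a cocycle of relative constants. The field `y₀ ∂_{y₀}` has divergence
`1` in every compatible coordinate system (`div_scaling`), by the formula for the logarithmic
derivative of a Berezinian (`berezinian_derivation`). If `V` is even and divergence free, then
`top(V x₀)` is the same in all compatible coordinates (`BerSection.Compatible.top_eq`). The first
fact makes the flux a relative constant (`flux_mem`); the second, applied to a difference of two
scaling fields, gives additivity (`flux_add_flux`).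

On the formal side, the Taylor expansion of a change of coordinates factors as `exp(X) ∘ T` with `T`
its linear part (`exists_log`), and Berezinian `1` forces `div X = 0`
(`div_eq_zero_of_berJacobian`). The even elements of `S(2)` are exactly the even divergence free
fields whose `∂_t`-component has no `θ¹θ²`-term (`div_and_top_of_mem_S2`, `mem_S2_of_div`). That
term of `X` equals the flux (`tau_exp_comp`, `tau_changeOfCoords`). So the change is in `Aut^Δ` if
and only if its flux vanishes (`changeInAutDelta_iff`).

Hence a global section of the torsor amounts to an atlas with vanishing fluxes. Relative to such an
atlas every section is measured by its flux, an even relative constant, and `z ↦ z + c θ¹θ²` changes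
the flux by `c`; this is the trivialization.

The vector calculus is needed both on `𝒪_C(U)` and on `R[[1|2]]`; the structure `Frame` covers the
two cases at once. -/

namespace SuperCurve
noncomputable section

/-! ### Supercommutativity, its passage to power series and Grassmann algebras, and frames. -/

/-- Supercommutativity in a form that does not mention homogeneous components. -/
class SuperComm (A : Type v) [Ring A] [Parity A] : Prop where
  even_comm : ∀ a : A, Parity.inv a = a → ∀ b, a * b = b * a
  odd_mul : ∀ a : A, Parity.inv a = -a → ∀ b, a * b = Parity.inv b * a
  two_torsion : ∀ a : A, a + a = 0 → a = 0

section Basic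

variable {A : Type v} [Ring A] [Parity A]

theorem hasParity_zero_iff {a : A} : HasParity 0 a ↔ Parity.inv a = a := by
  simp [HasParity]

theorem hasParity_one_iff {a : A} : HasParity 1 a ↔ Parity.inv a = -a := by
  simp [HasParity, ZMod.val_one]

theorem ZMod.two_cases (j : ZMod 2) : j = 0 ∨ j = 1 := by
  revert j; decide

theorem even_comm [SuperComm A] {a : A} (ha : Parity.inv a = a) (b : A) : a * b = b * a :=
  SuperComm.even_comm a ha b

theorem odd_mul [SuperComm A] {a : A} (ha : Parity.inv a = -a) (b : A) :
    a * b = Parity.inv b * a := SuperComm.odd_mul a ha b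

theorem odd_anticomm [SuperComm A] {a b : A} (ha : Parity.inv a = -a) (hb : Parity.inv b = -b) :
    a * b = -(b * a) := by rw [odd_mul ha, hb, neg_mul]

theorem odd_sq [SuperComm A] {a : A} (ha : Parity.inv a = -a) : a * a = 0 :=
  SuperComm.two_torsion _ (by nth_rewrite 1 [odd_anticomm ha ha]; simp)

/-- Up to the factor `2`, the even and odd parts of `b` are `b + inv b` and `b - inv b`. The
homogeneous identities for these two, added or subtracted, give twice the required identity. -/
theorem SuperComm.of_isSupercommutative (k : Type u) [Field k] [CharZero k] [Algebra k A]
    (h : IsSupercommutative A) : SuperComm A := by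
  have half : ∀ a : A, ((2 : k)⁻¹ • (a + a)) = a := fun a => by
    rw [← two_smul k a, smul_smul, inv_mul_cancel₀ two_ne_zero, one_smul]
  have tt : ∀ a : A, a + a = 0 → a = 0 := fun a ha => by rw [← half a, ha, smul_zero]
  have two_inj : ∀ a b : A, a + a = b + b → a = b := fun a b hab => by
    rw [← half a, hab, half]
  refine ⟨fun a ha b => ?_, fun a ha b => ?_, tt⟩
  · have h0 := h 0 0 a (b + Parity.inv b) (hasParity_zero_iff.2 ha)
      (hasParity_zero_iff.2 (by rw [map_add, Parity.inv_inv, add_comm]))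
    have h1 := h 0 1 a (b - Parity.inv b) (hasParity_zero_iff.2 ha)
      (hasParity_one_iff.2 (by rw [map_sub, Parity.inv_inv]; abel))
    simp only [ZMod.val_zero, zero_mul, pow_zero, one_mul] at h0 h1
    apply two_inj
    have := congrArg₂ (· + ·) h0 h1
    simp only [mul_add, add_mul, mul_sub, sub_mul] at this
    calc a * b + a * b = _ := by abel
      _ = _ := this.symm
      _ = _ := by abel
  · have h0 := h 1 0 a (b + Parity.inv b) (hasParity_one_iff.2 ha)
      (hasParity_zero_iff.2 (by rw [map_add, Parity.inv_inv, add_comm]))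
    have h1 := h 1 1 a (b - Parity.inv b) (hasParity_one_iff.2 ha)
      (hasParity_one_iff.2 (by rw [map_sub, Parity.inv_inv]; abel))
    simp only [ZMod.val_zero, ZMod.val_one, mul_zero, mul_one, pow_zero, pow_one, one_mul] at h0 h1
    apply two_inj
    have := congrArg₂ (· - ·) h0 h1
    simp only [mul_add, add_mul, mul_sub, sub_mul, neg_mul, one_mul] at this
    calc a * b + a * b = _ := by abel
      _ = _ := this.symm
      _ = _ := by abel

/-- `inv` is `k`-linear and `A` is a `k`-algebra, where only the module structure is bundled. -/
class SuperAlg (k : Type u) (A : Type v) [Field k] [Ring A] [Module k A] [Parity A] : Prop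
    extends IsScalarTower k A A, SMulCommClass k A A, SuperComm A where
  inv_smul : ∀ (c : k) (a : A), Parity.inv (c • a) = c • Parity.inv a

end Basic

section PowerSeries

variable {R : Type v} [Ring R] [Parity R]

@[simp] theorem coeff_inv (n : ℕ) (f : PowerSeries R) :
    PowerSeries.coeff n (Parity.inv f) = Parity.inv (PowerSeries.coeff n f) :=
  PowerSeries.coeff_map _ _ _

instance [SuperComm R] : SuperComm (PowerSeries R) where
  even_comm f hf g := by
    have h : ∀ n, Parity.inv (PowerSeries.coeff n f) = PowerSeries.coeff n f := fun n => by
      rw [← coeff_inv, hf]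
    ext n
    rw [PowerSeries.coeff_mul, PowerSeries.coeff_mul, ← Finset.Nat.sum_antidiagonal_swap]
    exact Finset.sum_congr rfl fun p _ => even_comm (h _) _
  odd_mul f hf g := by
    have h : ∀ n, Parity.inv (PowerSeries.coeff n f) = -PowerSeries.coeff n f := fun n => by
      rw [← coeff_inv, hf, map_neg]
    ext n
    rw [PowerSeries.coeff_mul, PowerSeries.coeff_mul, ← Finset.Nat.sum_antidiagonal_swap]
    exact Finset.sum_congr rfl fun p _ => by rw [coeff_inv]; exact odd_mul (h _) _
  two_torsion f hf := by
    ext n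
    exact SuperComm.two_torsion _ (by rw [← map_add, hf, map_zero])

instance {k : Type u} [Field k] [Module k R] [SuperAlg k R] : SuperAlg k (PowerSeries R) where
  smul_assoc c f g := by
    ext n
    simp [PowerSeries.coeff_mul, Finset.smul_sum, smul_mul_assoc]
  smul_comm c f g := by
    ext n
    simp [PowerSeries.coeff_mul, Finset.smul_sum, mul_smul_comm]
  inv_smul c f := by
    ext n
    simp [SuperAlg.inv_smul]

end PowerSeries

section Grassmann

variable {A : Type v} [Ring A] [Parity A]

@[simp] theorem Grassmann.fst_inv (f : Grassmann A) :
    (Parity.inv f).fst = Parity.inv f.fst := rfl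
@[simp] theorem Grassmann.snd_inv (f : Grassmann A) :
    (Parity.inv f).snd = -Parity.inv f.snd := rfl

instance [SuperComm A] : SuperComm (Grassmann A) where
  even_comm f hf g := by
    have h0 : Parity.inv f.fst = f.fst := congrArg Grassmann.fst hf
    have h1 : Parity.inv f.snd = -f.snd := by
      rw [← neg_eq_iff_eq_neg]; exact congrArg Grassmann.snd hf
    ext
    · exact even_comm h0 _
    · simp only [Grassmann.snd_mul, h0]
      rw [even_comm h0, odd_mul h1, Parity.inv_inv, add_comm]
  odd_mul f hf g := by
    have h0 : Parity.inv f.fst = -f.fst := congrArg Grassmann.fst hf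
    have h1 : Parity.inv f.snd = f.snd := neg_injective (congrArg Grassmann.snd hf)
    ext
    · exact odd_mul h0 _
    · simp only [Grassmann.snd_mul, Grassmann.fst_inv, Grassmann.snd_inv, h0, neg_mul_neg]
      rw [even_comm h1, odd_mul h0, add_comm]
  two_torsion f hf := by
    ext
    · exact SuperComm.two_torsion _ (congrArg Grassmann.fst hf)
    · exact SuperComm.two_torsion _ (congrArg Grassmann.snd hf)

instance {k : Type u} [Field k] [Module k A] [SuperAlg k A] : SuperAlg k (Grassmann A) where
  smul_assoc c f g := by
    ext <;> simp [smul_mul_assoc]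
  smul_comm c f g := by
    ext <;> simp [mul_smul_comm, SuperAlg.inv_smul]
  inv_smul c f := by
    ext <;> simp [SuperAlg.inv_smul]

end Grassmann

/-! ### Frames -/

section Frame

/-- The sign `(-1)^{|xᵢ|}`. -/
def sg : Fin 3 → ℤ := ![1, -1, -1]

@[simp] theorem sg_zero : sg 0 = 1 := rfl
@[simp] theorem sg_one : sg 1 = -1 := rfl
@[simp] theorem sg_two : sg 2 = -1 := rfl

variable {A : Type v} [Ring A] [Parity A]

/-- The `|xᵢ|`-th power of the parity involution. -/
def tw (i : Fin 3) : A →+* A := (![RingHom.id A, Parity.inv, Parity.inv] : Fin 3 → A →+* A) i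

@[simp] theorem tw_zero (a : A) : tw 0 a = a := rfl
@[simp] theorem tw_one (a : A) : tw 1 a = Parity.inv a := rfl
@[simp] theorem tw_two (a : A) : tw 2 a = Parity.inv a := rfl

variable (A) in
/-- Coordinates `(x₀ | x₁, x₂)` on `A` with their dual partial derivatives. -/
structure Frame where
  d : Fin 3 → A →+ A
  x : Fin 3 → A
  inv_x : ∀ i, Parity.inv (x i) = sg i • x i
  inv_d : ∀ i a, Parity.inv (d i a) = sg i • d i (Parity.inv a)
  d_mul : ∀ i a b, d i (a * b) = d i a * b + tw i a * d i b
  d_comm : ∀ i a, d 0 (d i a) = d i (d 0 a)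
  d_anti : ∀ i j a, i ≠ 0 → j ≠ 0 → d i (d j a) = -d j (d i a)
  d_x : ∀ i j, d i (x j) = if i = j then 1 else 0

end Frame

end

end SuperCurve

/-! ### Vector fields, divergence and Berezin integral in a frame. -/

namespace SuperCurve
noncomputable section

namespace Frame

variable {A : Type v} [Ring A] [Parity A] (F : Frame A)

theorem inv_x0 : Parity.inv (F.x 0) = F.x 0 := by simpa using F.inv_x 0
theorem inv_x1 : Parity.inv (F.x 1) = -F.x 1 := by simpa using F.inv_x 1
theorem inv_x2 : Parity.inv (F.x 2) = -F.x 2 := by simpa using F.inv_x 2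

theorem d_one (i : Fin 3) : F.d i 1 = 0 := by
  have := F.d_mul i 1 1
  simpa using this

theorem d_d_self [SuperComm A] {i : Fin 3} (hi : i ≠ 0) (a : A) : F.d i (F.d i a) = 0 :=
  SuperComm.two_torsion _ (by nth_rewrite 1 [F.d_anti i i a hi hi]; simp)

/-- The coefficient of `x₁ x₂`. -/
def top (a : A) : A := F.d 2 (F.d 1 a)

theorem top_add (a b : A) : F.top (a + b) = F.top a + F.top b := by simp [top]
theorem top_sub (a b : A) : F.top (a - b) = F.top a - F.top b := by simp [top]
theorem top_neg (a : A) : F.top (-a) = -F.top a := by simp [top]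
theorem top_zero : F.top 0 = 0 := by simp [top]

/-- Integration by parts for the Berezin integral: odd derivatives anticommute and square to zero,
so an odd derivative has no `θ¹θ²`-term. -/
theorem top_d1 [SuperComm A] (a : A) : F.top (F.d 1 a) = 0 := by
  simp [top, F.d_d_self]

theorem top_d2 [SuperComm A] (a : A) : F.top (F.d 2 a) = 0 := by
  rw [top, F.d_anti 1 2 _ (by decide) (by decide), map_neg, F.d_d_self (by decide), neg_zero]

theorem d0_top (a : A) : F.d 0 (F.top a) = F.top (F.d 0 a) := by
  simp [top, F.d_comm]

theorem d1_top [SuperComm A] (a : A) : F.d 1 (F.top a) = 0 := by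
  rw [top, F.d_anti 1 2 _ (by decide) (by decide), F.d_d_self (by decide), map_zero, neg_zero]

theorem d2_top [SuperComm A] (a : A) : F.d 2 (F.top a) = 0 := by
  simp [top, F.d_d_self]

theorem inv_top (a : A) : Parity.inv (F.top a) = F.top (Parity.inv a) := by
  simp [top, F.inv_d]

/-- Even vector fields. -/
structure IsEven (V : A → A) : Prop where
  inv_apply : ∀ a, Parity.inv (V a) = V (Parity.inv a)
  eq : ∀ a, V a = V (F.x 0) * F.d 0 a + V (F.x 1) * F.d 1 a + V (F.x 2) * F.d 2 a

/-- Odd vector fields. -/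
structure IsOdd (V : A → A) : Prop where
  inv_apply : ∀ a, Parity.inv (V a) = -V (Parity.inv a)
  eq : ∀ a, V a = V (F.x 0) * F.d 0 a + V (F.x 1) * F.d 1 a + V (F.x 2) * F.d 2 a

/-- The divergence of an even vector field. -/
def div (V : A → A) : A := F.d 0 (V (F.x 0)) - F.d 1 (V (F.x 1)) - F.d 2 (V (F.x 2))

/-- The divergence of an odd vector field. -/
def divOdd (V : A → A) : A := F.d 0 (V (F.x 0)) + F.d 1 (V (F.x 1)) + F.d 2 (V (F.x 2))

variable {F} {V U : A → A}

namespace IsEven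

variable (hV : F.IsEven V) (hU : F.IsEven U)
include hV

theorem map_add (a b : A) : V (a + b) = V a + V b := by
  rw [hV.eq (a + b), hV.eq a, hV.eq b]
  simp only [_root_.map_add, mul_add]
  abel

/-- An even vector field as an additive map. -/
def toHom : A →+ A := AddMonoidHom.mk' V hV.map_add

theorem map_neg (a : A) : V (-a) = -V a := _root_.map_neg hV.toHom a
theorem map_sub (a b : A) : V (a - b) = V a - V b := _root_.map_sub hV.toHom a b
theorem map_zero : V 0 = 0 := _root_.map_zero hV.toHom

theorem inv_apply0 : Parity.inv (V (F.x 0)) = V (F.x 0) := by rw [hV.inv_apply, F.inv_x0]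
theorem inv_apply1 : Parity.inv (V (F.x 1)) = -V (F.x 1) := by
  rw [hV.inv_apply, F.inv_x1, hV.map_neg]
theorem inv_apply2 : Parity.inv (V (F.x 2)) = -V (F.x 2) := by
  rw [hV.inv_apply, F.inv_x2, hV.map_neg]

/-- The twist `tw i a` in the Leibniz rule of an odd `d i` is undone by moving the odd coefficient
`V (F.x i)` past `a`. -/
theorem map_mul [SuperComm A] (a b : A) : V (a * b) = V a * b + a * V b := by
  have h1 : ∀ c, V (F.x 1) * Parity.inv c = c * V (F.x 1) := fun c => by
    rw [odd_mul hV.inv_apply1, Parity.inv_inv]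
  have h2 : ∀ c, V (F.x 2) * Parity.inv c = c * V (F.x 2) := fun c => by
    rw [odd_mul hV.inv_apply2, Parity.inv_inv]
  rw [hV.eq (a * b), hV.eq a, hV.eq b]
  simp only [F.d_mul, mul_add, add_mul, tw_zero, tw_one, tw_two, ← mul_assoc, h1, h2,
    even_comm hV.inv_apply0 a]
  abel

theorem map_one [SuperComm A] : V 1 = 0 := by
  have := hV.map_mul 1 1
  simpa using this

/-- Partial derivatives supercommute, so the commutator of `d i` with `V` only differentiates the
coefficients of `V`. -/
theorem d_apply [SuperComm A] (i : Fin 3) (a : A) : F.d i (V a) =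
    F.d i (V (F.x 0)) * F.d 0 a + F.d i (V (F.x 1)) * F.d 1 a + F.d i (V (F.x 2)) * F.d 2 a
      + V (F.d i a) := by
  rw [hV.eq a, hV.eq (F.d i a)]
  have c := F.d_comm
  have e := F.d_anti
  have e1 := F.d_d_self (i := 1) (by decide)
  have e2 := F.d_d_self (i := 2) (by decide)
  have e12 := fun a => F.d_anti 1 2 a (by decide) (by decide)
  fin_cases i
  · simp [F.d_mul, c]
    abel
  · simp [F.d_mul, c, e1, e12, hV.inv_apply0, hV.inv_apply1, hV.inv_apply2]
    abel
  · simp [F.d_mul, c, e2, e12, hV.inv_apply0, hV.inv_apply1, hV.inv_apply2]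
    abel

theorem inv_d_apply (i l : Fin 3) :
    Parity.inv (F.d i (V (F.x l))) = (sg i * sg l) • F.d i (V (F.x l)) := by
  rw [F.inv_d]
  fin_cases l
  · simp [hV.inv_apply0]
  · simp [hV.inv_apply1]
  · simp [hV.inv_apply2]

omit hV in
theorem of_inv (h : ∀ a, V a = V (F.x 0) * F.d 0 a + V (F.x 1) * F.d 1 a + V (F.x 2) * F.d 2 a)
    (h0 : Parity.inv (V (F.x 0)) = V (F.x 0)) (h1 : Parity.inv (V (F.x 1)) = -V (F.x 1))
    (h2 : Parity.inv (V (F.x 2)) = -V (F.x 2)) : F.IsEven V :=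
  ⟨fun a => by
    rw [h a, h (Parity.inv a)]
    simp [F.inv_d, h0, h1, h2], h⟩

include hU

/-- Both compositions contain the same terms `U (F.x i) * V (F.d i a)`, by `d_apply`; what survives
the subtraction is of first order. -/
theorem bracket [SuperComm A] : F.IsEven fun a => V (U a) - U (V a) where
  inv_apply a := by simp [hV.inv_apply, hU.inv_apply]
  eq a := by
    have h : ∀ {V U : A → A} (_ : F.IsEven V) (_ : F.IsEven U), V (U a) =
        (V (U (F.x 0)) * F.d 0 a + V (U (F.x 1)) * F.d 1 a + V (U (F.x 2)) * F.d 2 a)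
        + (U (F.x 0) * V (F.d 0 a) + U (F.x 1) * V (F.d 1 a) + U (F.x 2) * V (F.d 2 a)) := by
      intro V U hV hU
      rw [hU.eq a]
      simp only [hV.map_add, hV.map_mul]
      abel
    have e0 := fun a => hV.d_apply 0 a
    have e1 := fun a => hV.d_apply 1 a
    have e2 := fun a => hV.d_apply 2 a
    have hUVa := hU.eq (V a)
    rw [h hV hU, hUVa, e0, e1, e2, hU.eq (V (F.x 0)), hU.eq (V (F.x 1)), hU.eq (V (F.x 2))]
    simp only [mul_add, add_mul, sub_mul, mul_assoc]
    abel

/-- Transposed products of entries of two even supermatrices. -/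
theorem swap_d_apply [SuperComm A] (i l : Fin 3) :
    F.d i (V (F.x l)) * F.d l (U (F.x i)) =
      (sg i * sg l) • (F.d l (U (F.x i)) * F.d i (V (F.x l))) := by
  have h1 := hV.inv_d_apply i l
  have h2 := hU.inv_d_apply l i
  rw [mul_comm (sg l)] at h2
  have h : sg i * sg l = 1 ∨ sg i * sg l = -1 := by
    clear h1 h2
    revert i l
    decide
  rcases h with h|h <;> rw [h] at h1 h2 ⊢
  · rw [one_smul] at h1 ⊢
    exact even_comm h1 _
  · rw [neg_smul, one_smul] at h1 h2 ⊢
    exact odd_anticomm h1 h2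

/-- By `d_apply`, the terms quadratic in first derivatives are supertraces of the two products of
the Jacobian matrices of `V` and `U`; the supertrace is cyclic (`swap_d_apply`), so they cancel. -/
theorem div_bracket [SuperComm A] :
    F.div (fun a => V (U a) - U (V a)) = V (F.div U) - U (F.div V) := by
  simp only [div, _root_.map_sub, hV.map_sub, hU.map_sub]
  rw [hV.d_apply 0 (U (F.x 0)), hV.d_apply 1 (U (F.x 1)), hV.d_apply 2 (U (F.x 2)),
    hU.d_apply 0 (V (F.x 0)), hU.d_apply 1 (V (F.x 1)), hU.d_apply 2 (V (F.x 2))]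
  have s00 := hV.swap_d_apply hU 0 0
  have s11 := hV.swap_d_apply hU 1 1
  have s22 := hV.swap_d_apply hU 2 2
  have s01 := hV.swap_d_apply hU 0 1
  have s10 := hV.swap_d_apply hU 1 0
  have s02 := hV.swap_d_apply hU 0 2
  have s20 := hV.swap_d_apply hU 2 0
  have s12 := hV.swap_d_apply hU 1 2
  have s21 := hV.swap_d_apply hU 2 1
  simp only [sg_zero, sg_one, sg_two, mul_one, mul_neg, neg_neg, neg_smul, one_smul]
    at s00 s11 s22 s01 s10 s02 s20 s12 s21
  rw [s00, s11, s22, s01, s10, s02, s20, s12, s21]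
  abel

/-- This is `V g = div(g V) - g div V` for `g = U (F.x 0)`, arranged so that `top` kills the odd
derivatives. -/
theorem apply_eq [SuperComm A] : V (U (F.x 0)) = F.d 0 (U (F.x 0) * V (F.x 0))
    - F.d 1 (V (F.x 1) * U (F.x 0)) - F.d 2 (V (F.x 2) * U (F.x 0)) - U (F.x 0) * F.div V := by
  have h := hV.eq (U (F.x 0))
  have c := fun a => even_comm hU.inv_apply0 a
  rw [h, div, mul_sub, mul_sub, c, c, c, even_comm hU.inv_apply0]
  simp only [F.d_mul, tw_zero, tw_one, tw_two, hV.inv_apply1, hV.inv_apply2, neg_mul]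
  abel

/-- In `apply_eq` the `d 0`-terms of the two compositions agree and the odd derivatives integrate to
zero. For divergence free fields the right side vanishes, which is why brackets have no `θ¹θ²`-term
in their even component. -/
theorem top_bracket [SuperComm A] : F.top (V (U (F.x 0)) - U (V (F.x 0))) =
    F.top (V (F.x 0) * F.div U - U (F.x 0) * F.div V) := by
  rw [hV.apply_eq hU, hU.apply_eq hV, even_comm hU.inv_apply0 (V (F.x 0))]
  simp only [F.top_sub, F.top_d1, F.top_d2]
  abel

end IsEven

namespace IsOdd

variable (hV : F.IsOdd V) (hU : F.IsOdd U)
include hV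

theorem map_add (a b : A) : V (a + b) = V a + V b := by
  rw [hV.eq (a + b), hV.eq a, hV.eq b]
  simp only [_root_.map_add, mul_add]
  abel

/-- An odd vector field as an additive map. -/
def toHom : A →+ A := AddMonoidHom.mk' V hV.map_add

theorem map_neg (a : A) : V (-a) = -V a := _root_.map_neg hV.toHom a
theorem map_zero : V 0 = 0 := _root_.map_zero hV.toHom

theorem inv_apply0 : Parity.inv (V (F.x 0)) = -V (F.x 0) := by rw [hV.inv_apply, F.inv_x0]
theorem inv_apply1 : Parity.inv (V (F.x 1)) = V (F.x 1) := by
  rw [hV.inv_apply, F.inv_x1, hV.map_neg, neg_neg]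
theorem inv_apply2 : Parity.inv (V (F.x 2)) = V (F.x 2) := by
  rw [hV.inv_apply, F.inv_x2, hV.map_neg, neg_neg]

theorem map_mul [SuperComm A] (a b : A) : V (a * b) = V a * b + Parity.inv a * V b := by
  have h0 : ∀ c, V (F.x 0) * c = Parity.inv c * V (F.x 0) := odd_mul hV.inv_apply0
  have h1 : ∀ c, V (F.x 1) * c = c * V (F.x 1) := even_comm hV.inv_apply1
  have h2 : ∀ c, V (F.x 2) * c = c * V (F.x 2) := even_comm hV.inv_apply2
  rw [hV.eq (a * b), hV.eq a, hV.eq b]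
  simp only [F.d_mul, mul_add, add_mul, tw_zero, tw_one, tw_two, ← mul_assoc, h0 a,
    h1 (Parity.inv a), h2 (Parity.inv a)]
  abel

theorem d_apply [SuperComm A] (i : Fin 3) (a : A) : F.d i (V a) =
    F.d i (V (F.x 0)) * F.d 0 a + F.d i (V (F.x 1)) * F.d 1 a + F.d i (V (F.x 2)) * F.d 2 a
      + sg i • V (F.d i a) := by
  rw [hV.eq a, hV.eq (F.d i a)]
  have c := F.d_comm
  have e1 := F.d_d_self (i := 1) (by decide)
  have e2 := F.d_d_self (i := 2) (by decide)
  have e12 := fun a => F.d_anti 1 2 a (by decide) (by decide)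
  fin_cases i
  · simp [F.d_mul, c]
    abel
  · simp [F.d_mul, c, e1, e12, hV.inv_apply0, hV.inv_apply1, hV.inv_apply2]
    abel
  · simp [F.d_mul, c, e2, e12, hV.inv_apply0, hV.inv_apply1, hV.inv_apply2]
    abel

theorem inv_d_apply (i l : Fin 3) :
    Parity.inv (F.d i (V (F.x l))) = -(sg i * sg l) • F.d i (V (F.x l)) := by
  rw [F.inv_d]
  fin_cases l
  · simp [hV.inv_apply0]
  · simp [hV.inv_apply1]
  · simp [hV.inv_apply2]

include hU

theorem bracket [SuperComm A] : F.IsEven fun a => V (U a) + U (V a) where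
  inv_apply a := by simp [hV.inv_apply, hU.inv_apply, hV.map_neg, hU.map_neg]
  eq a := by
    have h : ∀ {V U : A → A} (_ : F.IsOdd V) (_ : F.IsOdd U), V (U a) =
        (V (U (F.x 0)) * F.d 0 a + V (U (F.x 1)) * F.d 1 a + V (U (F.x 2)) * F.d 2 a)
        + (-U (F.x 0) * V (F.d 0 a) + U (F.x 1) * V (F.d 1 a) + U (F.x 2) * V (F.d 2 a)) := by
      intro V U hV hU
      rw [hU.eq a]
      simp only [hV.map_add, hV.map_mul, hU.inv_apply0, hU.inv_apply1, hU.inv_apply2]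
      abel
    have e0 := fun a => hV.d_apply 0 a
    have e1 := fun a => hV.d_apply 1 a
    have e2 := fun a => hV.d_apply 2 a
    have hUVa := hU.eq (V a)
    rw [h hV hU, hUVa, e0, e1, e2, hU.eq (V (F.x 0)), hU.eq (V (F.x 1)), hU.eq (V (F.x 2))]
    simp only [mul_add, add_mul, neg_mul, mul_assoc, sg_zero, sg_one, sg_two, one_smul, neg_smul,
      mul_neg]
    abel

/-- Transposed products of entries of two odd supermatrices. -/
theorem swap_d_apply [SuperComm A] (i l : Fin 3) :
    F.d i (V (F.x l)) * F.d l (U (F.x i)) =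
      -(sg i * sg l) • (F.d l (U (F.x i)) * F.d i (V (F.x l))) := by
  have h1 := hV.inv_d_apply i l
  have h2 := hU.inv_d_apply l i
  rw [mul_comm (sg l)] at h2
  have h : sg i * sg l = -1 ∨ sg i * sg l = 1 := by
    clear h1 h2
    revert i l
    decide
  rcases h with h|h <;> rw [h] at h1 h2 ⊢
  · rw [neg_neg, one_smul] at h1 ⊢
    exact even_comm h1 _
  · rw [neg_smul, one_smul] at h1 h2 ⊢
    exact odd_anticomm h1 h2

theorem div_bracket [SuperComm A] :
    F.div (fun a => V (U a) + U (V a)) = V (F.divOdd U) + U (F.divOdd V) := by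
  simp only [div, divOdd, _root_.map_add, hV.map_add, hU.map_add]
  rw [hV.d_apply 0 (U (F.x 0)), hV.d_apply 1 (U (F.x 1)), hV.d_apply 2 (U (F.x 2)),
    hU.d_apply 0 (V (F.x 0)), hU.d_apply 1 (V (F.x 1)), hU.d_apply 2 (V (F.x 2))]
  have s00 := hV.swap_d_apply hU 0 0
  have s11 := hV.swap_d_apply hU 1 1
  have s22 := hV.swap_d_apply hU 2 2
  have s01 := hV.swap_d_apply hU 0 1
  have s10 := hV.swap_d_apply hU 1 0
  have s02 := hV.swap_d_apply hU 0 2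
  have s20 := hV.swap_d_apply hU 2 0
  have s12 := hV.swap_d_apply hU 1 2
  have s21 := hV.swap_d_apply hU 2 1
  simp only [sg_zero, sg_one, sg_two, mul_one, mul_neg, neg_neg, neg_smul, one_smul]
    at s00 s11 s22 s01 s10 s02 s20 s12 s21 ⊢
  rw [s00, s11, s22, s01, s10, s02, s20, s12, s21]
  abel

omit hU in
theorem apply_eq [SuperComm A] (b : A) : V b = F.d 0 (V (F.x 0) * b)
    + F.d 1 (V (F.x 1) * b) + F.d 2 (V (F.x 2) * b) - F.divOdd V * b := by
  have h := hV.eq (b)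
  rw [h, divOdd]
  simp only [F.d_mul, tw_zero, tw_one, tw_two, hV.inv_apply1, hV.inv_apply2, add_mul]
  abel

/-- Here the `d 0`-terms cancel because the even-direction components of odd fields are odd and
anticommute. -/
theorem top_bracket [SuperComm A] : F.top (V (U (F.x 0)) + U (V (F.x 0))) =
    -F.top (F.divOdd V * U (F.x 0) + F.divOdd U * V (F.x 0)) := by
  rw [hV.apply_eq (U (F.x 0)), hU.apply_eq (V (F.x 0)), odd_anticomm hV.inv_apply0 hU.inv_apply0]
  simp only [F.top_add, F.top_sub, F.top_d1, F.top_d2, _root_.map_neg, F.top_neg]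
  abel

end IsOdd

end Frame

end

end SuperCurve

/-! ### The logarithmic derivative of the Berezinian. -/

namespace SuperCurve
noncomputable section

section Core

variable {K : Type*} {A : Type*} [CommRing K] [Ring A] [Algebra K A]

/-- The logarithmic derivative of a Berezinian equal to `1`. -/
theorem berezinian_derivation_core
    {p a e D11 D12 D21 D22 s11 s12 s21 s22 d da d11 d12 d21 d22 κ0 κ1 κ2 : K}
    {B1 B2 C1 C2 q1 q2 r1 r2 g1 g2 dB1 dB2 dC1 dC2 dg1 dg2 : A}
    (hd : d = D11 * D22 - D12 * D21) (he : e * d = 1)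
    (hC1 : C1 = D11 • g1 + D12 • g2) (hC2 : C2 = D21 • g1 + D22 • g2)
    (hA : a • (1 : A) = B1 * g1 + B2 * g2 + d • 1)
    (hdA : da • (1 : A) = dB1 * g1 + B1 * dg1 + (dB2 * g2 + B2 * dg2)
      + (d11 * D22 + D11 * d22 - (d12 * D21 + D12 * d21)) • 1)
    (hdC1 : dC1 = d11 • g1 + D11 • dg1 + (d12 • g2 + D12 • dg2))
    (hdC2 : dC2 = d21 • g1 + D21 • dg1 + (d22 • g2 + D22 • dg2))
    (eA : da • (1 : A) = (p * a + κ0 * a) • 1 + q1 * C1 + q2 * C2)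
    (eB1 : dB1 = p • B1 + D11 • q1 + D21 • q2 + κ1 • B1)
    (eB2 : dB2 = p • B2 + D12 • q1 + D22 • q2 + κ2 • B2)
    (eC1 : dC1 = a • r1 + s11 • C1 + s12 • C2 + κ0 • C1)
    (eC2 : dC2 = a • r2 + s21 • C1 + s22 • C2 + κ0 • C2)
    (e11 : d11 • (1 : A) = r1 * B1 + (s11 * D11 + s12 * D21 + κ1 * D11) • 1)
    (e12 : d12 • (1 : A) = r1 * B2 + (s11 * D12 + s12 * D22 + κ2 * D12) • 1)
    (e21 : d21 • (1 : A) = r2 * B1 + (s21 * D11 + s22 * D21 + κ1 * D21) • 1)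
    (e22 : d22 • (1 : A) = r2 * B2 + (s21 * D12 + s22 * D22 + κ2 * D22) • 1)
    (r11 : r1 * B1 = -(B1 * r1)) (r12 : r1 * B2 = -(B2 * r1))
    (r21 : r2 * B1 = -(B1 * r2)) (r22 : r2 * B2 = -(B2 * r2)) :
    (p - s11 - s22 + κ0 - κ1 - κ2) • (1 : A) = 0 := by
  -- The matrix is `[a, B; C, D]` with `g = D⁻¹ C` and `d = det D`, so Berezinian `1` reads `a = B g
  -- + d`. Its derivative is `N M + M diag(κ)` with `N = [p, q; r, s]`. Even entries are scalars
  -- from `K`, which leaves only the order of odd factors to be tracked. This equation is the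
  -- derivative of `det D`, expanded by cofactors.
  have E2 : (d11 * D22 + D11 * d22 - (d12 * D21 + D12 * d21)) • (1 : A) =
      ((s11 + s22 + κ1 + κ2) * d) • 1 - (D22 • (B1 * r1) + D11 • (B2 * r2) - D21 • (B2 * r1)
        - D12 • (B1 * r2)) := by
    rw [r11] at e11
    rw [r12] at e12
    rw [r21] at e21
    rw [r22] at e22
    rw [hd]
    linear_combination (norm := module) D22 • e11 + D11 • e22 - D21 • e12 - D12 • e21
  -- multiply the equations of the lower left block by the row `B D⁻¹` on the left
  have F1 : D11 • dg1 + D12 • dg2 = d • r1 + (κ0 - κ1) • (D11 • g1) + (κ0 - κ2) • (D12 • g2) := by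
    have x1 := congrArg (· * g1) e11
    have x2 := congrArg (· * g2) e12
    have x3 := congrArg (r1 * ·) hA
    simp only [smul_mul_assoc, mul_smul_comm, one_mul, mul_one, add_mul, mul_add, ← mul_assoc] at x1 x2 x3
    rw [eC1, hC1, hC2] at hdC1
    linear_combination (norm := module) -hdC1 - x1 - x2 + x3
  have F2 : D21 • dg1 + D22 • dg2 = d • r2 + (κ0 - κ1) • (D21 • g1) + (κ0 - κ2) • (D22 • g2) := by
    have x1 := congrArg (· * g1) e21
    have x2 := congrArg (· * g2) e22
    have x3 := congrArg (r2 * ·) hA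
    simp only [smul_mul_assoc, mul_smul_comm, one_mul, mul_one, add_mul, mul_add, ← mul_assoc] at x1 x2 x3
    rw [eC2, hC1, hC2] at hdC2
    linear_combination (norm := module) -hdC2 - x1 - x2 + x3
  -- Cramer's rule for the system `F1`, `F2`; the unit `d` is cancelled afterwards.
  have G1 : d • dg1 = d • (D22 • r1 - D12 • r2) + ((κ0 - κ1) * d) • g1 := by
    rw [hd] at *
    linear_combination (norm := module) D22 • F1 - D12 • F2
  have G2 : d • dg2 = d • (D11 • r2 - D21 • r1) + ((κ0 - κ2) * d) • g2 := by
    rw [hd] at *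
    linear_combination (norm := module) D11 • F2 - D21 • F1
  have cancel : ∀ {x y : A}, d • x = d • y → x = y := fun {x y} h => by
    have := congrArg (e • ·) h
    simpa only [smul_smul, he, one_smul] using this
  have H1 : dg1 = (D22 • r1 - D12 • r2) + (κ0 - κ1) • g1 := cancel (by rw [G1]; module)
  have H2 : dg2 = (D11 • r2 - D21 • r1) + (κ0 - κ2) • g2 := cancel (by rw [G2]; module)
  apply cancel
  rw [smul_zero]
  -- The derivative of `a` from the matrix equation is compared with the one from the Leibniz rule
  -- for `a = B g + d`; what remains is `d` times the claim.
  have E1 : da • (1 : A) = (p * d + κ0 * a) • 1 + p • (B1 * g1 + B2 * g2) + q1 * C1 + q2 * C2 := by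
    linear_combination (norm := module) eA + p • hA
  rw [hdA, E2, eB1, eB2, H1, H2, hC1, hC2] at E1
  simp only [smul_mul_assoc, mul_smul_comm, add_mul, mul_add, mul_sub] at E1
  linear_combination (norm := module) -E1 - κ0 • hA

end Core

section Berezinian

variable {A : Type v} [Ring A]

theorem smul_one_center (c : Subring.center A) : c • (1 : A) = c.1 := mul_one _

/-- `Ring.inverse` is `0` on non-units, so otherwise the Berezinian would be `0`. Then `0 = 1`, and
in the trivial ring everything is a unit. -/
theorem isUnit_of_berezinian_eq_one {M : Matrix (Fin 3) (Fin 3) A} (h : berezinian M = 1) :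
    IsUnit (M 1 1 * M 2 2 - M 1 2 * M 2 1) := by
  by_contra hu
  have h0 : (0 : A) = 1 := by
    rw [← h, berezinian]
    simp [Ring.inverse_non_unit _ hu]
  have := subsingleton_of_zero_eq_one h0
  exact hu (isUnit_of_subsingleton _)

variable [Parity A]

theorem inv_inverse {a : A} (ha : Parity.inv a = a) :
    Parity.inv (Ring.inverse a) = Ring.inverse a := by
  by_cases hu : IsUnit a
  · have h1 : Parity.inv (Ring.inverse a) * a = 1 := by
      nth_rewrite 2 [← ha]
      rw [← map_mul, Ring.inverse_mul_cancel _ hu, map_one]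
    rw [← mul_one (Parity.inv (Ring.inverse a)), ← Ring.mul_inverse_cancel _ hu, ← mul_assoc, h1,
      one_mul]
  · rw [Ring.inverse_non_unit _ hu, map_zero]

theorem mem_center_of_even [SuperComm A] {a : A} (ha : Parity.inv a = a) :
    a ∈ Subring.center A :=
  Subring.mem_center_iff.2 fun b => (even_comm ha b).symm

/-- An even element as a scalar. -/
def scalar [SuperComm A] {a : A} (ha : Parity.inv a = a) : Subring.center A :=
  ⟨a, mem_center_of_even ha⟩

theorem scalar_smul [SuperComm A] {a : A} (ha : Parity.inv a = a) (b : A) :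
    scalar ha • b = a * b := rfl

/-- The logarithmic derivative of a Berezinian equal to `1`. -/
theorem berezinian_derivation [SuperComm A] {M N : Matrix (Fin 3) (Fin 3) A} {κ : Fin 3 → ℤ}
    (hM : ∀ i j, Parity.inv (M i j) = (sg i * sg j) • M i j)
    (hN : ∀ i j, Parity.inv (N i j) = (sg i * sg j) • N i j)
    (hB : berezinian M = 1) (D : A →+ A) (hD : ∀ a, Parity.inv (D a) = D (Parity.inv a))
    (hmul : ∀ a b, D (a * b) = D a * b + a * D b)
    (h : ∀ i j, D (M i j) = N i 0 * M 0 j + N i 1 * M 1 j + N i 2 * M 2 j + κ j • M i j) :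
    N 0 0 - N 1 1 - N 2 2 + κ 0 - κ 1 - κ 2 = 0 := by
  have hu := isUnit_of_berezinian_eq_one hB
  have M00 := hM 0 0
  have M01 := hM 0 1
  have M02 := hM 0 2
  have M10 := hM 1 0
  have M11 := hM 1 1
  have M12 := hM 1 2
  have M20 := hM 2 0
  have M21 := hM 2 1
  have M22 := hM 2 2
  have N00 := hN 0 0
  have N01 := hN 0 1
  have N02 := hN 0 2
  have N10 := hN 1 0
  have N11 := hN 1 1
  have N12 := hN 1 2
  have N20 := hN 2 0
  have N21 := hN 2 1
  have N22 := hN 2 2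
  simp only [sg_zero, sg_one, sg_two, mul_one, mul_neg, neg_neg, one_smul, neg_smul] at *
  have hde : Parity.inv (M 1 1 * M 2 2 - M 1 2 * M 2 1) = M 1 1 * M 2 2 - M 1 2 * M 2 1 := by
    simp [M11, M12, M21, M22]
  have hie := inv_inverse hde
  have hi := Ring.inverse_mul_cancel _ hu
  set d := M 1 1 * M 2 2 - M 1 2 * M 2 1 with hd
  set e := Ring.inverse d with he
  set g1 := e * (M 2 2 * M 1 0 - M 1 2 * M 2 0) with hg1
  set g2 := e * (M 1 1 * M 2 0 - M 2 1 * M 1 0) with hg2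
  have hDe : ∀ {a : A}, Parity.inv a = a → Parity.inv (D a) = D a := fun {a} ha => by
    rw [hD, ha]
  have hB' : M 0 0 - (M 0 1 * g1 + M 0 2 * g2) = d := by
    have hB2 : (M 0 0 - (M 0 1 * g1 + M 0 2 * g2)) * e = 1 := hB
    rw [← mul_one (M 0 0 - _), ← hi, ← mul_assoc, hB2, one_mul]
  have hA : M 0 0 = M 0 1 * g1 + M 0 2 * g2 + d := by rw [← hB']; abel
  have c11 := even_comm M11
  have c12 := even_comm M12
  have c21 := even_comm M21
  have c22 := even_comm M22
  have ce := even_comm hie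
  have hC1 : M 1 0 = M 1 1 * g1 + M 1 2 * g2 := by
    have : e * (d * M 1 0) = M 1 1 * g1 + M 1 2 * g2 := by
      rw [hg1, hg2, ← mul_assoc (M 1 1), ← mul_assoc (M 1 2), c11 e, c12 e, mul_assoc, mul_assoc,
        ← mul_add, hd]
      congr 1
      simp only [mul_sub, sub_mul, ← mul_assoc, c12 (M 1 1)]
      abel
    rw [← this, ← mul_assoc, hi, one_mul]
  have hC2 : M 2 0 = M 2 1 * g1 + M 2 2 * g2 := by
    have : e * (d * M 2 0) = M 2 1 * g1 + M 2 2 * g2 := by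
      rw [hg1, hg2, ← mul_assoc (M 2 1), ← mul_assoc (M 2 2), c21 e, c22 e, mul_assoc, mul_assoc,
        ← mul_add, hd]
      congr 1
      simp only [mul_sub, sub_mul, ← mul_assoc, c22 (M 1 1), c22 (M 2 1), c21 (M 1 2)]
      abel
    rw [← this, ← mul_assoc, hi, one_mul]
  have hz : ∀ n : ℤ, Parity.inv (n : A) = n := fun n => map_intCast _ n
  clear_value g1 g2
  -- Even elements are central, so the centre serves as the commutative ring of scalars.
  have final := berezinian_derivation_core (A := A) (K := Subring.center A)
    (p := scalar N00) (a := scalar M00) (e := scalar hie) (D11 := scalar M11) (D12 := scalar M12)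
    (D21 := scalar M21) (D22 := scalar M22) (s11 := scalar N11) (s12 := scalar N12)
    (s21 := scalar N21) (s22 := scalar N22) (d := scalar hde) (da := scalar (hDe M00))
    (d11 := scalar (hDe M11)) (d12 := scalar (hDe M12)) (d21 := scalar (hDe M21))
    (d22 := scalar (hDe M22)) (κ0 := scalar (hz (κ 0))) (κ1 := scalar (hz (κ 1)))
    (κ2 := scalar (hz (κ 2))) (B1 := M 0 1) (B2 := M 0 2) (C1 := M 1 0) (C2 := M 2 0)
    (q1 := N 0 1) (q2 := N 0 2) (r1 := N 1 0) (r2 := N 2 0) (g1 := g1) (g2 := g2)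
    (dB1 := D (M 0 1)) (dB2 := D (M 0 2)) (dC1 := D (M 1 0)) (dC2 := D (M 2 0)) (dg1 := D g1)
    (dg2 := D g2) (Subtype.ext hd) (Subtype.ext hi)
  simp only [smul_one_center, scalar_smul] at final
  refine final hC1 hC2 hA ?_ ?_ ?_ ?_ ?_ ?_ ?_ ?_ ?_ ?_ ?_ ?_ (odd_anticomm N10 M01)
    (odd_anticomm N10 M02) (odd_anticomm N20 M01) (odd_anticomm N20 M02)
  · change D (M 0 0) = _ + (D (M 1 1) * M 2 2 + M 1 1 * D (M 2 2)
      - (D (M 1 2) * M 2 1 + M 1 2 * D (M 2 1)))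
    rw [hA, map_add, map_add, hmul, hmul, hd, map_sub, hmul, hmul]
  · rw [hC1, map_add, hmul, hmul]
  · rw [hC2, map_add, hmul, hmul]
  · change D (M 0 0) = N 0 0 * M 0 0 + κ 0 * M 0 0 + N 0 1 * M 1 0 + N 0 2 * M 2 0
    rw [h, zsmul_eq_mul]; abel
  · rw [h, zsmul_eq_mul, ← c11, ← c21]
  · rw [h, zsmul_eq_mul, ← c12, ← c22]
  · rw [h, zsmul_eq_mul, even_comm M00]
  · rw [h, zsmul_eq_mul, even_comm M00]
  · change D (M 1 1) = _ + (N 1 1 * M 1 1 + N 1 2 * M 2 1 + κ 1 * M 1 1)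
    rw [h, zsmul_eq_mul]; abel
  · change D (M 1 2) = _ + (N 1 1 * M 1 2 + N 1 2 * M 2 2 + κ 2 * M 1 2)
    rw [h, zsmul_eq_mul]; abel
  · change D (M 2 1) = _ + (N 2 1 * M 1 1 + N 2 2 * M 2 1 + κ 1 * M 2 1)
    rw [h, zsmul_eq_mul]; abel
  · change D (M 2 2) = _ + (N 2 1 * M 1 2 + N 2 2 * M 2 2 + κ 2 * M 2 2)
    rw [h, zsmul_eq_mul]; abel

end Berezinian

end

end SuperCurve

/-! ### Divergence and Berezin integral under changes of coordinates. -/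

namespace SuperCurve
noncomputable section

namespace Frame

variable {A : Type v} [Ring A] [Parity A] [SuperComm A]

/-- A vector field that scales coordinates of Jacobian `1` has constant divergence. -/
theorem IsEven.div_eq {F : Frame A} {V : A → A} (hV : F.IsEven V) {y : Fin 3 → A} {κ : Fin 3 → ℤ}
    (hy : ∀ j, Parity.inv (y j) = sg j • y j)
    (hB : berezinian (Matrix.of fun i j => F.d i (y j)) = 1) (h : ∀ i j, F.d i (V (y j)) = κ j • F.d i (y j)) :
    F.div V = κ 0 - κ 1 - κ 2 := by
  -- By `d_apply`, `V` differentiates the Jacobian matrix of `y` to `N M + M diag(κ)` with `N` minus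
  -- the Jacobian matrix of `V`, and the supertrace of `N` is `-div V`.
  have := berezinian_derivation (M := Matrix.of fun i j => F.d i (y j))
    (N := Matrix.of fun i l => -F.d i (V (F.x l))) (κ := κ) (fun i j => ?_) (fun i j => ?_) hB
    hV.toHom hV.inv_apply hV.map_mul (fun i j => ?_)
  · simp only [Matrix.of_apply] at this
    rw [← sub_eq_zero, ← neg_eq_zero, ← this, div]
    abel
  · simp only [Matrix.of_apply]
    rw [F.inv_d, hy, map_zsmul, mul_smul]
  · simp only [Matrix.of_apply]
    rw [_root_.map_neg, hV.inv_d_apply, smul_neg]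
  · simp only [Matrix.of_apply]
    have h1 := hV.d_apply i (y j)
    rw [h] at h1
    change V (F.d i (y j)) = _
    rw [h1]
    simp only [neg_mul]
    abel

/-- The Berezin integral under a change of the odd coordinates. -/
theorem top_eq_top_mul (F G : Frame A)
    (h1 : ∀ a, F.d 1 a = F.d 1 (G.x 1) * G.d 1 a + F.d 1 (G.x 2) * G.d 2 a)
    (h2 : ∀ a, F.d 2 a = F.d 2 (G.x 1) * G.d 1 a + F.d 2 (G.x 2) * G.d 2 a)
    (hu : IsUnit (F.d 1 (G.x 1) * F.d 2 (G.x 2) - F.d 1 (G.x 2) * F.d 2 (G.x 1))) (f : A) :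
    F.top f = G.top ((F.d 1 (G.x 1) * F.d 2 (G.x 2) - F.d 1 (G.x 2) * F.d 2 (G.x 1)) * f) := by
  have i11 : Parity.inv (F.d 1 (G.x 1)) = F.d 1 (G.x 1) := by simp [F.inv_d, G.inv_x1]
  have i12 : Parity.inv (F.d 1 (G.x 2)) = F.d 1 (G.x 2) := by simp [F.inv_d, G.inv_x2]
  have i21 : Parity.inv (F.d 2 (G.x 1)) = F.d 2 (G.x 1) := by simp [F.inv_d, G.inv_x1]
  have i22 : Parity.inv (F.d 2 (G.x 2)) = F.d 2 (G.x 2) := by simp [F.inv_d, G.inv_x2]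
  have s11 : F.d 1 (F.d 1 (G.x 1)) = 0 := F.d_d_self (by decide) _
  have s12 : F.d 1 (F.d 1 (G.x 2)) = 0 := F.d_d_self (by decide) _
  have s21 : F.d 2 (F.d 2 (G.x 1)) = 0 := F.d_d_self (by decide) _
  have s22 : F.d 2 (F.d 2 (G.x 2)) = 0 := F.d_d_self (by decide) _
  have t1 : F.d 1 (F.d 2 (G.x 1)) = -F.top (G.x 1) := F.d_anti 1 2 _ (by decide) (by decide)
  have t2 : F.d 1 (F.d 2 (G.x 2)) = -F.top (G.x 2) := F.d_anti 1 2 _ (by decide) (by decide)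
  have t3 : F.d 2 (F.d 1 (G.x 1)) = F.top (G.x 1) := rfl
  have t4 : F.d 2 (F.d 1 (G.x 2)) = F.top (G.x 2) := rfl
  have d11 := F.d1_top (G.x 1)
  have d12 := F.d1_top (G.x 2)
  have d21 := F.d2_top (G.x 1)
  have d22 := F.d2_top (G.x 2)
  have io1 : Parity.inv (F.top (G.x 1)) = -F.top (G.x 1) := by rw [inv_top, G.inv_x1, top_neg]
  have io2 : Parity.inv (F.top (G.x 2)) = -F.top (G.x 2) := by rw [inv_top, G.inv_x2, top_neg]
  -- The chain rule applied twice. The proof is complete once the first-order coefficients are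
  -- recognized as derivatives of the determinant `D` (`D1`, `D2` below).
  have expand : F.top f = F.top (G.x 1) * G.d 1 f + F.top (G.x 2) * G.d 2 f
      + (F.d 1 (G.x 1) * F.d 2 (G.x 2) - F.d 1 (G.x 2) * F.d 2 (G.x 1)) * G.top f := by
    rw [top, h1 f, map_add, F.d_mul, F.d_mul, t3, t4, h2 (G.d 1 f), h2 (G.d 2 f),
      G.d_d_self (by decide), G.d_d_self (by decide), G.d_anti 1 2 f (by decide) (by decide)]
    simp only [tw_two, i11, i12, top, mul_zero, zero_add, add_zero, mul_neg, sub_mul, mul_assoc]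
    abel
  set a := F.d 1 (G.x 1)
  set b := F.d 1 (G.x 2)
  set c := F.d 2 (G.x 1)
  set e := F.d 2 (G.x 2)
  set D := a * e - b * c with hD
  have iD : Parity.inv D = D := by simp [hD, i11, i12, i21, i22]
  have ca := even_comm i11
  have cb := even_comm i12
  have cc := even_comm i21
  have ce := even_comm i22
  -- Cramer's rule expresses the derivatives of `G` by those of `F`.
  have g2 : ∀ x, D * G.d 2 x = a * F.d 2 x - c * F.d 1 x := fun x => by
    rw [h1 x, h2 x, hD, sub_mul, mul_add, mul_add, cb c, ← mul_assoc a c, ca c]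
    simp only [mul_assoc]
    abel
  have g1 : ∀ x, D * G.d 1 x = e * F.d 1 x - b * F.d 2 x := fun x => by
    rw [h1 x, h2 x, hD, sub_mul, mul_add, mul_add, ca e, ← mul_assoc b e, cb e]
    simp only [mul_assoc]
    abel
  have cancel : ∀ {x y}, D * x = D * y → x = y := fun {x y} h => hu.mul_left_cancel h
  have k1 : ∀ x, F.top (G.x 1) * x = Parity.inv x * F.top (G.x 1) := odd_mul io1
  have k2 : ∀ x, F.top (G.x 2) * x = Parity.inv x * F.top (G.x 2) := odd_mul io2
  have D2 : G.d 2 D = F.top (G.x 1) := cancel <| by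
    rw [g2, hD]
    simp only [map_sub, F.d_mul, tw_one, tw_two, t1, t2, t3, t4, s11, s12, s21, s22, i11, i12, k1,
      k2, i21, i22]
    simp only [mul_sub, sub_mul, mul_neg, mul_zero, zero_mul, add_zero, zero_add,
      ← mul_assoc, cc a, cc b]
    abel
  have D1 : G.d 1 D = -F.top (G.x 2) := cancel <| by
    rw [g1, hD]
    simp only [map_sub, F.d_mul, tw_one, tw_two, t1, t2, t3, t4, s11, s12, s21, s22, i11, i12, k1,
      k2, i21, i22]
    simp only [mul_sub, sub_mul, mul_neg, mul_zero, zero_mul, add_zero, zero_add,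
      ← mul_assoc, ce a, ce b]
    abel
  have D21 : G.d 2 (F.top (G.x 2)) = 0 := cancel <| by
    rw [g2, d12, d22, mul_zero, mul_zero, mul_zero, sub_zero]
  rw [expand]
  simp only [top, G.d_mul, map_add, tw_one, tw_two, iD]
  rw [D1, D2, map_neg, D21, map_neg, io2]
  simp only [top]
  simp only [neg_zero, zero_mul, neg_neg, zero_add]
  abel

/-- The Berezin integral of a divergence free vector field under a change of the even
coordinate. -/
theorem IsEven.top_eq {F G : Frame A} {V : A → A} (hV : F.IsEven V) (hdiv : F.div V = 0)
    {b : A} (hbe : Parity.inv b = b) (hb : b * F.d 0 (G.x 0) = 1) (u : Fin 3 → A)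
    (hu : ∀ i, u i = b * F.d i (G.x 0))
    (h1 : ∀ a, G.d 1 a = F.d 1 a - u 1 * F.d 0 a)
    (h2 : ∀ a, G.d 2 a = F.d 2 a - u 2 * F.d 0 a) :
    F.top (V (F.x 0)) = G.top (b * V (G.x 0)) := by
  have i1 : Parity.inv (u 1) = -u 1 := by simp [hu, hbe, F.inv_d, G.inv_x0]
  have i2 : Parity.inv (u 2) = -u 2 := by simp [hu, hbe, F.inv_d, G.inv_x0]
  have hfi := hV.inv_apply0
  have hg1i := hV.inv_apply1
  have hg2i := hV.inv_apply2
  have hbV : b * V (G.x 0) = V (F.x 0) + V (F.x 1) * u 1 + V (F.x 2) * u 2 := by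
    rw [hV.eq (G.x 0), hu, hu, mul_add, mul_add, ← mul_assoc, ← mul_assoc, ← mul_assoc,
      ← mul_assoc, ← mul_assoc, even_comm hbe (V (F.x 0)), even_comm hbe (V (F.x 1)),
      even_comm hbe (V (F.x 2)), mul_assoc, hb, mul_one]
  -- Vanishing divergence removes the even derivative of the even component, which `G.d 1` and `G.d
  -- 2` would otherwise introduce.
  have hP : F.d 0 (V (F.x 0)) = F.d 1 (V (F.x 1)) + F.d 2 (V (F.x 2)) := by
    rw [div, sub_sub, sub_eq_zero] at hdiv
    exact hdiv
  rw [hbV]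
  set f := V (F.x 0)
  set p := V (F.x 1)
  set q := V (F.x 2)
  -- Up to sign `u 1` and `u 2` are odd derivatives of the old even coordinate, so the relations
  -- between `G.d 1` and `G.d 2` become integrability conditions for them.
  have z1 : G.d 1 (F.x 0) = -u 1 := by rw [h1, F.d_x, F.d_x]; simp
  have z2 : G.d 2 (F.x 0) = -u 2 := by rw [h2, F.d_x, F.d_x]; simp
  have e11 : G.d 1 (u 1) = 0 := by
    rw [← neg_neg (u 1), ← z1, _root_.map_neg, G.d_d_self (by decide), neg_zero]
  have e22 : G.d 2 (u 2) = 0 := by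
    rw [← neg_neg (u 2), ← z2, _root_.map_neg, G.d_d_self (by decide), neg_zero]
  have e21 : G.d 2 (u 1) = -G.d 1 (u 2) := by
    rw [← neg_neg (u 1), ← z1, ← neg_neg (u 2), ← z2, _root_.map_neg, _root_.map_neg,
      G.d_anti 2 1 _ (by decide) (by decide)]
  have sq1 := odd_sq i1
  have sq2 := odd_sq i2
  have step1 : G.d 1 (f + p * u 1 + q * u 2) =
      F.d 1 f - F.d 2 q * u 1 + G.d 1 q * u 2 - q * G.d 1 (u 2) := by
    rw [_root_.map_add, _root_.map_add, G.d_mul, G.d_mul, e11, tw_one, tw_one, hg2i, h1 f, hP, h1 p]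
    have k1 : u 1 * F.d 1 p = F.d 1 p * u 1 := by
      rw [odd_mul i1, F.inv_d, hg1i]; simp
    have k2 : u 1 * F.d 2 q = F.d 2 q * u 1 := by
      rw [odd_mul i1, F.inv_d, hg2i]; simp
    have k3 : u 1 * F.d 0 p * u 1 = 0 := by
      rw [odd_mul i1, mul_assoc, sq1, mul_zero]
    rw [mul_add, sub_mul, k1, k2, k3]
    simp only [mul_zero, neg_mul]
    abel
  have e2d : G.d 2 (G.d 1 (u 2)) = 0 := by
    rw [G.d_anti 2 1 _ (by decide) (by decide), e22, _root_.map_zero, neg_zero]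
  have ie : Parity.inv (G.d 1 (u 2)) = G.d 1 (u 2) := by simp [G.inv_d, i2]
  have iF2q : Parity.inv (F.d 2 q) = F.d 2 q := by rw [F.inv_d, hg2i]; simp
  have iG1q : Parity.inv (G.d 1 q) = G.d 1 q := by rw [G.inv_d, hg2i]; simp
  rw [top, top, step1, _root_.map_sub, _root_.map_add, _root_.map_sub, G.d_mul, G.d_mul, G.d_mul, e2d, e22, e21, tw_two,
    tw_two, tw_two, iF2q]
  have a1 : G.d 2 (F.d 1 f) = F.d 2 (F.d 1 f) - u 2 * F.d 1 (F.d 2 q) := by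
    rw [h2, F.d_comm, hP, _root_.map_add, F.d_d_self (by decide), zero_add]
  have a2 : G.d 2 (F.d 2 q) = -(u 2 * F.d 0 (F.d 2 q)) := by
    rw [h2, F.d_d_self (by decide), zero_sub]
  have a3 : G.d 2 (G.d 1 q) * u 2 = F.d 2 (F.d 1 q) * u 2 + G.d 1 (u 2) * F.d 0 q * u 2
      + u 1 * F.d 2 (F.d 0 q) * u 2 := by
    have b1 : u 2 * F.d 0 (F.d 1 q) * u 2 = 0 := by
      rw [odd_mul i2, mul_assoc, sq2, mul_zero]
    have b2 : u 1 * (u 2 * F.d 0 (F.d 0 q)) * u 2 = 0 := by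
      rw [odd_mul i2, mul_assoc, mul_assoc, sq2, mul_zero, mul_zero]
    rw [h1 q, _root_.map_sub, h2 (F.d 1 q), G.d_mul, e21, tw_two, i1, h2 (F.d 0 q), mul_sub]
    simp only [sub_mul, add_mul, neg_mul, b1, b2]
    abel
  have a4 : u 2 * F.d 1 (F.d 2 q) = F.d 2 (F.d 1 q) * u 2 := by
    rw [odd_mul i2, F.d_anti 1 2 _ (by decide) (by decide)]
    simp [F.inv_d, hg2i]
  have a5 : u 2 * F.d 0 (F.d 2 q) * u 1 = -(u 1 * F.d 2 (F.d 0 q) * u 2) := by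
    have iE : Parity.inv (F.d 2 (F.d 0 q)) = F.d 2 (F.d 0 q) := by
      rw [F.inv_d, F.inv_d, hg2i]; simp
    rw [F.d_comm, ← even_comm iE, ← even_comm iE, mul_assoc, mul_assoc, odd_anticomm i2 i1, mul_neg]
  have a6 : u 2 * F.d 0 q * G.d 1 (u 2) = -(G.d 1 (u 2) * F.d 0 q * u 2) := by
    rw [← even_comm ie, odd_mul i2, F.inv_d, hg2i]
    simp [mul_assoc]
  rw [a1, a2, a3, a4, h2 q]
  simp only [neg_mul, sub_mul, a5, a6, mul_zero, mul_neg]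
  abel

end Frame

end

end SuperCurve

/-! ### Superderivations and the operations on relative vector fields. -/

namespace SuperCurve
noncomputable section

section SuperDerivation

variable {k : Type u} {A : Type v} [Field k] [CharZero k] [Ring A] [Module k A] [Parity A]

theorem eq_half_add_half (k : Type u) [Field k] [CharZero k] [Module k A] (a : A) :
    a = (2 : k)⁻¹ • (a + Parity.inv a) + (2 : k)⁻¹ • (a - Parity.inv a) := by
  rw [← smul_add, add_add_sub_cancel, ← two_smul k a, smul_smul, inv_mul_cancel₀ two_ne_zero,
    one_smul]

/-- `Parity.inv` is only additive here, but halving is the inverse of doubling, so additivity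
suffices. -/
theorem inv_half_smul (k : Type u) [Field k] [CharZero k] [Module k A] (a : A) :
    Parity.inv ((2 : k)⁻¹ • a) = (2 : k)⁻¹ • Parity.inv a := by
  have half : ∀ b : A, (2 : k)⁻¹ • (b + b) = b := fun b => by
    rw [← two_smul k b, smul_smul, inv_mul_cancel₀ two_ne_zero, one_smul]
  rw [← half (Parity.inv ((2 : k)⁻¹ • a)), ← map_add, ← smul_add, half]

variable {D E : A →ₗ[k] A}

/-- The Leibniz rule for homogeneous elements extends to all elements by splitting them into even
and odd halves. The same holds for parity `1`, where the sign becomes the parity involution. -/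
theorem isSuperDerivation_zero_iff : IsSuperDerivation 0 D ↔
    (∀ a, Parity.inv (D a) = D (Parity.inv a)) ∧ ∀ a b, D (a * b) = D a * b + a * D b := by
  constructor
  · refine fun h => ⟨fun a => by simpa using h.parity a, fun a b => ?_⟩
    have e := inv_half_smul (A := A) k
    have h0 := h.leibniz 0 ((2 : k)⁻¹ • (a + Parity.inv a)) b
      (hasParity_zero_iff.2 (by rw [e, map_add, Parity.inv_inv, add_comm]))
    have h1 := h.leibniz 1 ((2 : k)⁻¹ • (a - Parity.inv a)) b
      (hasParity_one_iff.2 (by rw [e, map_sub, Parity.inv_inv, ← smul_neg, neg_sub]))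
    simp only [ZMod.val_zero, mul_zero, pow_zero, one_mul] at h0 h1
    rw [eq_half_add_half k a, add_mul, map_add, h0, h1, map_add]
    noncomm_ring
  · rintro ⟨h1, h2⟩
    exact ⟨fun a => by simpa using h1 a, fun i a b _ => by simpa using h2 a b⟩

theorem isSuperDerivation_one_iff : IsSuperDerivation 1 D ↔
    (∀ a, Parity.inv (D a) = -D (Parity.inv a)) ∧
      ∀ a b, D (a * b) = D a * b + Parity.inv a * D b := by
  constructor
  · refine fun h => ⟨fun a => by simpa [ZMod.val_one] using h.parity a, fun a b => ?_⟩
    have e := inv_half_smul (A := A) k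
    have e0 : Parity.inv ((2 : k)⁻¹ • (a + Parity.inv a)) = (2 : k)⁻¹ • (a + Parity.inv a) := by
      rw [e, map_add, Parity.inv_inv, add_comm]
    have e1 : Parity.inv ((2 : k)⁻¹ • (a - Parity.inv a)) = -((2 : k)⁻¹ • (a - Parity.inv a)) := by
      rw [e, map_sub, Parity.inv_inv, ← smul_neg, neg_sub]
    have h0 := h.leibniz 0 _ b (hasParity_zero_iff.2 e0)
    have h1 := h.leibniz 1 _ b (hasParity_one_iff.2 e1)
    simp only [ZMod.val_zero, ZMod.val_one, mul_one, pow_zero, pow_one, one_mul,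
      neg_mul] at h0 h1
    have hs := eq_half_add_half k a
    set p := (2 : k)⁻¹ • (a + Parity.inv a)
    set q := (2 : k)⁻¹ • (a - Parity.inv a)
    rw [hs, add_mul, map_add, h0, h1, map_add, map_add, e0, e1]
    noncomm_ring
  · rintro ⟨h1, h2⟩
    refine ⟨fun a => by simpa [ZMod.val_one] using h1 a, fun i a b ha => ?_⟩
    rw [h2, ha, ZMod.val_one, mul_one, mul_assoc]

theorem IsSuperDerivation.sub {j : ZMod 2} (hD : IsSuperDerivation j D)
    (hE : IsSuperDerivation j E) : IsSuperDerivation j (D - E) := by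
  rcases ZMod.two_cases j with rfl | rfl
  · rw [isSuperDerivation_zero_iff] at *
    refine ⟨fun a => by simp [hD.1, hE.1], fun a b => ?_⟩
    simp only [LinearMap.sub_apply, hD.2, hE.2]
    noncomm_ring
  · rw [isSuperDerivation_one_iff] at *
    refine ⟨fun a => by simp [hD.1, hE.1]; abel, fun a b => ?_⟩
    simp only [LinearMap.sub_apply, hD.2, hE.2]
    noncomm_ring

theorem IsSuperDerivation.bracket {i j : ZMod 2} (hD : IsSuperDerivation i D)
    (hE : IsSuperDerivation j E) :
    IsSuperDerivation (i + j) (D ∘ₗ E - (-1 : k) ^ (i.val * j.val) • (E ∘ₗ D)) := by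
  rcases ZMod.two_cases i with rfl | rfl <;> rcases ZMod.two_cases j with rfl | rfl
  · rw [add_zero]
    rw [isSuperDerivation_zero_iff] at *
    refine ⟨fun a => by simp [hD.1, hE.1], fun a b => ?_⟩
    simp [hD.2, hE.2]
    noncomm_ring
  · rw [zero_add]
    rw [isSuperDerivation_zero_iff] at hD
    rw [isSuperDerivation_one_iff] at *
    refine ⟨fun a => by simp [hD.1, hE.1]; abel, fun a b => ?_⟩
    simp [hD.2, hE.2, hD.1, ZMod.val_one]
    noncomm_ring
  · rw [add_zero]
    rw [isSuperDerivation_zero_iff] at hE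
    rw [isSuperDerivation_one_iff] at *
    refine ⟨fun a => by simp [hD.1, hE.1]; abel, fun a b => ?_⟩
    simp [hD.2, hE.2, hE.1, ZMod.val_one]
    noncomm_ring
  · rw [show (1 + 1 : ZMod 2) = 0 from by decide]
    rw [isSuperDerivation_zero_iff]
    rw [isSuperDerivation_one_iff] at *
    refine ⟨fun a => by simp [hD.1, hE.1, ZMod.val_one], fun a b => ?_⟩
    simp [hD.2, hE.2, hD.1, hE.1, ZMod.val_one, Parity.inv_inv]
    noncomm_ring

theorem IsSuperDerivation.add {j : ZMod 2} (hD : IsSuperDerivation j D)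
    (hE : IsSuperDerivation j E) : IsSuperDerivation j (D + E) := by
  rcases ZMod.two_cases j with rfl | rfl
  · rw [isSuperDerivation_zero_iff] at *
    refine ⟨fun a => by simp [hD.1, hE.1], fun a b => ?_⟩
    simp only [LinearMap.add_apply, hD.2, hE.2]
    noncomm_ring
  · rw [isSuperDerivation_one_iff] at *
    refine ⟨fun a => by simp [hD.1, hE.1]; abel, fun a b => ?_⟩
    simp only [LinearMap.add_apply, hD.2, hE.2]
    noncomm_ring

theorem IsSuperDerivation.mulLeft [SuperComm A] [SMulCommClass k A A] {i j : ZMod 2} {c : A} (hc : HasParity (j + i) c)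
    (hD : IsSuperDerivation i D) : IsSuperDerivation j (LinearMap.mulLeft k c ∘ₗ D) := by
  rcases ZMod.two_cases i with rfl | rfl <;> rcases ZMod.two_cases j with rfl | rfl
  · rw [add_zero, hasParity_zero_iff] at hc
    rw [isSuperDerivation_zero_iff] at *
    refine ⟨fun a => by simp [hD.1, hc], fun a b => ?_⟩
    simp only [LinearMap.comp_apply, LinearMap.mulLeft_apply, hD.2, mul_add, ← mul_assoc,
      even_comm hc a]
  · rw [add_zero, hasParity_one_iff] at hc
    rw [isSuperDerivation_zero_iff] at hD
    rw [isSuperDerivation_one_iff] at *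
    refine ⟨fun a => by simp [hD.1, hc], fun a b => ?_⟩
    simp only [LinearMap.comp_apply, LinearMap.mulLeft_apply, hD.2, mul_add, ← mul_assoc,
      odd_mul hc a]
  · rw [zero_add, hasParity_one_iff] at hc
    rw [isSuperDerivation_one_iff] at hD
    rw [isSuperDerivation_zero_iff] at *
    refine ⟨fun a => by simp [hD.1, hc], fun a b => ?_⟩
    simp only [LinearMap.comp_apply, LinearMap.mulLeft_apply, hD.2, mul_add, ← mul_assoc,
      odd_mul hc (Parity.inv a), Parity.inv_inv]
  · rw [show (1 + 1 : ZMod 2) = 0 from by decide, hasParity_zero_iff] at hc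
    rw [isSuperDerivation_one_iff] at *
    refine ⟨fun a => by simp [hD.1, hc], fun a b => ?_⟩
    simp only [LinearMap.comp_apply, LinearMap.mulLeft_apply, hD.2, mul_add, ← mul_assoc,
      even_comm hc (Parity.inv a)]

end SuperDerivation

open SuperSpace

variable {k : Type u} [Field k] [CharZero k] {C S : SuperSpace k} {π : Hom C S}

instance (U : Opens C.top) : SuperComm (C.Sec U) :=
  SuperComm.of_isSupercommutative k (C.supercomm U)

instance (U : Opens C.top) : SuperAlg k (C.Sec U) where
  inv_smul c f := (C.parity.app (op U)).hom.toLinearMap.map_smul c f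

namespace VectorField

variable {U : Opens C.top} {i j : ZMod 2}

/-- The difference of two vector fields. -/
def sub (D E : VectorField π U j) : VectorField π U j where
  app V h := D.app V h - E.app V h
  app_res V W hV hW f := by simp [D.app_res V W hV hW, E.app_res V W hV hW]
  isSuperDerivation V h := (D.isSuperDerivation V h).sub (E.isSuperDerivation V h)
  relative V h W hW s := by simp [D.relative V h W hW, E.relative V h W hW]

/-- The sum of two vector fields. -/
def add (D E : VectorField π U j) : VectorField π U j where
  app V h := D.app V h + E.app V h
  app_res V W hV hW f := by simp [D.app_res V W hV hW, E.app_res V W hV hW]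
  isSuperDerivation V h := (D.isSuperDerivation V h).add (E.isSuperDerivation V h)
  relative V h W hW s := by simp [D.relative V h W hW, E.relative V h W hW]

/-- The supercommutator of two vector fields. -/
def bracket (D : VectorField π U i) (E : VectorField π U j) : VectorField π U (i + j) where
  app V h := D.app V h ∘ₗ E.app V h - (-1 : k) ^ (i.val * j.val) • (E.app V h ∘ₗ D.app V h)
  app_res V W hV hW f := by simp [D.app_res V W hV hW, E.app_res V W hV hW]
  isSuperDerivation V h := (D.isSuperDerivation V h).bracket (E.isSuperDerivation V h)
  relative V h W hW s := by simp [D.relative V h W hW, E.relative V h W hW]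

/-- The product of a vector field and a function. -/
def mulLeft (c : C.Sec U) (hc : HasParity (j + i) c) (D : VectorField π U i) :
    VectorField π U j where
  app V h := LinearMap.mulLeft k (res h c) ∘ₗ D.app V h
  app_res V W hV hW f := by simp [D.app_res V W hV hW, res_res]
  isSuperDerivation V h := IsSuperDerivation.mulLeft (res_hasParity h hc) (D.isSuperDerivation V h)
  relative V h W hW s := by simp [D.relative V h W hW]

end VectorField

end

end SuperCurve

/-! ### Coordinates as frames, the coordinate independent Berezin integral, and the flux cocycle. -/

namespace SuperCurve
noncomputable section

open SuperSpace

theorem par_zero : par 0 = 0 := rfl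
theorem par_one : par 1 = 1 := rfl
theorem par_two : par 2 = 1 := rfl

theorem hasParity_par_iff {A : Type v} [Ring A] [Parity A] {i : Fin 3} {a : A} :
    HasParity (par i) a ↔ Parity.inv a = sg i • a := by
  fin_cases i
  · simp [par_zero, hasParity_zero_iff]
  · simp [par_one, hasParity_one_iff]
  · simp [par_two, hasParity_one_iff]

/-- The divergence differs from `F.d 0 (V (F.x 0))` by odd derivatives, which `top` annihilates. -/
theorem Frame.d0_top_apply {A : Type v} [Ring A] [Parity A] [SuperComm A] (F : Frame A)
    (V : A → A) : F.d 0 (F.top (V (F.x 0))) = F.top (F.div V) := by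
  rw [F.d0_top, div, F.top_sub, F.top_sub, F.top_d1, F.top_d2, sub_zero, sub_zero]

/-- An element with an inverse up to products of odd elements is invertible. -/
theorem exists_even_inverse {A : Type v} [Ring A] [Parity A] [SuperComm A] {a n p q r s : A}
    (hn : Parity.inv n = n) (hp : Parity.inv p = -p)
    (hq : Parity.inv q = -q) (hr : Parity.inv r = -r) (hs : Parity.inv s = -s)
    (h : n * a + p * q + r * s = 1) : ∃ b, Parity.inv b = b ∧ b * a = 1 := by
  have ipq : Parity.inv (p * q) = p * q := by rw [map_mul, hp, hq, neg_mul_neg]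
  have irs : Parity.inv (r * s) = r * s := by rw [map_mul, hr, hs, neg_mul_neg]
  have pq2 : p * q * (p * q) = 0 := by
    rw [← mul_assoc, even_comm ipq, ← mul_assoc, odd_sq hp, zero_mul, zero_mul]
  have rs2 : r * s * (r * s) = 0 := by
    rw [← mul_assoc, even_comm irs, ← mul_assoc, odd_sq hr, zero_mul, zero_mul]
  have hc : n * a = 1 - p * q - r * s := by rw [← h]; abel
  -- With `ε = p q + r s` one has `n a = 1 - ε`, `ε² = 2 p q r s` and `ε³ = 0`; the witness is `(1 +
  -- ε + ε²) n`.
  refine ⟨(1 + p * q + r * s + (p * q * (r * s) + p * q * (r * s))) * n, ?_, ?_⟩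
  · simp [ipq, irs, hn]
  · rw [mul_assoc, hc]
    have c1 := even_comm irs (p * q)
    have z1 : p * q * (r * s) * (p * q) = 0 := by rw [mul_assoc, c1, ← mul_assoc, pq2, zero_mul]
    have z2 : p * q * (r * s) * (r * s) = 0 := by rw [mul_assoc, rs2, mul_zero]
    simp only [mul_sub, add_mul, mul_one, one_mul, pq2, rs2, c1, z1, z2]
    abel

variable {k : Type u} [Field k] {C S : SuperSpace k} {π : Hom C S}

theorem res_self {U : Opens C.top} (f : C.Sec U) : res le_rfl f = f := by
  have := C.sheaf.presheaf.map_id (op U)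
  exact congrArg (fun φ => φ.hom f) this

theorem VectorField.hasParity_apply {U : Opens C.top} {i j : ZMod 2} (D : VectorField π U j)
    {f : C.Sec U} (hf : HasParity i f) : HasParity (j + i) (D.app U le_rfl f) := by
  have h := (D.isSuperDerivation U le_rfl).parity f
  rcases ZMod.two_cases i with rfl | rfl <;> rcases ZMod.two_cases j with rfl | rfl
  · rw [hasParity_zero_iff] at hf
    rw [add_zero, hasParity_zero_iff, h, hf]
    simp
  · rw [hasParity_zero_iff] at hf
    rw [add_zero, hasParity_one_iff, h, hf]
    simp [ZMod.val_one]
  · rw [hasParity_one_iff] at hf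
    rw [zero_add, hasParity_one_iff, h, hf]
    simp
  · rw [hasParity_one_iff] at hf
    rw [show (1 + 1 : ZMod 2) = 0 from by decide, hasParity_zero_iff, h, hf]
    simp [ZMod.val_one]

variable [CharZero k]

namespace Coords

variable {U : Opens C.top} (x y z : Coords π U)

/-- The chain rule `D = ∑ D(xᵢ) ∂ᵢ`. -/
theorem vectorField_apply {j : ZMod 2} (D : VectorField π U j) (f : C.Sec U) :
    D.app U le_rfl f = D.app U le_rfl (x.x 0) * (x.partialD 0).app U le_rfl f
      + D.app U le_rfl (x.x 1) * (x.partialD 1).app U le_rfl f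
      + D.app U le_rfl (x.x 2) * (x.partialD 2).app U le_rfl f := by
  have hp := fun i => D.hasParity_apply (x.parity i)
  -- The difference of the two sides is itself a vector field and kills the coordinates, so `unique`
  -- applies.
  let E : VectorField π U j := D.sub
    (((VectorField.mulLeft _ (hp 0) (x.partialD 0)).add
      (VectorField.mulLeft _ (hp 1) (x.partialD 1))).add
        (VectorField.mulLeft _ (hp 2) (x.partialD 2)))
  have hE : ∀ g, E.app U le_rfl g = D.app U le_rfl g -
      (D.app U le_rfl (x.x 0) * (x.partialD 0).app U le_rfl g
      + D.app U le_rfl (x.x 1) * (x.partialD 1).app U le_rfl g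
      + D.app U le_rfl (x.x 2) * (x.partialD 2).app U le_rfl g) := fun g => by
    simp [E, VectorField.sub, VectorField.add, VectorField.mulLeft, res_self]
  have h0 := x.unique U le_rfl j E (fun i => by
    rw [res_self, hE, x.dual, x.dual, x.dual]
    fin_cases i <;> simp) U le_rfl f
  rw [hE, sub_eq_zero] at h0
  exact h0

/-- Derivations kill `0` and `1`, so the supercommutator kills all coordinates and vanishes. This
yields the commutation relations of the partial derivatives. -/
theorem vectorField_bracket {i j : ZMod 2} (D : VectorField π U i) (E : VectorField π U j)
    (hD : ∀ l, D.app U le_rfl (x.x l) = 0 ∨ D.app U le_rfl (x.x l) = 1)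
    (hE : ∀ l, E.app U le_rfl (x.x l) = 0 ∨ E.app U le_rfl (x.x l) = 1) (f : C.Sec U) :
    D.app U le_rfl (E.app U le_rfl f) =
      (-1 : k) ^ (i.val * j.val) • E.app U le_rfl (D.app U le_rfl f) := by
  have one : ∀ {j : ZMod 2} (D : VectorField π U j), D.app U le_rfl 1 = 0 := fun D => by
    have := (D.isSuperDerivation U le_rfl).leibniz 0 1 1 (hasParity_zero_iff.2 (map_one _))
    simpa using this
  have h := x.vectorField_apply (D.bracket E) f
  have hz : ∀ l, (D.bracket E).app U le_rfl (x.x l) = 0 := fun l => by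
    simp only [VectorField.bracket, LinearMap.sub_apply, LinearMap.comp_apply, LinearMap.smul_apply]
    rcases hD l with h1 | h1 <;> rcases hE l with h2 | h2 <;> rw [h1, h2] <;> simp [one]
  rw [hz, hz, hz, zero_mul, zero_mul, zero_mul, add_zero, add_zero] at h
  exact sub_eq_zero.1 h

/-- The frame of a coordinate system. -/
def frame : Frame (C.Sec U) where
  d i := ((x.partialD i).app U le_rfl).toAddMonoidHom
  x := x.x
  inv_x i := hasParity_par_iff.1 (x.parity i)
  inv_d i a := by
    have h := ((x.partialD i).isSuperDerivation U le_rfl).parity a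
    fin_cases i <;> simpa [par_zero, par_one, par_two, ZMod.val_one] using h
  d_mul i a b := by
    have h := (x.partialD i).isSuperDerivation U le_rfl
    fin_cases i
    · exact (isSuperDerivation_zero_iff.1 h).2 a b
    · exact (isSuperDerivation_one_iff.1 h).2 a b
    · exact (isSuperDerivation_one_iff.1 h).2 a b
  d_comm i a := by
    have h := x.vectorField_bracket (x.partialD 0) (x.partialD i)
      (fun l => by rw [x.dual]; split_ifs <;> simp) (fun l => by rw [x.dual]; split_ifs <;> simp) a
    simpa [par_zero] using h
  d_anti i j a hi hj := by
    have h := x.vectorField_bracket (x.partialD i) (x.partialD j)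
      (fun l => by rw [x.dual]; split_ifs <;> simp) (fun l => by rw [x.dual]; split_ifs <;> simp) a
    have pi : ∀ i : Fin 3, i ≠ 0 → par i = 1 := by decide
    simpa [pi i hi, pi j hj, ZMod.val_one] using h
  d_x i j := x.dual i j

theorem frame_d (i : Fin 3) (f : C.Sec U) : x.frame.d i f = (x.partialD i).app U le_rfl f := rfl

theorem frame_x (i : Fin 3) : x.frame.x i = x.x i := rfl

theorem isEven (D : VectorField π U 0) : x.frame.IsEven (D.app U le_rfl) where
  inv_apply := (isSuperDerivation_zero_iff.1 (D.isSuperDerivation U le_rfl)).1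
  eq := x.vectorField_apply D

theorem frame_d_eq (i : Fin 3) (f : C.Sec U) : x.frame.d i f = x.frame.d i (y.x 0) * y.frame.d 0 f
    + x.frame.d i (y.x 1) * y.frame.d 1 f + x.frame.d i (y.x 2) * y.frame.d 2 f :=
  y.vectorField_apply (x.partialD i) f

theorem restrict_frame_d {V : Opens C.top} (h : V ≤ U) (i : Fin 3) (f : C.Sec U) :
    (x.restrict h).frame.d i (res h f) = res h (x.frame.d i f) :=
  (x.partialD i).app_res U V le_rfl h f

/-- The coordinates obtained by a change of the even coordinate. -/
def changeEven (w b : C.Sec U) (hw : Parity.inv w = w) (hb : Parity.inv b = b)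
    (hbw : b * x.frame.d 0 w = 1) : Coords π U where
  x := ![w, x.x 1, x.x 2]
  parity i := by
    fin_cases i
    · exact hasParity_zero_iff.2 hw
    · exact x.parity 1
    · exact x.parity 2
  -- The field dual to `w` is `b ∂_z`; from each odd derivative a multiple of `∂_z` is subtracted so
  -- that it kills `w`.
  partialD i := match i with
    | 0 => VectorField.mulLeft (j := 0) (i := 0) b (hasParity_zero_iff.2 hb) (x.partialD 0)
    | 1 => (x.partialD 1).sub (VectorField.mulLeft (j := 1) (i := 0) (b * x.frame.d 1 w)
        (hasParity_one_iff.2 (by simp [hb, x.frame.inv_d, hw])) (x.partialD 0))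
    | 2 => (x.partialD 2).sub (VectorField.mulLeft (j := 1) (i := 0) (b * x.frame.d 2 w)
        (hasParity_one_iff.2 (by simp [hb, x.frame.inv_d, hw])) (x.partialD 0))
  dual i j := by
    have e : ∀ l : Fin 3, b * x.frame.d l w * x.frame.d 0 w = x.frame.d l w := fun l => by
      rw [even_comm hb, mul_assoc, hbw, mul_one]
    fin_cases i <;> fin_cases j <;>
      simp [VectorField.sub, VectorField.mulLeft, res_self, x.dual, ← frame_d, ← mul_assoc, e, hbw]
  unique V hV j D hD W hW f := by
    refine x.unique V hV j D (fun i => ?_) W hW f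
    fin_cases i
    -- As `D` kills the odd coordinates, the chain rule gives `D w = D z · ∂_z w`, and `∂_z w` is
    -- invertible.
    · have h := (x.restrict hV).vectorField_apply D (res hV w)
      have h0 := hD 0
      have h1 := hD 1
      have h2 := hD 2
      change D.app V le_rfl (res hV w) = 0 at h0
      change D.app V le_rfl ((x.restrict hV).x 1) = 0 at h1
      change D.app V le_rfl ((x.restrict hV).x 2) = 0 at h2
      rw [h0, h1, h2, zero_mul, zero_mul, add_zero, add_zero, ← frame_d, restrict_frame_d] at h
      have hu : res hV (x.frame.d 0 w) * res hV b = 1 := by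
        rw [← map_mul, ← even_comm hb, hbw, map_one]
      have h3 := congrArg (· * res hV b) h
      simp only [zero_mul, mul_assoc, hu, mul_one] at h3
      exact h3.symm
    · exact hD 1
    · exact hD 2

theorem changeEven_frame_d_zero (w b : C.Sec U) (hw : Parity.inv w = w) (hb : Parity.inv b = b)
    (hbw : b * x.frame.d 0 w = 1) (f : C.Sec U) :
    (x.changeEven w b hw hb hbw).frame.d 0 f = b * x.frame.d 0 f := by
  simp [frame_d, changeEven, VectorField.mulLeft, res_self]

theorem changeEven_frame_d_one (w b : C.Sec U) (hw : Parity.inv w = w) (hb : Parity.inv b = b)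
    (hbw : b * x.frame.d 0 w = 1) (f : C.Sec U) :
    (x.changeEven w b hw hb hbw).frame.d 1 f = x.frame.d 1 f - b * x.frame.d 1 w * x.frame.d 0 f := by
  simp [frame_d, changeEven, VectorField.mulLeft, VectorField.sub, res_self, mul_assoc]

theorem changeEven_frame_d_two (w b : C.Sec U) (hw : Parity.inv w = w) (hb : Parity.inv b = b)
    (hbw : b * x.frame.d 0 w = 1) (f : C.Sec U) :
    (x.changeEven w b hw hb hbw).frame.d 2 f = x.frame.d 2 f - b * x.frame.d 2 w * x.frame.d 0 f := by
  simp [frame_d, changeEven, VectorField.mulLeft, VectorField.sub, res_self, mul_assoc]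

theorem berJacobian_changeEven (w b : C.Sec U) (hw : Parity.inv w = w) (hb : Parity.inv b = b)
    (hbw : b * x.frame.d 0 w = 1) :
    x.berJacobian (x.changeEven w b hw hb hbw) = x.frame.d 0 w := by
  simp [berJacobian, berezinian, changeEven, x.dual, frame_d]

theorem berJacobian_eq_inverse (h : y.x 0 = x.x 0) : x.berJacobian y = Ring.inverse
    (x.frame.d 1 (y.x 1) * x.frame.d 2 (y.x 2) - x.frame.d 1 (y.x 2) * x.frame.d 2 (y.x 1)) := by
  simp [berJacobian, berezinian, h, x.dual, frame_d]

end Coords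

/-- The Berezin integral of a divergence free vector field does not depend on the compatible
coordinates. -/
theorem BerSection.Compatible.top_eq {Δ : BerSection π} {U : Opens C.top} (x y : Δ.Compatible U)
    (V : VectorField π U 0) (hV : x.1.frame.div (V.app U le_rfl) = 0) :
    x.1.frame.top (V.app U le_rfl (x.1.x 0)) = y.1.frame.top (V.app U le_rfl (y.1.x 0)) := by
  obtain ⟨x, hx⟩ := x
  obtain ⟨y, hy⟩ := y
  change x.frame.div _ = 0 at hV
  change x.frame.top _ = y.frame.top _
  have hy0 : Parity.inv (y.x 0) = y.x 0 := y.frame.inv_x0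
  have hx0 : Parity.inv (x.x 0) = x.x 0 := x.frame.inv_x0
  have hx1 : Parity.inv (x.x 1) = -x.x 1 := x.frame.inv_x1
  have hx2 : Parity.inv (x.x 2) = -x.x 2 := x.frame.inv_x2
  -- The chain rule for `∂_{y₀} y₀ = 1` inverts `∂_{x₀} y₀` up to two products of odd functions.
  obtain ⟨b, hb, hbw⟩ : ∃ b, Parity.inv b = b ∧ b * x.frame.d 0 (y.x 0) = 1 := by
    have h := y.frame_d_eq x 0 (y.x 0)
    have h1 : y.frame.d 0 (y.x 0) = 1 := y.dual 0 0
    rw [h1] at h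
    refine exists_even_inverse ?_ ?_ ?_ ?_ ?_ h.symm <;>
      simp [Frame.inv_d, hy0, hx0, hx1, hx2]
  -- The change from `x` to `y` is factored through `(y₀ | x₁, x₂)`: the first factor changes only
  -- the even coordinate, the second only the odd ones.
  set m := x.changeEven (y.x 0) b hy0 hb hbw with hm
  have hm0 : m.x 0 = y.x 0 := rfl
  have c1 := Δ.change x m
  have c2 := Δ.change m y
  rw [hx, x.berJacobian_changeEven] at c1
  rw [hy, one_mul, m.berJacobian_eq_inverse y hm0.symm] at c2
  have hu : IsUnit (m.frame.d 1 (y.x 1) * m.frame.d 2 (y.x 2)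
      - m.frame.d 1 (y.x 2) * m.frame.d 2 (y.x 1)) := by
    by_contra hu
    rw [Ring.inverse_non_unit _ hu] at c2
    rw [c2, zero_mul] at c1
    have := subsingleton_of_zero_eq_one c1.symm
    exact hu (isUnit_of_subsingleton _)
  -- The Berezinians of the two factors are `∂_{x₀} y₀` and the inverse of this determinant.
  -- Compatibility makes their product `1`, so the determinant cancels the factor `b` from the first
  -- change.
  have hD : m.frame.d 1 (y.x 1) * m.frame.d 2 (y.x 2)
      - m.frame.d 1 (y.x 2) * m.frame.d 2 (y.x 1) = x.frame.d 0 (y.x 0) := by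
    rw [← mul_one (_ - _), c1, c2, ← mul_assoc, Ring.mul_inverse_cancel _ hu, one_mul]
  have s1 := (x.isEven V).top_eq (G := m.frame) hV hb hbw (fun i => b * x.frame.d i (y.x 0))
    (fun _ => rfl) (x.changeEven_frame_d_one _ _ hy0 hb hbw)
    (x.changeEven_frame_d_two _ _ hy0 hb hbw)
  have z : ∀ i, i ≠ 0 → m.frame.d i (y.x 0) = 0 := fun i hi => by
    rw [← hm0]
    exact (m.dual i 0).trans (if_neg hi)
  have s2 := Frame.top_eq_top_mul m.frame y.frame
    (fun a => by rw [m.frame_d_eq y, z 1 (by decide), zero_mul, zero_add]; rfl)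
    (fun a => by rw [m.frame_d_eq y, z 2 (by decide), zero_mul, zero_add]; rfl) hu
  rw [← x.frame_x, s1, s2]
  change y.frame.top ((m.frame.d 1 (y.x 1) * m.frame.d 2 (y.x 2)
      - m.frame.d 1 (y.x 2) * m.frame.d 2 (y.x 1)) * (b * V.app U le_rfl (y.x 0))) = _
  rw [hD, ← mul_assoc, ← even_comm hb, hbw, one_mul]

/-! ### The invariant of a change of coordinates -/

namespace Coords

variable {U : Opens C.top} (x y z : Coords π U)

/-- The vector field `y₀ ∂_{y₀}`. -/
def scaling : VectorField π U 0 :=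
  VectorField.mulLeft (j := 0) (i := 0) (y.x 0) (y.parity 0) (y.partialD 0)

theorem scaling_apply (f : C.Sec U) : y.scaling.app U le_rfl f = y.x 0 * y.frame.d 0 f := by
  simp [scaling, VectorField.mulLeft, res_self, frame_d]

/-- The obstruction `c` for the change of coordinates from `x` to `y` to be in `Aut^Δ`. -/
def flux : C.Sec U := x.frame.top (y.x 0 * y.frame.d 0 (x.x 0))

theorem flux_eq : x.flux y = x.frame.top (y.scaling.app U le_rfl (x.x 0)) := by
  rw [scaling_apply, flux]

theorem flux_restrict {V : Opens C.top} (h : V ≤ U) :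
    (x.restrict h).flux (y.restrict h) = res h (x.flux y) := by
  simp only [flux, Frame.top]
  have e1 : (y.restrict h).x 0 = res h (y.x 0) := rfl
  have e2 : (x.restrict h).x 0 = res h (x.x 0) := rfl
  rw [e1, e2, restrict_frame_d, ← map_mul, restrict_frame_d, restrict_frame_d]

theorem flux_self : x.flux x = 0 := by
  have h0 : x.frame.d 0 (x.x 0) = 1 := x.dual 0 0
  have h1 : x.frame.d 1 (x.x 0) = 0 := x.dual 1 0
  rw [flux, h0, mul_one, Frame.top, h1, map_zero]

theorem inv_flux : Parity.inv (x.flux y) = x.flux y := by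
  rw [flux, Frame.inv_top, map_mul, Frame.inv_d, ← frame_x, ← frame_x, Frame.inv_x0, Frame.inv_x0]
  simp

end Coords

namespace BerSection.Compatible

variable {Δ : BerSection π} {U : Opens C.top} (x y z : Δ.Compatible U)

theorem berJacobian_eq_one : x.1.berJacobian y.1 = 1 := by
  have := Δ.change x.1 y.1
  rw [x.2, y.2, one_mul] at this
  exact this.symm

/-- The field scales `(y₀ | y₁, y₂)` with weights `(1 | 0, 0)`, and the Jacobian has Berezinian `1`,
so `div_eq` gives `1 - 0 - 0`. -/
theorem div_scaling : x.1.frame.div (y.1.scaling.app U le_rfl) = 1 := by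
  have := (x.1.isEven y.1.scaling).div_eq (y := y.1.x) (κ := ![1, 0, 0]) y.1.frame.inv_x
    (x.berJacobian_eq_one y) (fun i j => by
      rw [Coords.scaling_apply, Coords.frame_d y.1, y.1.dual]
      fin_cases j <;> simp)
  simpa using this

theorem div_partialD_zero : x.1.frame.div ((y.1.partialD 0).app U le_rfl) = 0 := by
  have := (x.1.isEven (y.1.partialD 0)).div_eq (y := y.1.x) (κ := ![0, 0, 0]) y.1.frame.inv_x
    (x.berJacobian_eq_one y) (fun i j => by
      rw [y.1.dual]
      fin_cases j <;> simp [Frame.d_one])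
  simpa using this

/-- The field `∂_{y₀}` is divergence free, so its integral can be computed in `y`, where the
component is the constant `1`. This makes the flux insensitive to the translation of `y₀` in the
Taylor expansion. -/
theorem top_partialD_zero : x.1.frame.top (y.1.frame.d 0 (x.1.x 0)) = 0 := by
  have h := x.top_eq y (y.1.partialD 0) (x.div_partialD_zero y)
  rw [← Coords.frame_d, ← Coords.frame_d] at h
  have h0 : y.1.frame.d 0 (y.1.x 0) = 1 := y.1.dual 0 0
  rw [h, h0, Frame.top, Frame.d_one, map_zero]

/-- The even derivative of the flux is `top` of the divergence of the scaling field, hence `top 1 =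
0`; odd derivatives of `top` always vanish. -/
theorem flux_mem : x.1.flux y.1 ∈ relativeConstants π U := by
  have h0 : ∀ i, x.1.frame.d i (x.1.flux y.1) = 0 := fun i => by
    rw [Coords.flux_eq]
    fin_cases i
    · have h := x.1.frame.d0_top_apply (y.1.scaling.app U le_rfl)
      rw [x.div_scaling y] at h
      exact h.trans (by rw [Frame.top, Frame.d_one, map_zero])
    · exact x.1.frame.d1_top _
    · exact x.1.frame.d2_top _
  refine ⟨hasParity_zero_iff.2 (Coords.inv_flux _ _), fun V hV j D => ?_⟩
  rw [(x.1.restrict hV).vectorField_apply D]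
  simp only [← Coords.frame_d, Coords.restrict_frame_d, h0, map_zero, mul_zero, add_zero]

/-- The difference of the scaling fields of `z` and `y` is divergence free, so its integral is the
same in `x` and in `y`; in `y` the second field contributes `0`. -/
theorem flux_add_flux : x.1.flux y.1 + y.1.flux z.1 = x.1.flux z.1 := by
  let W := z.1.scaling.sub y.1.scaling
  have hW : ∀ f, W.app U le_rfl f = z.1.scaling.app U le_rfl f - y.1.scaling.app U le_rfl f :=
    fun f => rfl
  have hdiv : x.1.frame.div (W.app U le_rfl) = 0 := by
    have h1 := x.div_scaling y
    have h2 := x.div_scaling z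
    have h3 := (h2.trans h1.symm)
    rw [← sub_eq_zero] at h3
    rw [← h3]
    simp only [Frame.div, hW, map_sub]
    abel
  have h := x.top_eq y W hdiv
  rw [hW, hW, Frame.top_sub, Frame.top_sub, ← Coords.flux_eq, ← Coords.flux_eq, ← Coords.flux_eq,
    ← Coords.flux_eq, Coords.flux_self, sub_zero] at h
  rw [← h]
  abel

theorem flux_symm : y.1.flux x.1 = -x.1.flux y.1 := by
  have := y.flux_add_flux x y
  rw [Coords.flux_self] at this
  exact eq_neg_of_add_eq_zero_left this

end BerSection.Compatible

section Shift

variable {U : Opens C.top} (x : Coords π U) (c : relativeConstants π U)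

theorem Coords.frame_d_constant (i : Fin 3) : x.frame.d i c.1 = 0 := by
  have := c.2.2 U le_rfl _ (x.partialD i)
  rwa [res_self] at this

theorem inv_constant : Parity.inv c.1 = c.1 := hasParity_zero_iff.1 c.2.1

theorem Coords.inv_shift : Parity.inv (x.x 0 + c.1 * (x.x 1 * x.x 2)) =
    x.x 0 + c.1 * (x.x 1 * x.x 2) := by
  simp [← frame_x, x.frame.inv_x0, x.frame.inv_x1, x.frame.inv_x2, inv_constant]

theorem Coords.frame_d_shift : x.frame.d 0 (x.x 0 + c.1 * (x.x 1 * x.x 2)) = 1 := by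
  simp only [map_add, x.frame.d_mul, x.frame_d_constant, ← frame_x, x.frame.d_x]
  simp

/-- The coordinates `(z + c θ¹ θ² | θ¹, θ²)`. -/
def Coords.shift : Coords π U :=
  x.changeEven (x.x 0 + c.1 * (x.x 1 * x.x 2)) 1 (x.inv_shift c) (map_one _)
    (by rw [one_mul, x.frame_d_shift])

/-- Every even relative constant occurs as a flux, which makes the action of `𝔾_a` visible to the
cocycle. -/
theorem Coords.flux_shift : x.flux (x.shift c) = c.1 := by
  have e : (x.shift c).frame.d 0 (x.x 0) = 1 := by
    rw [shift, changeEven_frame_d_zero, one_mul, ← frame_x, x.frame.d_x, if_pos rfl]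
  rw [flux, e, mul_one]
  change x.frame.top (x.frame.x 0 + c.1 * (x.frame.x 1 * x.frame.x 2)) = _
  simp [Frame.top, x.frame.d_mul, x.frame_d_constant, x.frame.d_x, inv_constant]

/-- The compatible coordinates `(z + c θ¹ θ² | θ¹, θ²)`. -/
def BerSection.Compatible.shift {Δ : BerSection π} (x : Δ.Compatible U)
    (c : relativeConstants π U) : Δ.Compatible U :=
  ⟨x.1.shift c, by
    have h := Δ.change x.1 (x.1.shift c)
    rw [x.2, Coords.shift, Coords.berJacobian_changeEven, Coords.frame_d_shift, mul_one] at h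
    exact h.symm⟩

end Shift

end

end SuperCurve

/-! ### Formal derivatives and the `𝔪`-adic filtration of `R[[1|2]]`. -/

namespace SuperCurve
noncomputable section

section PowerSeriesDerivative

variable {R : Type v} [Ring R]

/-- The derivative of a power series over a noncommutative ring. -/
def dPS : PowerSeries R →+ PowerSeries R where
  toFun f := PowerSeries.mk fun n => ((n + 1 : ℕ) : R) * PowerSeries.coeff (n + 1) f
  map_zero' := by ext; simp
  map_add' f g := by ext; simp [mul_add]

theorem coeff_dPS (f : PowerSeries R) (n : ℕ) :
    PowerSeries.coeff n (dPS f) = ((n + 1 : ℕ) : R) * PowerSeries.coeff (n + 1) f := by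
  simp [dPS]

theorem dPS_mul (f g : PowerSeries R) : dPS (f * g) = dPS f * g + f * dPS g := by
  ext n
  rw [map_add, coeff_dPS, PowerSeries.coeff_mul, PowerSeries.coeff_mul, PowerSeries.coeff_mul]
  -- On the antidiagonal of `n + 1` the factor `n + 1` splits as `p.1 + p.2`; in each half the
  -- boundary term has weight zero.
  have e1 := Finset.Nat.sum_antidiagonal_succ (n := n)
    (f := fun p : ℕ × ℕ => ((p.1 : ℕ) : R) * (PowerSeries.coeff p.1 f * PowerSeries.coeff p.2 g))
  have e2 := Finset.Nat.sum_antidiagonal_succ' (n := n)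
    (f := fun p : ℕ × ℕ => ((p.2 : ℕ) : R) * (PowerSeries.coeff p.1 f * PowerSeries.coeff p.2 g))
  simp only [Nat.cast_zero, zero_mul, zero_add] at e1 e2
  simp only [coeff_dPS]
  calc _ = ∑ p ∈ Finset.HasAntidiagonal.antidiagonal (n + 1),
        (((p.1 : ℕ) : R) * (PowerSeries.coeff p.1 f * PowerSeries.coeff p.2 g)
        + ((p.2 : ℕ) : R) * (PowerSeries.coeff p.1 f * PowerSeries.coeff p.2 g)) := by
          rw [Finset.mul_sum]
          refine Finset.sum_congr rfl fun p hp => ?_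
          rw [← add_mul, ← Nat.cast_add, Finset.HasAntidiagonal.mem_antidiagonal.1 hp]
    _ = _ := by
          rw [Finset.sum_add_distrib, e1, e2]
          congr 1
          · exact Finset.sum_congr rfl fun p _ => by rw [mul_assoc]
          · refine Finset.sum_congr rfl fun p _ => ?_
            rw [← mul_assoc, ← mul_assoc, (Nat.cast_commute _ _).eq]

theorem dPS_inv [Parity R] (f : PowerSeries R) : dPS (Parity.inv f) = Parity.inv (dPS f) := by
  ext n
  simp [coeff_dPS]

theorem dPS_X : dPS (PowerSeries.X : PowerSeries R) = 1 := by
  ext n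
  rw [coeff_dPS, PowerSeries.coeff_X, PowerSeries.coeff_one]
  rcases n with _ | n <;> simp

theorem dPS_one : dPS (1 : PowerSeries R) = 0 := by
  ext n
  simp [coeff_dPS, PowerSeries.coeff_one]

theorem dPS_C (r : R) : dPS (PowerSeries.C r) = 0 := by
  ext n
  simp [coeff_dPS]

/-- `f` is divisible by `X ^ N`. -/
def OrdGE (N : ℕ) (f : PowerSeries R) : Prop := ∀ n < N, PowerSeries.coeff n f = 0

variable {N M : ℕ} {f g : PowerSeries R}

theorem OrdGE.zero : OrdGE N (0 : PowerSeries R) := fun _ _ => map_zero _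

theorem OrdGE.add (hf : OrdGE N f) (hg : OrdGE N g) : OrdGE N (f + g) := fun n hn => by
  rw [map_add, hf n hn, hg n hn, add_zero]

theorem OrdGE.neg (hf : OrdGE N f) : OrdGE N (-f) := fun n hn => by rw [map_neg, hf n hn, neg_zero]

theorem OrdGE.mono (hf : OrdGE N f) (h : M ≤ N) : OrdGE M f := fun n hn => hf n (hn.trans_le h)

theorem OrdGE.mul (hf : OrdGE N f) (hg : OrdGE M g) : OrdGE (N + M) (f * g) := fun n hn => by
  rw [PowerSeries.coeff_mul]
  refine Finset.sum_eq_zero fun p hp => ?_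
  have := Finset.HasAntidiagonal.mem_antidiagonal.1 hp
  rcases lt_or_ge p.1 N with h | h
  · rw [hf _ h, zero_mul]
  · rw [hg p.2 (by omega), mul_zero]

theorem OrdGE.inv [Parity R] (hf : OrdGE N f) : OrdGE N (Parity.inv f) := fun n hn => by
  rw [coeff_inv, hf n hn, map_zero]

theorem OrdGE.d (hf : OrdGE N f) : OrdGE (N - 1) (dPS f) := fun n hn => by
  rw [coeff_dPS, hf _ (by omega), mul_zero]

end PowerSeriesDerivative

namespace Disk

variable {R : Type v} [Ring R] [Parity R]

/-- Equality of the four components of elements of `R[[1|2]]`. -/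
theorem ext4 {f g : Disk R} (h0 : f.fst.fst = g.fst.fst) (h1 : f.fst.snd = g.fst.snd)
    (h2 : f.snd.fst = g.snd.fst) (h3 : f.snd.snd = g.snd.snd) : f = g :=
  Grassmann.ext (Grassmann.ext h0 h1) (Grassmann.ext h2 h3)

/-- Each `θ` has degree one and lowers the required order in `t` by one. Truncated subtraction is
harmless: for small `N` both forms of the condition are empty. -/
theorem mem_maxPow_iff {N : ℕ} {f : Disk R} : f ∈ maxPow (R := R) N ↔
    OrdGE N f.fst.fst ∧ OrdGE (N - 1) f.fst.snd ∧ OrdGE (N - 1) f.snd.fst ∧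
      OrdGE (N - 2) f.snd.snd := by
  constructor
  · intro h
    exact ⟨fun n hn => (h n).1 hn, fun n hn => ((h n).2.1 (by omega)).1,
      fun n hn => ((h n).2.1 (by omega)).2, fun n hn => (h n).2.2 (by omega)⟩
  · rintro ⟨h0, h1, h2, h3⟩ n
    exact ⟨fun hn => h0 n hn, fun hn => ⟨h1 n (by omega), h2 n (by omega)⟩,
      fun hn => h3 n (by omega)⟩

variable (R) in
/-- The powers of the ideal `𝔪 = (t, θ¹, θ²)` as additive subgroups. -/
def mPow (N : ℕ) : AddSubgroup (Disk R) where
  carrier := maxPow N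
  zero_mem' := mem_maxPow_iff.2 ⟨OrdGE.zero, OrdGE.zero, OrdGE.zero, OrdGE.zero⟩
  add_mem' ha hb := by
    rw [mem_maxPow_iff] at *
    exact ⟨ha.1.add hb.1, ha.2.1.add hb.2.1, ha.2.2.1.add hb.2.2.1, ha.2.2.2.add hb.2.2.2⟩
  neg_mem' ha := by
    rw [mem_maxPow_iff] at *
    exact ⟨ha.1.neg, ha.2.1.neg, ha.2.2.1.neg, ha.2.2.2.neg⟩

theorem mem_mPow_iff {N : ℕ} {f : Disk R} : f ∈ mPow R N ↔
    OrdGE N f.fst.fst ∧ OrdGE (N - 1) f.fst.snd ∧ OrdGE (N - 1) f.snd.fst ∧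
      OrdGE (N - 2) f.snd.snd := mem_maxPow_iff

theorem mem_mPow_zero (f : Disk R) : f ∈ mPow R 0 :=
  mem_mPow_iff.2 ⟨fun _ h => by omega, fun _ h => by omega, fun _ h => by omega,
    fun _ h => by omega⟩

theorem mPow_mono {N M : ℕ} (h : M ≤ N) {f : Disk R} (hf : f ∈ mPow R N) : f ∈ mPow R M := by
  rw [mem_mPow_iff] at *
  exact ⟨hf.1.mono h, hf.2.1.mono (by omega), hf.2.2.1.mono (by omega), hf.2.2.2.mono (by omega)⟩

theorem eq_zero_of_mem_mPow {f : Disk R} (h : ∀ N, f ∈ mPow R N) : f = 0 := by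
  have h' := fun N => mem_mPow_iff.1 (h N)
  refine ext4 ?_ ?_ ?_ ?_ <;> ext n
  · exact (h' (n + 1)).1 n (by omega)
  · exact (h' (n + 2)).2.1 n (by omega)
  · exact (h' (n + 2)).2.2.1 n (by omega)
  · exact (h' (n + 3)).2.2.2 n (by omega)

theorem mul_mem_mPow {N M : ℕ} {f g : Disk R} (hf : f ∈ mPow R N) (hg : g ∈ mPow R M) :
    f * g ∈ mPow R (N + M) := by
  rw [mem_mPow_iff] at *
  obtain ⟨f0, f1, f2, f3⟩ := hf
  obtain ⟨g0, g1, g2, g3⟩ := hg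
  simp only [Grassmann.fst_mul, Grassmann.snd_mul, Grassmann.fst_add, Grassmann.snd_add,
    Grassmann.fst_inv, Grassmann.snd_inv, Parity.inv_inv]
  refine ⟨f0.mul g0, ((f0.mul g1).mono (by omega)).add ((f1.mul g0.inv).mono (by omega)),
    ((f0.mul g2).mono (by omega)).add ((f2.mul g0.inv).mono (by omega)), ?_⟩
  exact (((f0.mul g3).mono (by omega)).add ((f1.mul g2.inv).mono (by omega))).add
    (((f2.mul g1.inv.neg).mono (by omega)).add ((f3.mul g0).mono (by omega)))

theorem inv_mem_mPow {N : ℕ} {f : Disk R} (hf : f ∈ mPow R N) : Parity.inv f ∈ mPow R N := by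
  rw [mem_mPow_iff] at *
  exact ⟨hf.1.inv, hf.2.1.inv.neg, hf.2.2.1.inv.neg, by
    simpa using hf.2.2.2.inv⟩

theorem smul_mem_mPow {k : Type u} [Field k] [Module k R] {N : ℕ} (c : k) {f : Disk R}
    (hf : f ∈ mPow R N) : c • f ∈ mPow R N := by
  have : ∀ {n : ℕ} {p : PowerSeries R}, OrdGE n p → OrdGE n (c • p) := fun {_ p} h m hm => by
    change c • PowerSeries.coeff (R := R) m p = 0
    rw [h m hm, smul_zero]
  rw [mem_mPow_iff] at *
  exact ⟨this hf.1, this hf.2.1, this hf.2.2.1, this hf.2.2.2⟩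

theorem pow_mem_mPow {f : Disk R} (hf : f ∈ mPow R 1) (n : ℕ) : f ^ n ∈ mPow R n := by
  induction n with
  | zero => exact mem_mPow_zero _
  | succ n ih => rw [pow_succ]; exact mul_mem_mPow ih hf

theorem gen_mem_mPow (i : Fin 3) : gen (R := R) i ∈ mPow R 1 := by
  rw [mem_mPow_iff]
  fin_cases i
  · refine ⟨fun n hn => ?_, OrdGE.zero, OrdGE.zero, OrdGE.zero⟩
    obtain rfl : n = 0 := by omega
    exact PowerSeries.coeff_zero_X
  · exact ⟨OrdGE.zero, fun n hn => by omega, OrdGE.zero, OrdGE.zero⟩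
  · exact ⟨OrdGE.zero, OrdGE.zero, fun n hn => by omega, OrdGE.zero⟩

/-! ### The frame of `R[[1|2]]` -/

theorem partialD_zero (f : Disk R) :
    partialD 0 f = ⟨⟨dPS f.fst.fst, dPS f.fst.snd⟩, ⟨dPS f.snd.fst, dPS f.snd.snd⟩⟩ := rfl

theorem partialD_one (f : Disk R) :
    partialD 1 f = ⟨⟨Parity.inv f.fst.snd, 0⟩, ⟨Parity.inv f.snd.snd, 0⟩⟩ := rfl

theorem partialD_two (f : Disk R) :
    partialD 2 f = ⟨⟨Parity.inv f.snd.fst, -Parity.inv f.snd.snd⟩, 0⟩ := rfl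

theorem gen_zero : gen (R := R) 0 = ⟨⟨PowerSeries.X, 0⟩, 0⟩ := rfl
theorem gen_one : gen (R := R) 1 = ⟨⟨0, 1⟩, 0⟩ := rfl
theorem gen_two : gen (R := R) 2 = ⟨0, 1⟩ := rfl

variable (R) in
/-- The coordinates `(t | θ¹, θ²)` of `R[[1|2]]`. -/
def frame : Frame (Disk R) where
  d i := AddMonoidHom.mk' (partialD i) fun f g => by
    fin_cases i
    · refine ext4 ?_ ?_ ?_ ?_ <;> simp [partialD_zero]
    · refine ext4 ?_ ?_ ?_ ?_ <;> simp [partialD_one]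
    · refine ext4 ?_ ?_ ?_ ?_ <;> simp [partialD_two, add_comm]
  x := gen
  inv_x i := by
    have hX : Parity.inv (PowerSeries.X : PowerSeries R) = PowerSeries.X := PowerSeries.map_X _
    fin_cases i <;> refine ext4 ?_ ?_ ?_ ?_ <;> simp [gen_zero, gen_one, gen_two, hX]
  inv_d i f := by
    fin_cases i <;> refine ext4 ?_ ?_ ?_ ?_ <;>
      simp [partialD_zero, partialD_one, partialD_two, dPS_inv]
  d_mul i f g := by
    fin_cases i <;> refine ext4 ?_ ?_ ?_ ?_ <;>
      simp [partialD_zero, partialD_one, partialD_two, dPS_inv, dPS_mul, Parity.inv_inv] <;> abel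
  d_comm i f := by
    fin_cases i <;> refine ext4 ?_ ?_ ?_ ?_ <;>
      simp [partialD_zero, partialD_one, partialD_two, dPS_inv]
  d_anti i j f hi hj := by
    fin_cases i <;> fin_cases j <;> first | exact absurd rfl hi | exact absurd rfl hj | skip
    all_goals
      refine ext4 ?_ ?_ ?_ ?_ <;>
        simp [partialD_one, partialD_two, Parity.inv_inv]
  d_x i j := by
    fin_cases i <;> fin_cases j <;> refine ext4 ?_ ?_ ?_ ?_ <;>
      simp [partialD_zero, partialD_one, partialD_two, gen_zero, gen_one, gen_two, dPS_X,
        dPS_one]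

theorem frame_d (i : Fin 3) (f : Disk R) : (frame R).d i f = partialD i f := rfl

theorem frame_x (i : Fin 3) : (frame R).x i = gen i := rfl

theorem partialD_mem_mPow {N : ℕ} (i : Fin 3) {f : Disk R} (hf : f ∈ mPow R N) :
    (frame R).d i f ∈ mPow R (N - 1) := by
  rw [mem_mPow_iff] at *
  rw [frame_d]
  obtain ⟨h0, h1, h2, h3⟩ := hf
  fin_cases i
  · exact ⟨h0.d, h1.d, h2.d, h3.d.mono (by omega)⟩
  · exact ⟨h1.inv, OrdGE.zero, h3.inv.mono (by omega), OrdGE.zero⟩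
  · exact ⟨h2.inv, h3.inv.neg.mono (by omega), OrdGE.zero, OrdGE.zero⟩

theorem inv_const (r : R) : Parity.inv (const r) = const (Parity.inv r) :=
  ext4 (PowerSeries.map_C _ _) (by simp [const]) (by simp [const]) (by simp [const])

variable (R) in
/-- The power series in `t` as elements of `R[[1|2]]`. -/
def ofPS : PowerSeries R →+* Disk R where
  toFun p := ⟨⟨p, 0⟩, 0⟩
  map_one' := rfl
  map_zero' := rfl
  map_add' p q := by refine ext4 ?_ ?_ ?_ ?_ <;> simp
  map_mul' p q := by refine ext4 ?_ ?_ ?_ ?_ <;> simp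

theorem ofPS_apply (p : PowerSeries R) : ofPS R p = ⟨⟨p, 0⟩, 0⟩ := rfl

variable (R) in
/-- The constants as a ring homomorphism. -/
def constHom : R →+* Disk R := (ofPS R).comp PowerSeries.C

theorem constHom_apply (r : R) : constHom R r = const r := rfl

theorem partialD_const (i : Fin 3) (r : R) : (frame R).d i (const r) = 0 := by
  rw [frame_d]
  fin_cases i <;> refine ext4 ?_ ?_ ?_ ?_ <;>
    simp [partialD_zero, partialD_one, partialD_two, const, dPS_C]

theorem eq_sum_components (f : Disk R) : f = ofPS R f.fst.fst + ofPS R f.fst.snd * gen 1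
    + ofPS R f.snd.fst * gen 2 + ofPS R f.snd.snd * (gen 1 * gen 2) := by
  refine ext4 ?_ ?_ ?_ ?_ <;> simp [ofPS_apply, gen_one, gen_two]

theorem ofPS_eq_const_add (p : PowerSeries R) : ∃ q, ofPS R p =
    const (PowerSeries.coeff 0 p) + gen 0 * ofPS R q := by
  refine ⟨PowerSeries.mk fun n => PowerSeries.coeff (n + 1) p, ?_⟩
  have h := PowerSeries.eq_X_mul_shift_add_const p
  conv_lhs => rw [h]
  rw [map_add, map_mul, add_comm, PowerSeries.coeff_zero_eq_constantCoeff_apply]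
  rfl

/-- Continuity: an additive map that kills constants and satisfies `D(t p) = u D(p)` with `u ∈ 𝔪`
kills `R[[t]]`. -/
theorem map_ofPS_eq_zero {D : Disk R → Disk R} (hadd : ∀ f g, D (f + g) = D f + D g) {u : Disk R}
    (hu : u ∈ mPow R 1) (hc : ∀ r, D (const r) = 0) (hD : ∀ f, D (gen 0 * f) = u * D f)
    (p : PowerSeries R) : D (ofPS R p) = 0 := by
  -- Writing `p = p(0) + t q` gives `D p = u * D q`, so every round gains a factor in `𝔪`.
  refine eq_zero_of_mem_mPow fun N => ?_
  induction N generalizing p with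
  | zero => exact mem_mPow_zero _
  | succ N ih =>
    obtain ⟨q, hq⟩ := ofPS_eq_const_add p
    rw [hq, hadd, hc, hD, zero_add, add_comm N]
    exact mul_mem_mPow hu (ih q)

/-- A ring endomorphism is determined by its values on the constants and the generators. -/
theorem ringHom_ext {F G : Disk R →+* Disk R} (hm : F (gen 0) ∈ mPow R 1)
    (hc : ∀ r, F (const r) = G (const r)) (hg : ∀ i, F (gen i) = G (gen i)) : F = G := by
  have h : ∀ p, F (ofPS R p) = G (ofPS R p) := fun p => by
    rw [← sub_eq_zero]
    refine map_ofPS_eq_zero (D := fun f => F f - G f) (fun f g => ?_) hm (fun r => ?_)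
      (fun f => ?_) p
    · simp only [map_add]; abel
    · rw [hc, sub_self]
    · rw [map_mul, map_mul, ← hg, mul_sub]
  ext1 f
  rw [eq_sum_components f]
  simp only [map_add, map_mul, h, hg]

end Disk

end

end SuperCurve

/-! ### Convergent sums and exponentials of vector fields. -/

namespace SuperCurve
noncomputable section

namespace Disk

section Sums

variable {R : Type v} [Ring R] [Parity R]

/-- `s` is the `𝔪`-adic sum of `a`, whose `n`-th term is to be in `𝔪ⁿ`. -/
def IsSum (a : ℕ → Disk R) (s : Disk R) : Prop :=
  ∀ N, s - ∑ n ∈ Finset.range N, a n ∈ mPow R N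

theorem IsSum.unique {a : ℕ → Disk R} {s t : Disk R} (hs : IsSum a s) (ht : IsSum a t) : s = t := by
  rw [← sub_eq_zero]
  refine eq_zero_of_mem_mPow fun N => ?_
  have := (mPow R N).sub_mem (hs N) (ht N)
  rwa [sub_sub_sub_cancel_right] at this

theorem IsSum.map {a : ℕ → Disk R} {s : Disk R} (hs : IsSum a s) (L : Disk R →+ Disk R)
    (hL : ∀ N, ∀ f ∈ mPow R N, L f ∈ mPow R N) : IsSum (fun n => L (a n)) (L s) := fun N => by
  have := hL N _ (hs N)
  rwa [map_sub, map_sum] at this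

theorem IsSum.add {a b : ℕ → Disk R} {s t : Disk R} (hs : IsSum a s) (ht : IsSum b t) :
    IsSum (fun n => a n + b n) (s + t) := fun N => by
  have := (mPow R N).add_mem (hs N) (ht N)
  rw [Finset.sum_add_distrib]
  convert this using 1
  abel

theorem IsSum.mem_mPow {a : ℕ → Disk R} {s : Disk R} (hs : IsSum a s) {N : ℕ}
    (ha : ∀ n, a n ∈ mPow R N) : s ∈ mPow R N := by
  have := (mPow R N).add_mem (hs N) ((mPow R N).sum_mem (t := Finset.range N) fun n _ => ha n)
  rwa [sub_add_cancel] at this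

theorem IsSum.of_eventually_zero {a : ℕ → Disk R} (h : ∀ n, n ≠ 0 → a n = 0) :
    IsSum a (a 0) := fun N => by
  rcases N with _ | N
  · exact mem_mPow_zero _
  · rw [Finset.sum_range_succ', Finset.sum_eq_zero fun n _ => h _ (Nat.succ_ne_zero n), zero_add,
      sub_self]
    exact zero_mem _

/-- The `𝔪`-adic sum of a sequence whose `n`-th term is in `𝔪ⁿ`. -/
def msum (a : ℕ → Disk R) : Disk R :=
  -- A monomial `t^m` times `j` of the `θ`'s has degree `m + j`, so only the terms with `n ≤ m + j`
  -- contribute to its coefficient.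
  ⟨⟨PowerSeries.mk fun m => ∑ n ∈ Finset.range (m + 1), PowerSeries.coeff m (a n).fst.fst,
    PowerSeries.mk fun m => ∑ n ∈ Finset.range (m + 2), PowerSeries.coeff m (a n).fst.snd⟩,
    ⟨PowerSeries.mk fun m => ∑ n ∈ Finset.range (m + 2), PowerSeries.coeff m (a n).snd.fst,
    PowerSeries.mk fun m => ∑ n ∈ Finset.range (m + 3), PowerSeries.coeff m (a n).snd.snd⟩⟩

theorem isSum_msum {a : ℕ → Disk R} (ha : ∀ n, a n ∈ mPow R n) : IsSum a (msum a) := by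
  have key : ∀ (c : ℕ → R) (K N : ℕ), K ≤ N → (∀ n, K ≤ n → c n = 0) →
      ∑ n ∈ Finset.range K, c n - ∑ n ∈ Finset.range N, c n = 0 := fun c K N h hc => by
    rw [sub_eq_zero]
    refine Finset.sum_subset (Finset.range_mono h) fun n _ hn => hc n ?_
    simpa using hn
  have proj : ∀ (p : Disk R →+ PowerSeries R) (m N : ℕ), PowerSeries.coeff m
      (p (∑ n ∈ Finset.range N, a n)) = ∑ n ∈ Finset.range N, PowerSeries.coeff m (p (a n)) :=
    fun p m N => by rw [map_sum, map_sum]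
  let p00 : Disk R →+ PowerSeries R := AddMonoidHom.mk' (fun f => f.fst.fst) fun _ _ => rfl
  let p10 : Disk R →+ PowerSeries R := AddMonoidHom.mk' (fun f => f.fst.snd) fun _ _ => rfl
  let p01 : Disk R →+ PowerSeries R := AddMonoidHom.mk' (fun f => f.snd.fst) fun _ _ => rfl
  let p11 : Disk R →+ PowerSeries R := AddMonoidHom.mk' (fun f => f.snd.snd) fun _ _ => rfl
  have ha' := fun n => mem_mPow_iff.1 (ha n)
  intro N
  refine mem_mPow_iff.2 ⟨fun m hm => ?_, fun m hm => ?_, fun m hm => ?_, fun m hm => ?_⟩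
  · refine Eq.trans ?_ (key (fun n => PowerSeries.coeff m (a n).fst.fst) (m + 1) N (by omega)
      fun n hn => (ha' n).1 m (by omega))
    have := proj p00 m N
    change PowerSeries.coeff m ((msum a).fst.fst - p00 (∑ n ∈ Finset.range N, a n)) = _
    rw [map_sub, this]
    simp only [msum, PowerSeries.coeff_mk]
    rfl
  · refine Eq.trans ?_ (key (fun n => PowerSeries.coeff m (a n).fst.snd) (m + 2) N (by omega)
      fun n hn => (ha' n).2.1 m (by omega))
    have := proj p10 m N
    change PowerSeries.coeff m ((msum a).fst.snd - p10 (∑ n ∈ Finset.range N, a n)) = _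
    rw [map_sub, this]
    simp only [msum, PowerSeries.coeff_mk]
    rfl
  · refine Eq.trans ?_ (key (fun n => PowerSeries.coeff m (a n).snd.fst) (m + 2) N (by omega)
      fun n hn => (ha' n).2.2.1 m (by omega))
    have := proj p01 m N
    change PowerSeries.coeff m ((msum a).snd.fst - p01 (∑ n ∈ Finset.range N, a n)) = _
    rw [map_sub, this]
    simp only [msum, PowerSeries.coeff_mk]
    rfl
  · refine Eq.trans ?_ (key (fun n => PowerSeries.coeff m (a n).snd.snd) (m + 3) N (by omega)
      fun n hn => (ha' n).2.2.2 m (by omega))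
    have := proj p11 m N
    change PowerSeries.coeff m ((msum a).snd.snd - p11 (∑ n ∈ Finset.range N, a n)) = _
    rw [map_sub, this]
    simp only [msum, PowerSeries.coeff_mk]
    rfl

/-- Summation of a double series along antidiagonals. -/
theorem IsSum.of_double {c : ℕ → ℕ → Disk R} {s : Disk R} (hc : ∀ i j, c i j ∈ mPow R (i + j))
    (h : ∀ N, s - ∑ i ∈ Finset.range N, ∑ j ∈ Finset.range N, c i j ∈ mPow R N) :
    IsSum (fun n => ∑ p ∈ Finset.HasAntidiagonal.antidiagonal n, c p.1 p.2) s := fun N => by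
  -- The square of indices consists of the triangle `i + j < N` and pairs whose terms already lie in
  -- `𝔪^N`.
  set Q := Finset.range N ×ˢ Finset.range N
  have e1 : ∑ n ∈ Finset.range N, ∑ p ∈ Finset.HasAntidiagonal.antidiagonal n, c p.1 p.2 =
      ∑ p ∈ Q with p.1 + p.2 < N, c p.1 p.2 := by
    rw [← Finset.sum_fiberwise_of_maps_to (t := Finset.range N) (g := fun p : ℕ × ℕ => p.1 + p.2)]
    · refine Finset.sum_congr rfl fun n hn => Finset.sum_congr ?_ fun _ _ => rfl
      ext p
      simp only [Finset.HasAntidiagonal.mem_antidiagonal, Finset.mem_filter, Q,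
        Finset.mem_product, Finset.mem_range] at *
      omega
    · intro p hp
      exact Finset.mem_range.2 (Finset.mem_filter.1 hp).2
  have e2 := Finset.sum_filter_add_sum_filter_not Q (fun p => p.1 + p.2 < N)
    (fun p => c p.1 p.2)
  have h' := h N
  rw [← Finset.sum_product (f := fun p : ℕ × ℕ => c p.1 p.2)] at h'
  rw [e1]
  have h3 : ∑ p ∈ Q with ¬ p.1 + p.2 < N, c p.1 p.2 ∈ mPow R N :=
    (mPow R N).sum_mem fun p hp => mPow_mono (not_lt.1 (Finset.mem_filter.1 hp).2) (hc _ _)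
  have := (mPow R N).add_mem h' h3
  change s - ∑ p ∈ Q, c p.1 p.2 + _ ∈ _ at this
  rw [← e2] at this
  convert this using 1
  abel

theorem IsSum.mul {a b : ℕ → Disk R} {s t : Disk R} (ha : ∀ n, a n ∈ mPow R n)
    (hb : ∀ n, b n ∈ mPow R n) (hs : IsSum a s) (ht : IsSum b t) :
    IsSum (fun n => ∑ p ∈ Finset.HasAntidiagonal.antidiagonal n, a p.1 * b p.2) (s * t) := by
  refine IsSum.of_double (c := fun i j => a i * b j) (fun i j => mul_mem_mPow (ha i) (hb j))
    fun N => ?_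
  rw [← Finset.sum_mul_sum]
  have h1 := mul_mem_mPow (hs N) (mem_mPow_zero t)
  have h2 := mul_mem_mPow (mem_mPow_zero (∑ n ∈ Finset.range N, a n)) (ht N)
  rw [add_zero] at h1
  rw [zero_add] at h2
  have := (mPow R N).add_mem h1 h2
  convert this using 1
  noncomm_ring

end Sums

/-! ### Exponentials -/

section Exp

variable {k : Type u} {R : Type v} [Field k] [Ring R] [Module k R] [Parity R]

/-- `X` maps `𝔪^N` to `𝔪^{N+1}`. -/
def Raises (X : Module.End k (Disk R)) : Prop := ∀ N, ∀ f ∈ mPow R N, X f ∈ mPow R (N + 1)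

/-- `V` maps `𝔪^N` to `𝔪^N`. -/
def Preserves (V : Disk R → Disk R) : Prop := ∀ N, ∀ f ∈ mPow R N, V f ∈ mPow R N

theorem Raises.preserves {X : Module.End k (Disk R)} (hX : Raises X) : Preserves X :=
  fun N f hf => mPow_mono (Nat.le_succ N) (hX N f hf)

theorem Raises.neg {X : Module.End k (Disk R)} (hX : Raises X) : Raises (-X) :=
  fun N f hf => (mPow R _).neg_mem (hX N f hf)

/-- The term `Xⁿ / n!` of the exponential series. -/
def expTerm (X : Module.End k (Disk R)) (n : ℕ) : Module.End k (Disk R) :=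
  (n.factorial : k)⁻¹ • X ^ n

theorem expTerm_apply (X : Module.End k (Disk R)) (n : ℕ) (f : Disk R) :
    expTerm X n f = (n.factorial : k)⁻¹ • (X ^ n) f := rfl

theorem expTerm_zero (X : Module.End k (Disk R)) : expTerm X 0 = 1 := by simp [expTerm]

theorem Raises.pow_mem {X : Module.End k (Disk R)} (hX : Raises X) (n : ℕ) {N : ℕ} {f : Disk R}
    (hf : f ∈ mPow R N) : (X ^ n) f ∈ mPow R (n + N) := by
  induction n with
  | zero => simpa using hf
  | succ n ih =>
    rw [pow_succ', Module.End.mul_apply, Nat.succ_add]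
    exact hX _ _ ih

theorem Raises.expTerm_mem {X : Module.End k (Disk R)} (hX : Raises X) (n : ℕ) {N : ℕ} {f : Disk R}
    (hf : f ∈ mPow R N) : expTerm X n f ∈ mPow R (n + N) :=
  smul_mem_mPow _ (hX.pow_mem n hf)

theorem isExp_iff {X : Module.End k (Disk R)} {E : Disk R ≃+* Disk R} :
    IsExp X E ↔ ∀ f, IsSum (fun n => expTerm X n f) (E f) := Iff.rfl

variable [CharZero k]

theorem succ_smul_expTerm (X : Module.End k (Disk R)) (n : ℕ) :
    ((n + 1 : ℕ) : k) • expTerm X (n + 1) = X * expTerm X n := by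
  have : (n.factorial : k) ≠ 0 := Nat.cast_ne_zero.2 n.factorial_ne_zero
  have h : ((n + 1 : ℕ) : k) ≠ 0 := Nat.cast_ne_zero.2 n.succ_ne_zero
  rw [expTerm, expTerm, Nat.factorial_succ, smul_smul, Nat.cast_mul, mul_inv, ← mul_assoc,
    mul_inv_cancel₀ h, one_mul, mul_smul_comm, pow_succ']

theorem succ_smul_expTerm' (X : Module.End k (Disk R)) (n : ℕ) :
    ((n + 1 : ℕ) : k) • expTerm X (n + 1) = expTerm X n * X := by
  rw [succ_smul_expTerm, expTerm, mul_smul_comm, smul_mul_assoc, ← pow_succ, ← pow_succ']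

theorem smul_right_cancel {A : Type v} [AddCommGroup A] [Module k A] (n : ℕ) {a b : A}
    (h : ((n + 1 : ℕ) : k) • a = ((n + 1 : ℕ) : k) • b) : a = b := by
  have h0 : ((n + 1 : ℕ) : k) ≠ 0 := Nat.cast_ne_zero.2 n.succ_ne_zero
  exact smul_right_injective A h0 h

/-- The iterated commutators `[X, [X, …, [X, V]]]`. -/
def adPow (X V : Module.End k (Disk R)) : ℕ → Module.End k (Disk R)
  | 0 => V
  | n + 1 => X * adPow X V n - adPow X V n * X

/-- The left side is the coefficient of `sⁿ` in `e^{sX} V e^{-sX}`. This series satisfies the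
differential equation `W' = X W - W X`, whose coefficients are determined recursively by `W(0) = V`.
-/
theorem sum_expTerm_mul_expTerm (X V : Module.End k (Disk R)) (n : ℕ) :
    ∑ p ∈ Finset.HasAntidiagonal.antidiagonal n, expTerm X p.1 * V * expTerm (-X) p.2 =
      (n.factorial : k)⁻¹ • adPow X V n := by
  let a : PowerSeries (Module.End k (Disk R)) := PowerSeries.mk fun n => expTerm X n
  let b : PowerSeries (Module.End k (Disk R)) := PowerSeries.mk fun n => expTerm (-X) n
  have cast : ∀ (m : ℕ) (Y : Module.End k (Disk R)),
      ((m : ℕ) : Module.End k (Disk R)) * Y = (m : k) • Y := fun m Y => by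
    rw [← nsmul_eq_mul, Nat.cast_smul_eq_nsmul]
  have ha : dPS a = PowerSeries.C X * a := by
    ext1 n
    rw [coeff_dPS, PowerSeries.coeff_C_mul, PowerSeries.coeff_mk, PowerSeries.coeff_mk, cast,
      succ_smul_expTerm]
  have hb : dPS b = b * PowerSeries.C (-X) := by
    ext1 n
    rw [coeff_dPS, PowerSeries.coeff_mul_C, PowerSeries.coeff_mk, PowerSeries.coeff_mk, cast,
      succ_smul_expTerm']
  have hc : ∀ n, PowerSeries.coeff n (a * PowerSeries.C V * b) =
      ∑ p ∈ Finset.HasAntidiagonal.antidiagonal n, expTerm X p.1 * V * expTerm (-X) p.2 :=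
    fun n => by
      rw [PowerSeries.coeff_mul]
      exact Finset.sum_congr rfl fun p _ => by
        rw [PowerSeries.coeff_mul_C, PowerSeries.coeff_mk, PowerSeries.coeff_mk]
  have hd : dPS (a * PowerSeries.C V * b) = PowerSeries.C X * (a * PowerSeries.C V * b)
      - (a * PowerSeries.C V * b) * PowerSeries.C X := by
    rw [dPS_mul, dPS_mul, ha, hb, dPS_C, mul_zero, add_zero, map_neg]
    noncomm_ring
  rw [← hc]
  induction n with
  | zero => simp [hc, expTerm_zero, adPow]
  | succ n ih =>
    have h := congrArg (PowerSeries.coeff n) hd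
    rw [coeff_dPS, map_sub, PowerSeries.coeff_C_mul, PowerSeries.coeff_mul_C, ih, cast,
      mul_smul_comm, smul_mul_assoc, ← smul_sub] at h
    refine smul_right_cancel (k := k) n ?_
    have h0 : ((n + 1 : ℕ) : k) ≠ 0 := Nat.cast_ne_zero.2 n.succ_ne_zero
    rw [h, Nat.factorial_succ, smul_smul, Nat.cast_mul, mul_inv, ← mul_assoc,
      mul_inv_cancel₀ h0, one_mul, adPow]

/-- The expansion of `exp(X) V exp(-X)`. -/
theorem isSum_conj {X V : Module.End k (Disk R)} (hX : Raises X) (hV : Preserves V)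
    {E : Disk R →+ Disk R} (hE : ∀ f, IsSum (fun n => expTerm X n f) (E f)) {f f' : Disk R}
    (hf : IsSum (fun n => expTerm (-X) n f) f') :
    IsSum (fun n => (n.factorial : k)⁻¹ • adPow X V n f) (E (V f')) := by
  have hEp : Preserves E := fun N g hg =>
    (hE g).mem_mPow fun n => mPow_mono (Nat.le_add_left _ _) (hX.expTerm_mem n hg)
  have key := IsSum.of_double (c := fun i j => expTerm X i (V (expTerm (-X) j f))) (s := E (V f'))
    (fun i j => hX.expTerm_mem i (hV _ _ (by simpa using hX.neg.expTerm_mem j (mem_mPow_zero f))))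
    fun N => ?_
  · convert key using 2 with n
    rw [← LinearMap.smul_apply, ← sum_expTerm_mul_expTerm, LinearMap.sum_apply]
    rfl
  · have h1 := hEp N _ (hV N _ (hf N))
    have h2 : ∑ j ∈ Finset.range N, (E (V (expTerm (-X) j f))
        - ∑ i ∈ Finset.range N, expTerm X i (V (expTerm (-X) j f))) ∈ mPow R N :=
      (mPow R N).sum_mem fun j _ => hE _ N
    have := (mPow R N).add_mem h1 h2
    convert this using 1
    rw [Finset.sum_sub_distrib, map_sub, map_sub, map_sum, map_sum, Finset.sum_comm]
    abel

/-- For `V = 1` all commutators vanish and the conjugation series reduces to its first term. Only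
additivity of `E` is assumed, so that the inverse of the exponential can be built from this. -/
theorem exp_exp_neg {X : Module.End k (Disk R)} (hX : Raises X) {E : Disk R →+ Disk R}
    (hE : ∀ f, IsSum (fun n => expTerm X n f) (E f)) {f f' : Disk R}
    (hf : IsSum (fun n => expTerm (-X) n f) f') : E f' = f := by
  have h1 := isSum_conj hX (V := 1) (fun N f hf => hf) hE hf
  have h2 := IsSum.of_eventually_zero
    (a := fun n => (n.factorial : k)⁻¹ • adPow X (1 : Module.End k (Disk R)) n f) fun n hn => by
      have : ∀ m, adPow X (1 : Module.End k (Disk R)) (m + 1) = 0 := fun m => by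
        induction m with
        | zero => simp [adPow]
        | succ m ih => rw [adPow, ih, mul_zero, zero_mul, sub_zero]
      obtain ⟨m, rfl⟩ := Nat.exists_eq_succ_of_ne_zero hn
      rw [this]
      simp
  have h3 := h1.unique h2
  simpa [adPow] using h3

omit [CharZero k] in
theorem isSum_expTerm {X : Module.End k (Disk R)} (hX : Raises X) (f : Disk R) :
    IsSum (fun n => expTerm X n f) (msum fun n => expTerm X n f) :=
  isSum_msum fun n => by simpa using hX.expTerm_mem n (mem_mPow_zero f)

theorem isSum_symm {X : Module.End k (Disk R)} (hX : Raises X) {E : Disk R ≃+* Disk R}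
    (hE : IsExp X E) (f : Disk R) : IsSum (fun n => expTerm (-X) n f) (E.symm f) := by
  have h := isSum_expTerm hX.neg f
  have h1 := exp_exp_neg hX (E := (E : Disk R →+ Disk R)) hE h
  rw [E.symm_apply_eq.2 h1.symm]
  exact h

theorem isSum_conj_symm {X V : Module.End k (Disk R)} (hX : Raises X) (hV : Preserves V)
    {E : Disk R ≃+* Disk R} (hE : IsExp X E) (f : Disk R) :
    IsSum (fun n => (n.factorial : k)⁻¹ • adPow X V n f) (E (V (E.symm f))) :=
  isSum_conj hX hV (E := (E : Disk R →+ Disk R)) hE (isSum_symm hX hE f)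

/-- The Leibniz rule for divided powers: the generating series of `f * g` and the product of those
of `f` and `g` solve the same differential equation. -/
theorem expTerm_mul {X : Module.End k (Disk R)} (hmul : ∀ f g, X (f * g) = X f * g + f * X g)
    (n : ℕ) (f g : Disk R) : expTerm X n (f * g) =
      ∑ p ∈ Finset.HasAntidiagonal.antidiagonal n, expTerm X p.1 f * expTerm X p.2 g := by
  let F : Disk R → PowerSeries (Disk R) := fun f => PowerSeries.mk fun n => expTerm X n f
  have cast : ∀ (m : ℕ) (a : Disk R), ((m : ℕ) : Disk R) * a = (m : k) • a := fun m a => by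
    rw [← nsmul_eq_mul, Nat.cast_smul_eq_nsmul]
  have hF : ∀ f n, PowerSeries.coeff n (dPS (F f)) = X (expTerm X n f) := fun f n => by
    rw [coeff_dPS, PowerSeries.coeff_mk, cast, ← LinearMap.smul_apply, succ_smul_expTerm]
    rfl
  have hc : ∀ n, PowerSeries.coeff n (F f * F g) =
      ∑ p ∈ Finset.HasAntidiagonal.antidiagonal n, expTerm X p.1 f * expTerm X p.2 g := fun n => by
    rw [PowerSeries.coeff_mul]
    exact Finset.sum_congr rfl fun p _ => by rw [PowerSeries.coeff_mk, PowerSeries.coeff_mk]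
  rw [← hc]
  induction n with
  | zero => simp [hc, expTerm_zero]
  | succ n ih =>
    refine smul_right_cancel (k := k) n ?_
    rw [← LinearMap.smul_apply, succ_smul_expTerm, Module.End.mul_apply, ih, hc, ← cast, ← coeff_dPS,
      dPS_mul, map_add, PowerSeries.coeff_mul, PowerSeries.coeff_mul, map_sum,
      ← Finset.sum_add_distrib]
    exact Finset.sum_congr rfl fun p _ => by
      rw [hF, hF, PowerSeries.coeff_mk, PowerSeries.coeff_mk, hmul]

/-- The exponential of a derivation that maps `𝔪^N` to `𝔪^{N+1}`. -/
theorem exists_isExp {X : Module.End k (Disk R)} (hX : Raises X)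
    (hmul : ∀ f g, X (f * g) = X f * g + f * X g) : ∃ E : Disk R ≃+* Disk R, IsExp X E := by
  let e : (Y : Module.End k (Disk R)) → Raises Y → (Disk R →+ Disk R) := fun Y hY =>
    AddMonoidHom.mk' (fun f => msum fun n => expTerm Y n f) fun f g =>
      (isSum_expTerm hY (f + g)).unique (by
        simpa only [map_add] using (isSum_expTerm hY f).add (isSum_expTerm hY g))
  have he : ∀ Y hY f, IsSum (fun n => expTerm Y n f) (e Y hY f) := fun Y hY f => isSum_expTerm hY f
  have h1 : ∀ f, e X hX (e (-X) hX.neg f) = f := fun f =>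
    exp_exp_neg hX (he X hX) (he (-X) hX.neg f)
  have h2 : ∀ f, e (-X) hX.neg (e X hX f) = f := fun f =>
    exp_exp_neg hX.neg (he (-X) hX.neg) (by simpa only [neg_neg] using he X hX f)
  refine ⟨{ toFun := e X hX, invFun := e (-X) hX.neg, left_inv := h2, right_inv := h1,
            map_add' := map_add _, map_mul' := fun f g => ?_ }, he X hX⟩
  refine (he X hX (f * g)).unique ?_
  have hm : ∀ f n, expTerm X n f ∈ mPow R n := fun f n => by
    simpa using hX.expTerm_mem n (mem_mPow_zero f)
  simpa only [expTerm_mul hmul] using (he X hX f).mul (hm f) (hm g) (he X hX g)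

end Exp

end Disk

end

end SuperCurve

/-! ### Vector fields on the formal superdisk and necessary conditions for `S(2)`. -/

namespace SuperCurve
noncomputable section

namespace Disk

section Top

variable {R : Type v} [Ring R] [Parity R]

theorem top_eq (f : Disk R) : (frame R).top f = ofPS R f.snd.snd := by
  change partialD 2 (partialD 1 f) = _
  rw [partialD_one, partialD_two, ofPS_apply]
  refine ext4 ?_ ?_ ?_ ?_ <;> simp [Parity.inv_inv]

/-- The coefficient of `θ¹ θ²`. -/
def tau : Disk R →+ R := AddMonoidHom.mk' (fun f => PowerSeries.coeff 0 f.snd.snd) fun _ _ => rfl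

theorem tau_apply (f : Disk R) : tau f = PowerSeries.coeff 0 f.snd.snd := rfl

theorem tau_eq_zero_of_top {f : Disk R} (h : (frame R).top f = 0) : tau f = 0 := by
  rw [top_eq] at h
  have : f.snd.snd = 0 := congrArg (fun g : Disk R => g.fst.fst) h
  rw [tau_apply, this, map_zero]

theorem tau_eq_zero_of_mem {f : Disk R} (h : f ∈ mPow R 3) : tau f = 0 :=
  (mem_mPow_iff.1 h).2.2.2 0 (by omega)

/-- The twist `σ` serves even derivations as the identity and odd ones as the parity involution. -/
theorem eq_zero_of_derivation {D : Disk R → Disk R} {σ : Disk R → Disk R}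
    (hadd : ∀ f g, D (f + g) = D f + D g) (hc : ∀ r, D (const r) = 0)
    (hmul : ∀ f g, D (f * g) = D f * g + σ f * D g) (hσ : σ (gen 0) = gen 0)
    (hg : ∀ i, D (gen i) = 0) (f : Disk R) : D f = 0 := by
  have h : ∀ p, D (ofPS R p) = 0 := map_ofPS_eq_zero hadd (gen_mem_mPow 0) hc fun f => by
    rw [hmul, hg, zero_mul, zero_add, hσ]
  rw [eq_sum_components f]
  simp [hadd, hmul, h, hg]

theorem frame_x_ite (i j : Fin 3) : (frame R).d i (gen j) = if i = j then 1 else 0 :=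
  (frame R).d_x i j

end Top

section VectorFields

variable {k : Type u} {R : Type v} [Field k] [Ring R] [Module k R] [Parity R] [SuperAlg k R]

theorem frame_d_smul (i : Fin 3) (c : k) (f : Disk R) :
    (frame R).d i (c • f) = c • (frame R).d i f := by
  have hs : ∀ n (p : PowerSeries R), PowerSeries.coeff n (c • p) = c • PowerSeries.coeff n p :=
    fun _ _ => rfl
  have h : ∀ p : PowerSeries R, dPS (c • p) = c • dPS p := fun p => by
    ext n
    rw [coeff_dPS, hs, hs, coeff_dPS, mul_smul_comm]
  rw [frame_d, frame_d]
  fin_cases i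
  · refine ext4 ?_ ?_ ?_ ?_ <;> simp [partialD_zero, h]
  · refine ext4 ?_ ?_ ?_ ?_ <;> simp [partialD_one, SuperAlg.inv_smul]
  · refine ext4 ?_ ?_ ?_ ?_ <;> simp [partialD_two, SuperAlg.inv_smul]

variable (k) in
/-- The vector field `v₀ ∂_t + v₁ ∂_{θ¹} + v₂ ∂_{θ²}`. -/
def vf (v : Fin 3 → Disk R) : Module.End k (Disk R) where
  toFun f := v 0 * (frame R).d 0 f + v 1 * (frame R).d 1 f + v 2 * (frame R).d 2 f
  map_add' f g := by simp only [map_add, mul_add]; abel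
  map_smul' c f := by
    simp only [frame_d_smul, mul_smul_comm, smul_add, RingHom.id_apply]

theorem vf_apply (v : Fin 3 → Disk R) (f : Disk R) :
    vf k v f = v 0 * (frame R).d 0 f + v 1 * (frame R).d 1 f + v 2 * (frame R).d 2 f := rfl

theorem vf_gen (v : Fin 3 → Disk R) (i : Fin 3) : vf k v (gen i) = v i := by
  rw [vf_apply, frame_x_ite, frame_x_ite, frame_x_ite]
  fin_cases i <;> simp

theorem isEven_vf {v : Fin 3 → Disk R} (hv : ∀ i, Parity.inv (v i) = sg i • v i) :
    (frame R).IsEven (vf k v) := by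
  have h : ∀ i, vf k v ((frame R).x i) = v i := vf_gen v
  refine Frame.IsEven.of_inv (fun a => ?_) ?_ ?_ ?_
  · rw [h, h, h, vf_apply]
  · simpa [h] using hv 0
  · simpa [h] using hv 1
  · simpa [h] using hv 2

theorem vf_add (v w : Fin 3 → Disk R) : vf k (v + w) = vf k v + vf k w := by
  ext1 f
  simp only [vf_apply, LinearMap.add_apply, Pi.add_apply, add_mul]
  abel

variable [CharZero k]

-- Subtracting the field with the same values on the generators leaves a derivation that kills
-- constants and generators, hence zero. In particular no continuity has to be assumed.
omit [SuperAlg k R] [CharZero k] [Module k R] in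
theorem isEven_of_derivation [SuperComm R] {V : Disk R → Disk R}
    (hadd : ∀ f g, V (f + g) = V f + V g) (hinv : ∀ f, Parity.inv (V f) = V (Parity.inv f))
    (hmul : ∀ f g, V (f * g) = V f * g + f * V g) (hc : ∀ r, V (const r) = 0) :
    (frame R).IsEven V := by
  have hneg : ∀ f, V (-f) = -V f := map_neg (AddMonoidHom.mk' V hadd)
  let W : Disk R → Disk R := fun a => V (gen 0) * (frame R).d 0 a + V (gen 1) * (frame R).d 1 a
    + V (gen 2) * (frame R).d 2 a
  have hWg : ∀ i, W (gen i) = V (gen i) := fun i => by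
    simp only [W, frame_x_ite]
    fin_cases i <;> simp
  have hW : (frame R).IsEven W := by
    refine Frame.IsEven.of_inv (fun a => ?_) ?_ ?_ ?_
    · simp only [frame_x, hWg, W]
    · rw [frame_x, hWg, hinv, ← frame_x, (frame R).inv_x0]
    · rw [frame_x, hWg, hinv, ← frame_x, (frame R).inv_x1, hneg]
    · rw [frame_x, hWg, hinv, ← frame_x, (frame R).inv_x2, hneg]
  have h := eq_zero_of_derivation (D := fun f => V f - W f) (σ := id) (fun f g => by
    rw [hadd, hW.map_add]; abel) (fun r => by simp [hc, W, partialD_const]) (fun f g => by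
    rw [hmul, hW.map_mul]
    simp only [id]
    noncomm_ring) rfl (fun i => by rw [hWg, sub_self])
  have : V = W := funext fun f => sub_eq_zero.1 (h f)
  rwa [this]

omit [SuperAlg k R] [CharZero k] [Module k R] in
theorem isOdd_of_derivation [SuperComm R] {V : Disk R → Disk R}
    (hadd : ∀ f g, V (f + g) = V f + V g) (hinv : ∀ f, Parity.inv (V f) = -V (Parity.inv f))
    (hmul : ∀ f g, V (f * g) = V f * g + Parity.inv f * V g) (hc : ∀ r, V (const r) = 0) :
    (frame R).IsOdd V := by
  have hneg : ∀ f, V (-f) = -V f := map_neg (AddMonoidHom.mk' V hadd)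
  let W : Disk R → Disk R := fun a => V (gen 0) * (frame R).d 0 a + V (gen 1) * (frame R).d 1 a
    + V (gen 2) * (frame R).d 2 a
  have hWg : ∀ i, W (gen i) = V (gen i) := fun i => by
    simp only [W, frame_x_ite]
    fin_cases i <;> simp
  have hW : (frame R).IsOdd W := by
    have e0 : Parity.inv (V (gen 0)) = -V (gen 0) := by rw [hinv, ← frame_x, (frame R).inv_x0]
    have e1 : Parity.inv (V (gen 1)) = V (gen 1) := by
      rw [hinv, ← frame_x, (frame R).inv_x1, hneg, neg_neg]
    have e2 : Parity.inv (V (gen 2)) = V (gen 2) := by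
      rw [hinv, ← frame_x, (frame R).inv_x2, hneg, neg_neg]
    refine ⟨fun a => ?_, fun a => ?_⟩
    · simp [W, Frame.inv_d, e0, e1, e2]
      abel
    · simp only [frame_x, hWg, W]
  have h := eq_zero_of_derivation (D := fun f => V f - W f) (σ := Parity.inv) (fun f g => by
    rw [hadd, hW.map_add]; abel) (fun r => by simp [hc, W, partialD_const]) (fun f g => by
    rw [hmul, hW.map_mul]
    noncomm_ring) (frame R).inv_x0 (fun i => by rw [hWg, sub_self])
  have : V = W := funext fun f => sub_eq_zero.1 (h f)
  rwa [this]

theorem mem_der_zero_iff {X : Module.End k (Disk R)} : X ∈ Der k R 0 ↔ (frame R).IsEven X := by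
  have : SuperComm R := SuperAlg.toSuperComm k
  constructor
  · rintro ⟨h, hc⟩
    rw [isSuperDerivation_zero_iff] at h
    exact isEven_of_derivation (map_add X) h.1 h.2 hc
  · refine fun h => ⟨isSuperDerivation_zero_iff.2 ⟨h.inv_apply, h.map_mul⟩, fun r => ?_⟩
    rw [h.eq]
    simp [partialD_const]

theorem isOdd_of_mem_der_one {X : Module.End k (Disk R)} (hX : X ∈ Der k R 1) :
    (frame R).IsOdd X := by
  have : SuperComm R := SuperAlg.toSuperComm k
  have h := isSuperDerivation_one_iff.1 hX.1
  exact isOdd_of_derivation (map_add X) h.1 h.2 hX.2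

omit [SuperAlg k R] [CharZero k] in
theorem sdiv_zero (X : Module.End k (Disk R)) : sdiv 0 X = (frame R).div X := by
  simp only [sdiv, Frame.div, zero_add, ZMod.val_one, pow_one, neg_mul, one_mul, ← sub_eq_add_neg,
    frame_d, frame_x]

omit [SuperAlg k R] [CharZero k] in
theorem sdiv_one (X : Module.End k (Disk R)) : sdiv 1 X = (frame R).divOdd X := by
  simp only [sdiv, Frame.divOdd, show (1 + 1 : ZMod 2) = 0 from by decide, ZMod.val_zero, pow_zero,
    one_mul, frame_d, frame_x]

theorem mem_S12_zero_iff {X : Module.End k (Disk R)} :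
    X ∈ S12 k R 0 ↔ (frame R).IsEven X ∧ (frame R).div X = 0 := by
  rw [S12, Set.mem_ofPred_eq, mem_der_zero_iff, sdiv_zero]

omit [SuperAlg k R] [CharZero k] [Module k R] in
theorem _root_.SuperCurve.Frame.IsEven.mem_mPow {V : Disk R → Disk R} (hV : (frame R).IsEven V)
    {M : ℕ} (hM : 1 ≤ M) (h : ∀ i, V (gen i) ∈ mPow R M) {N : ℕ} {f : Disk R} (hf : f ∈ mPow R N) :
    V f ∈ mPow R (N + M - 1) := by
  rw [hV.eq]
  have : ∀ i, V ((frame R).x i) * (frame R).d i f ∈ mPow R (N + M - 1) := fun i =>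
    mPow_mono (by omega) (mul_mem_mPow (h i) (partialD_mem_mPow i hf))
  exact (mPow R _).add_mem ((mPow R _).add_mem (this 0) (this 1)) (this 2)

omit [SuperAlg k R] [CharZero k] in
theorem raises_of_isEven {X : Module.End k (Disk R)} (hX : (frame R).IsEven X)
    (h : ∀ i, X (gen i) ∈ mPow R 2) : Raises X := fun _ _ hf => hX.mem_mPow (by omega) h hf

omit [SuperAlg k R] [CharZero k] [Module k R] in
theorem preserves_of_isEven {V : Disk R → Disk R} (hV : (frame R).IsEven V)
    (h : ∀ i, V (gen i) ∈ mPow R 1) : Preserves V := fun _ _ hf => hV.mem_mPow le_rfl h hf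

/-- Elements of `S(2)` are divergence free, and their `∂_t`-components have no `θ¹ θ²`-terms. -/
theorem div_and_top_of_mem_S2 {X : Module.End k (Disk R)} (hX : X ∈ S2 k R)
    (hXe : (frame R).IsEven X) : (frame R).div X = 0 ∧ (frame R).top (X (gen 0)) = 0 := by
  have : SuperComm R := SuperAlg.toSuperComm k
  set F := frame R
  -- The span mixes parities, so the two conditions are imposed on twice the even part of `Z`. They
  -- are then linear in `Z`, and odd brackets satisfy them trivially.
  have key : ∀ Z ∈ S2 k R, F.d 0 (Z (gen 0) + Parity.inv (Z (gen 0)))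
      - F.d 1 (Z (gen 1) - Parity.inv (Z (gen 1)))
      - F.d 2 (Z (gen 2) - Parity.inv (Z (gen 2))) = 0 ∧
      F.top (Z (gen 0) + Parity.inv (Z (gen 0))) = 0 := by
    intro Z hZ
    induction hZ using Submodule.span_induction with
    | mem Z hZ =>
      have even : F.IsEven Z → F.div Z = 0 → F.top (Z (gen 0)) = 0 → _ := fun h h1 h2 => by
        have e0 := h.inv_apply0
        have e1 := h.inv_apply1
        have e2 := h.inv_apply2
        rw [frame_x] at e0 e1 e2
        refine (⟨?_, ?_⟩ : F.d 0 (Z (gen 0) + Parity.inv (Z (gen 0)))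
            - F.d 1 (Z (gen 1) - Parity.inv (Z (gen 1)))
            - F.d 2 (Z (gen 2) - Parity.inv (Z (gen 2))) = 0 ∧
            F.top (Z (gen 0) + Parity.inv (Z (gen 0))) = 0)
        · rw [e0, e1, e2, ← add_zero (0 : Disk R), ← h1, Frame.div]
          simp only [map_add, map_sub, map_neg, F, frame_x]
          abel
        · rw [e0, F.top_add, h2, add_zero]
      have odd : (∀ a, Parity.inv (Z a) = -Z (Parity.inv a)) → _ := fun h => by
        have e0 := h (gen 0)
        have e1 := h (gen 1)
        have e2 := h (gen 2)
        have i0 := F.inv_x0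
        have i1 := F.inv_x1
        have i2 := F.inv_x2
        simp only [F, frame_x] at i0 i1 i2
        rw [i0] at e0
        rw [i1, map_neg, neg_neg] at e1
        rw [i2, map_neg, neg_neg] at e2
        refine (⟨?_, ?_⟩ : F.d 0 (Z (gen 0) + Parity.inv (Z (gen 0)))
            - F.d 1 (Z (gen 1) - Parity.inv (Z (gen 1)))
            - F.d 2 (Z (gen 2) - Parity.inv (Z (gen 2))) = 0 ∧
            F.top (Z (gen 0) + Parity.inv (Z (gen 0))) = 0)
        · rw [e0, e1, e2]
          simp
        · rw [e0, add_neg_cancel, F.top_zero]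
      obtain ⟨i, j, X, Y, hX, hY, rfl⟩ := hZ
      rcases ZMod.two_cases i with rfl | rfl <;> rcases ZMod.two_cases j with rfl | rfl
      · rw [mem_S12_zero_iff] at hX hY
        have hZ : ∀ a, (X * Y - (-1) ^ ((0 : ZMod 2).val * (0 : ZMod 2).val) * (Y * X)) a =
          X (Y a) - Y (X a) := fun a => by simp
        have hf := funext hZ
        refine even (by rw [hf]; exact hX.1.bracket hY.1) ?_ ?_
        · rw [hf, hX.1.div_bracket hY.1, hX.2, hY.2, hX.1.map_zero, hY.1.map_zero, sub_zero]
        · rw [hZ]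
          refine (hX.1.top_bracket hY.1).trans ?_
          rw [hX.2, hY.2, mul_zero, mul_zero, sub_zero, Frame.top_zero]
      · refine odd fun a => ?_
        have h1 := (mem_S12_zero_iff.1 hX).1
        have h2 := isOdd_of_mem_der_one hY.1
        simp [h1.inv_apply, h2.inv_apply]
        abel
      · refine odd fun a => ?_
        have h1 := (mem_S12_zero_iff.1 hY).1
        have h2 := isOdd_of_mem_der_one hX.1
        simp [h1.inv_apply, h2.inv_apply]
        abel
      · have h1 := isOdd_of_mem_der_one hX.1
        have h2 := isOdd_of_mem_der_one hY.1
        have d1 := hX.2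
        have d2 := hY.2
        rw [sdiv_one] at d1 d2
        have hZ : ∀ a, (X * Y - (-1) ^ ((1 : ZMod 2).val * (1 : ZMod 2).val) * (Y * X)) a =
          X (Y a) + Y (X a) := fun a => by simp [ZMod.val_one]
        have hf := funext hZ
        refine even (by rw [hf]; exact h1.bracket h2) ?_ ?_
        · rw [hf, h1.div_bracket h2, d1, d2, h1.map_zero, h2.map_zero, add_zero]
        · rw [hZ]
          refine (h1.top_bracket h2).trans ?_
          rw [d1, d2, zero_mul, zero_mul, add_zero, Frame.top_zero, neg_zero]
    | zero => simp [Frame.top]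
    | add Y Z _ _ hY hZ =>
      refine ⟨?_, ?_⟩
      · rw [← add_zero (0 : Disk R)]
        nth_rewrite 1 [← hY.1]
        rw [← hZ.1]
        simp only [LinearMap.add_apply, map_add, map_sub]
        abel
      · rw [← add_zero (0 : Disk R)]
        nth_rewrite 1 [← hY.2]
        rw [← hZ.2]
        simp only [LinearMap.add_apply, map_add, F.top_add]
        abel
    | smul c Z _ hZ =>
      refine ⟨?_, ?_⟩
      · refine Eq.trans ?_ ((congrArg (c • ·) hZ.1).trans (smul_zero c))
        simp only [LinearMap.smul_apply, SuperAlg.inv_smul, ← smul_add, ← smul_sub, F, frame_d_smul]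
      · refine Eq.trans ?_ ((congrArg (c • ·) hZ.2).trans (smul_zero c))
        simp only [LinearMap.smul_apply, SuperAlg.inv_smul, ← smul_add, F, Frame.top, frame_d_smul]
  have h := key X hX
  have e0 := hXe.inv_apply0
  have e1 := hXe.inv_apply1
  have e2 := hXe.inv_apply2
  simp only [F, frame_x] at e0 e1 e2
  rw [e0, e1, e2] at h
  refine ⟨SuperComm.two_torsion _ (Eq.trans ?_ h.1), SuperComm.two_torsion _ ?_⟩
  · simp only [Frame.div, map_add, map_sub, map_neg, F, frame_x]
    abel
  · rw [← F.top_add, h.2]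

end VectorFields

end Disk

end

end SuperCurve

/-! ### Antiderivatives in `t` and sufficient conditions for `S(2)`. -/

namespace SuperCurve
noncomputable section

namespace Disk

variable (k : Type u) {R : Type v} [Field k] [Ring R] [Module k R] [Parity R]

/-- The antiderivative of a power series without constant term. -/
def integralPS (p : PowerSeries R) : PowerSeries R :=
  PowerSeries.mk fun n => Nat.casesOn n 0 fun m => ((m + 1 : ℕ) : k)⁻¹ • PowerSeries.coeff m p

/-- The antiderivative with respect to `t`. -/
def integral (f : Disk R) : Disk R :=
  ⟨⟨integralPS k f.fst.fst, integralPS k f.fst.snd⟩,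
    ⟨integralPS k f.snd.fst, integralPS k f.snd.snd⟩⟩

variable [SuperAlg k R]

omit [SuperAlg k R] [Parity R] in
theorem integralPS_neg (p : PowerSeries R) : integralPS k (-p) = -integralPS k p := by
  ext n
  rw [map_neg, integralPS, integralPS, PowerSeries.coeff_mk, PowerSeries.coeff_mk]
  rcases n with _ | n
  · exact neg_zero.symm
  · exact (congrArg _ (map_neg _ _)).trans (smul_neg _ _)

omit [SuperAlg k R] in
theorem integral_neg (f : Disk R) : integral k (-f) = -integral k f := by
  refine ext4 ?_ ?_ ?_ ?_ <;> simp [integral, integralPS_neg]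

theorem inv_integral (f : Disk R) : Parity.inv (integral k f) = integral k (Parity.inv f) := by
  have h : ∀ p : PowerSeries R, Parity.inv (integralPS k p) = integralPS k (Parity.inv p) :=
    fun p => by
      ext n
      rw [coeff_inv, integralPS, integralPS, PowerSeries.coeff_mk, PowerSeries.coeff_mk]
      rcases n with _ | n
      · exact map_zero _
      · exact (SuperAlg.inv_smul _ _).trans (congrArg _ (coeff_inv n p).symm)
  refine ext4 ?_ ?_ ?_ ?_ <;> simp [integral, h, integralPS_neg]

variable [CharZero k]

omit [SuperAlg k R] [CharZero k] [Parity R] in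
theorem natCast_succ_mul (n : ℕ) (a : R) : ((n + 1 : ℕ) : R) * a = ((n + 1 : ℕ) : k) • a := by
  rw [← nsmul_eq_mul, Nat.cast_smul_eq_nsmul]

omit [SuperAlg k R] in
theorem partialD_zero_integral (f : Disk R) : (frame R).d 0 (integral k f) = f := by
  have h : ∀ p : PowerSeries R, dPS (integralPS k p) = p := fun p => by
    ext n
    have h0 : ((n + 1 : ℕ) : k) ≠ 0 := Nat.cast_ne_zero.2 n.succ_ne_zero
    rw [coeff_dPS, natCast_succ_mul k, integralPS, PowerSeries.coeff_mk]
    exact smul_inv_smul₀ h0 _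
  rw [frame_d, partialD_zero]
  refine ext4 ?_ ?_ ?_ ?_ <;> simp [integral, h]

omit [SuperAlg k R] [Parity R] in
include k in
theorem eq_C_of_dPS_eq_zero {p : PowerSeries R} (hp : dPS p = 0) :
    p = PowerSeries.C (PowerSeries.coeff 0 p) := by
  ext n
  rcases n with _ | n
  · simp
  · have h := congrArg (PowerSeries.coeff n) hp
    rw [coeff_dPS, natCast_succ_mul k, map_zero] at h
    have h0 : ((n + 1 : ℕ) : k) ≠ 0 := Nat.cast_ne_zero.2 n.succ_ne_zero
    rw [PowerSeries.coeff_C, if_neg n.succ_ne_zero]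
    exact (smul_eq_zero.1 h).resolve_left h0

-- The `θ¹θ²`-term of the `∂_t`-component of a divergence free field does not depend on `t`, so its
-- constant coefficient `tau` decides whether it vanishes.
include k in
theorem top_eq_zero_of_div {X : Disk R → Disk R} (hX : (frame R).div X = 0)
    (ht : tau (X (gen 0)) = 0) : (frame R).top (X (gen 0)) = 0 := by
  have : SuperComm R := SuperAlg.toSuperComm k
  have h := (frame R).d0_top_apply X
  rw [hX, Frame.top_zero, frame_x, top_eq] at h
  have h1 : dPS (X (gen 0)).snd.snd = 0 := congrArg (fun g : Disk R => g.fst.fst) h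
  rw [top_eq, eq_C_of_dPS_eq_zero k h1, ← tau_apply, ht, map_zero, map_zero]

variable {k}

/-- Divergence free even vector fields whose `∂_t`-component has no `θ¹ θ²`-term are in `S(2)`. -/
theorem mem_S2_of_div {X : Module.End k (Disk R)} (hXe : (frame R).IsEven X)
    (hX : (frame R).div X = 0) (ht : tau (X (gen 0)) = 0) : X ∈ S2 k R := by
  have : SuperComm R := SuperAlg.toSuperComm k
  have htop := top_eq_zero_of_div k hX ht
  set F := frame R with hF
  -- The aim is `X = [∂_t, Y]` with `Y` divergence free. Integrating the coefficients in `t` solves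
  -- the equation, but leaves a divergence `h` that is independent of `t` and satisfies `top h = 0`.
  let y : Fin 3 → Disk R := fun i => integral k (X (F.x i))
  have d0y : ∀ i, F.d 0 (y i) = X (F.x i) := fun i => partialD_zero_integral k _
  have hy0 : Parity.inv (y 0) = y 0 := by simp only [y, inv_integral, hXe.inv_apply0]
  have hy1 : Parity.inv (y 1) = -y 1 := by simp only [y, inv_integral, hXe.inv_apply1, integral_neg]
  have hy2 : Parity.inv (y 2) = -y 2 := by simp only [y, inv_integral, hXe.inv_apply2, integral_neg]
  obtain ⟨h, hh⟩ : ∃ h, h = F.d 0 (y 0) - F.d 1 (y 1) - F.d 2 (y 2) := ⟨_, rfl⟩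
  have hinv : Parity.inv h = h := by simp [hh, F.inv_d, hy0, hy1, hy2]
  have hd0 : F.d 0 h = 0 := by
    rw [hh, map_sub, map_sub, F.d_comm 1, F.d_comm 2, d0y, d0y, d0y]
    exact hX
  have htop' : F.top h = 0 := by
    rw [hh, F.top_sub, F.top_sub, F.top_d1, F.top_d2, d0y, sub_zero, sub_zero]
    exact htop
  have x1 := F.inv_x1
  have x2 := F.inv_x2
  have h1inv : Parity.inv (F.d 1 h) = -F.d 1 h := by simp [F.inv_d, hinv]
  -- The corrections do not depend on `t`, so `[∂_t, Y]` is unchanged. Their odd derivatives are `h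
  -- - θ¹ ∂₁h` and, because `∂₂∂₁h = 0`, `θ¹ ∂₁h`; together they remove `h`.
  let w : Fin 3 → Disk R :=
    ![y 0, y 1 + F.x 1 * h, y 2 + F.x 2 * (F.x 1 * F.d 1 h)]
  have hw : ∀ i, Parity.inv (w i) = sg i • w i := fun i => by
    fin_cases i
    · simpa [w] using hy0
    · change Parity.inv (y 1 + F.x 1 * h) = (-1 : ℤ) • (y 1 + F.x 1 * h)
      rw [map_add, map_mul, hy1, x1, hinv, neg_smul, one_smul, neg_add, neg_mul]
    · change Parity.inv (y 2 + F.x 2 * (F.x 1 * F.d 1 h)) =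
        (-1 : ℤ) • (y 2 + F.x 2 * (F.x 1 * F.d 1 h))
      rw [map_add, map_mul, map_mul, hy2, x1, x2, h1inv, neg_smul, one_smul, neg_add,
        neg_mul_neg, neg_mul]
  have d0w : ∀ i, F.d 0 (w i) = X (F.x i) := fun i => by
    fin_cases i
    · exact d0y 0
    · simp [w, F.d_mul, F.d_x, d0y, hd0]
    · simp [w, F.d_mul, F.d_x, d0y, hd0, F.d_comm]
  have hYe := isEven_vf (k := k) hw
  have hYd : F.div (vf k w) = 0 := by
    have e : ∀ i, vf k w (F.x i) = w i := vf_gen w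
    have ht1 : F.d 2 (F.d 1 h) = 0 := htop'
    have e1 : F.d 1 (w 1) = F.d 1 (y 1) + (h - F.x 1 * F.d 1 h) := by
      simp [w, F.d_mul, F.d_x, x1, sub_eq_add_neg]
    have e2 : F.d 2 (w 2) = F.d 2 (y 2) + F.x 1 * F.d 1 h := by
      simp [w, F.d_mul, F.d_x, x1, x2, ht1]
    rw [Frame.div, e, e, e, e1, e2]
    change F.d 0 (y 0) - _ - _ = 0
    nth_rewrite 1 [hh]
    abel
  let v : Fin 3 → Disk R := ![1, 0, 0]
  have hv : ∀ i, Parity.inv (v i) = sg i • v i := fun i => by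
    fin_cases i <;> simp [v]
  have hve := isEven_vf (k := k) hv
  have hvd : F.div (vf k v) = 0 := by
    have e : ∀ i, vf k v (F.x i) = v i := vf_gen v
    simp only [Frame.div, e]
    simp [v, F.d_one]
  refine Submodule.subset_span ⟨0, 0, vf k v, vf k w, mem_S12_zero_iff.2 ⟨hve, hvd⟩,
    mem_S12_zero_iff.2 ⟨hYe, hYd⟩, ?_⟩
  ext1 f
  have hvf : ∀ f, vf k v f = F.d 0 f := fun f => by simp [vf_apply, v, hF]
  have e : (vf k v * vf k w - (-1) ^ ((0 : ZMod 2).val * (0 : ZMod 2).val) * (vf k w * vf k v)) f =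
      F.d 0 (vf k w f) - vf k w (F.d 0 f) := by simp [hvf]
  rw [e, hXe.eq, ← d0w, ← d0w, ← d0w, vf_apply, vf_apply]
  simp only [map_add, F.d_mul, tw_zero, ← hF, F.d_comm]
  abel

end Disk

end

end SuperCurve

/-! ### Substitutions and linear automorphisms. -/

namespace SuperCurve
noncomputable section

theorem map_berezinian {A B : Type*} [Ring A] [Parity A] [Ring B] (φ : A →+* B)
    {M : Matrix (Fin 3) (Fin 3) A} (h : berezinian M = 1) :
    berezinian (Matrix.of fun i j => φ (M i j)) = 1 := by
  have hu := isUnit_of_berezinian_eq_one h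
  set D := M 1 1 * M 2 2 - M 1 2 * M 2 1 with hD
  have e : Ring.inverse (φ D) = φ (Ring.inverse D) := by
    rw [← one_mul (Ring.inverse (φ D)), ← map_one φ, ← Ring.inverse_mul_cancel D hu, map_mul,
      mul_assoc, Ring.mul_inverse_cancel _ (hu.map φ), mul_one]
  have e' : φ (M 1 1) * φ (M 2 2) - φ (M 1 2) * φ (M 2 1) = φ D := by
    rw [hD, map_sub, map_mul, map_mul]
  rw [berezinian, ← hD] at h
  have h' := congrArg φ h
  rw [map_one] at h'
  rw [← h', berezinian]
  simp only [Matrix.of_apply, e', e, map_mul, map_sub, map_add]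

/-- The extension to `A[θ]` of a homomorphism of superalgebras `A → B` that maps `θ` to `v`. -/
def Grassmann.liftHom {A B : Type*} [Ring A] [Parity A] [Ring B] [Parity B] [SuperComm B]
    (φ : A →+* B) (hφ : ∀ a, Parity.inv (φ a) = φ (Parity.inv a)) (v : B)
    (hv : Parity.inv v = -v) : Grassmann A →+* B where
  toFun f := φ f.fst + φ f.snd * v
  map_one' := by simp
  map_zero' := by simp
  map_add' f g := by simp only [fst_add, snd_add, map_add, add_mul]; abel
  map_mul' f g := by
    have h1 : ∀ c, v * φ c = φ (Parity.inv c) * v := fun c => by rw [odd_mul hv, hφ]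
    have h2 : φ f.snd * v * (φ g.snd * v) = 0 := by
      rw [mul_assoc, ← mul_assoc v, h1, mul_assoc, odd_sq hv, mul_zero, mul_zero]
    have h3 : φ f.snd * v * φ g.fst = φ f.snd * φ (Parity.inv g.fst) * v := by
      rw [mul_assoc, h1, mul_assoc]
    simp only [fst_mul, snd_mul, map_add, map_mul, mul_add, add_mul, h2, h3, mul_assoc]
    abel

theorem Grassmann.inv_liftHom {A B : Type*} [Ring A] [Parity A] [Ring B] [Parity B] [SuperComm B]
    (φ : A →+* B) (hφ : ∀ a, Parity.inv (φ a) = φ (Parity.inv a)) (v : B)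
    (hv : Parity.inv v = -v) (f : Grassmann A) :
    Parity.inv (liftHom φ hφ v hv f) = liftHom φ hφ v hv (Parity.inv f) := by
  simp [liftHom, hφ, hv]

namespace Disk

variable {R : Type v} [Ring R] [Parity R]

theorem const_mul_mem {N : ℕ} (r : R) {f : Disk R} (hf : f ∈ mPow R N) :
    const r * f ∈ mPow R N := by
  simpa using mul_mem_mPow (mem_mPow_zero (const r)) hf

theorem isSum_eval {u : Disk R} (hm : u ∈ mPow R 1) (p : PowerSeries R) :
    IsSum (fun n => const (PowerSeries.coeff n p) * u ^ n)
      (msum fun n => const (PowerSeries.coeff n p) * u ^ n) :=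
  isSum_msum fun n => const_mul_mem _ (pow_mem_mPow hm n)

/-- Substitution of an even element of `𝔪` into a power series. -/
def evalPS [SuperComm R] (u : Disk R) (hu : Parity.inv u = u) (hm : u ∈ mPow R 1) :
    PowerSeries R →+* Disk R where
  toFun p := msum fun n => const (PowerSeries.coeff n p) * u ^ n
  map_one' := (isSum_eval hm 1).unique (by
    have h := IsSum.of_eventually_zero
      (a := fun n => const (PowerSeries.coeff n (1 : PowerSeries R)) * u ^ n) fun n hn => by
        rw [PowerSeries.coeff_one, if_neg hn, ← constHom_apply, map_zero, zero_mul]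
    convert h using 1
    simp [← constHom_apply])
  map_zero' := (isSum_eval hm 0).unique (by
    have h := IsSum.of_eventually_zero
      (a := fun n => const (PowerSeries.coeff n (0 : PowerSeries R)) * u ^ n) fun n hn => by
        simp [← constHom_apply]
    convert h using 1
    simp [← constHom_apply])
  map_add' p q := (isSum_eval hm (p + q)).unique (by
    simpa only [map_add, add_mul, ← constHom_apply] using (isSum_eval hm p).add (isSum_eval hm q))
  map_mul' p q := (isSum_eval hm (p * q)).unique (by
    have hn : ∀ (p : PowerSeries R) n, const (PowerSeries.coeff n p) * u ^ n ∈ mPow R n :=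
      fun p n => const_mul_mem _ (pow_mem_mPow hm n)
    convert (isSum_eval hm p).mul (hn p) (hn q) (isSum_eval hm q) using 2 with n
    rw [PowerSeries.coeff_mul, ← constHom_apply, map_sum, Finset.sum_mul]
    refine Finset.sum_congr rfl fun x hx => ?_
    have hun : Parity.inv (u ^ x.1) = u ^ x.1 := by rw [map_pow, hu]
    rw [← Finset.HasAntidiagonal.mem_antidiagonal.1 hx, pow_add, map_mul, constHom_apply,
      constHom_apply, mul_assoc, mul_assoc, ← mul_assoc (const _) (u ^ x.1),
      ← even_comm hun, mul_assoc])

variable [SuperComm R]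

theorem isSum_evalPS {u : Disk R} (hu : Parity.inv u = u) (hm : u ∈ mPow R 1) (p : PowerSeries R) :
    IsSum (fun n => const (PowerSeries.coeff n p) * u ^ n) (evalPS u hu hm p) := isSum_eval hm p

theorem inv_evalPS {u : Disk R} (hu : Parity.inv u = u) (hm : u ∈ mPow R 1) (p : PowerSeries R) :
    Parity.inv (evalPS u hu hm p) = evalPS u hu hm (Parity.inv p) := by
  refine ((isSum_evalPS hu hm p).map (Parity.inv (A := Disk R)).toAddMonoidHom
    fun N f hf => inv_mem_mPow hf).unique ?_
  convert isSum_evalPS hu hm (Parity.inv p) using 2 with n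
  change Parity.inv (const _ * u ^ n) = _
  rw [map_mul, map_pow, hu, inv_const, coeff_inv]

theorem evalPS_C {u : Disk R} (hu : Parity.inv u = u) (hm : u ∈ mPow R 1) (r : R) :
    evalPS u hu hm (PowerSeries.C r) = const r := by
  refine (isSum_evalPS hu hm _).unique ?_
  have h := IsSum.of_eventually_zero
      (a := fun n => const (PowerSeries.coeff n (PowerSeries.C r)) * u ^ n) fun n hn => by
        rw [PowerSeries.coeff_C, if_neg hn, ← constHom_apply, map_zero, zero_mul]
  convert h using 1
  simp

theorem evalPS_X {u : Disk R} (hu : Parity.inv u = u) (hm : u ∈ mPow R 1) :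
    evalPS u hu hm PowerSeries.X = u := by
  refine (isSum_evalPS hu hm _).unique fun N => ?_
  have h : ∀ n, const (PowerSeries.coeff n (PowerSeries.X : PowerSeries R)) * u ^ n =
      if n = 1 then u else 0 := fun n => by
    rw [PowerSeries.coeff_X]
    split_ifs with hn
    · rw [hn, pow_one, ← constHom_apply, map_one, one_mul]
    · rw [← constHom_apply, map_zero, zero_mul]
  simp only [h, Finset.sum_ite_eq', Finset.mem_range]
  split_ifs with hN
  · rw [sub_self]; exact zero_mem _
  · rw [sub_zero]; exact mPow_mono (by omega) hm

variable {w : Fin 3 → Disk R} (hw : ∀ i, Parity.inv (w i) = sg i • w i) (hm : w 0 ∈ mPow R 1)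

/-- The endomorphism of `R[[1|2]]` that maps the generators to `w`. -/
def subst : Disk R →+* Disk R :=
  Grassmann.liftHom (Grassmann.liftHom (evalPS (w 0) (by simpa using hw 0) hm)
      (inv_evalPS _ hm) (w 1) (by simpa using hw 1))
    (Grassmann.inv_liftHom _ _ _ _) (w 2) (by simpa using hw 2)

theorem subst_apply (f : Disk R) : subst hw hm f =
    evalPS (w 0) (by simpa using hw 0) hm f.fst.fst
    + evalPS (w 0) (by simpa using hw 0) hm f.fst.snd * w 1
    + (evalPS (w 0) (by simpa using hw 0) hm f.snd.fst
    + evalPS (w 0) (by simpa using hw 0) hm f.snd.snd * w 1) * w 2 := rfl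

theorem inv_subst (f : Disk R) : Parity.inv (subst hw hm f) = subst hw hm (Parity.inv f) :=
  Grassmann.inv_liftHom _ _ _ _ f

theorem subst_const (r : R) : subst hw hm (const r) = const r := by
  rw [subst_apply]
  simpa [const] using evalPS_C (u := w 0) (by simpa using hw 0) hm r

theorem subst_gen (i : Fin 3) : subst hw hm (gen i) = w i := by
  rw [subst_apply]
  fin_cases i
  · simp [gen_zero, evalPS_X]
  · simp [gen_one]
  · simp [gen_two]

omit [SuperComm R] in
theorem mem_of_map_gen {F : Disk R →+* Disk R}
    (hg : ∀ i, F (gen i) ∈ mPow R 1) {f : Disk R} (hf : f ∈ mPow R 1) : F f ∈ mPow R 1 := by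
  have h0 : PowerSeries.coeff 0 f.fst.fst = 0 := (mem_mPow_iff.1 hf).1 0 one_pos
  obtain ⟨q, hq⟩ := ofPS_eq_const_add f.fst.fst
  rw [h0, ← constHom_apply, map_zero, zero_add] at hq
  have hl : ∀ a {b : Disk R}, b ∈ mPow R 1 → a * b ∈ mPow R 1 := fun a b hb => by
    simpa using mul_mem_mPow (mem_mPow_zero a) hb
  have hr : ∀ {a} (b : Disk R), a ∈ mPow R 1 → a * b ∈ mPow R 1 := fun b ha => by
    simpa using mul_mem_mPow ha (mem_mPow_zero b)
  rw [eq_sum_components f, hq]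
  simp only [map_add, map_mul]
  exact add_mem (add_mem (add_mem (hr _ (hg 0)) (hl _ (hg 1))) (hl _ (hg 2)))
    (hl _ (hr _ (hg 1)))

/-- The product of the matrices of two linear substitutions. -/
theorem sum_tw_mul_tw {M N : Fin 3 → Fin 3 → R}
    (hM : ∀ i j, Parity.inv (M i j) = (sg i * sg j) • M i j)
    (hMN : ∀ i l, M i 0 * N 0 l + M i 1 * N 1 l + M i 2 * N 2 l = if i = l then 1 else 0)
    (l j : Fin 3) : ∑ i, tw i (N i j) * tw l (M l i) = if l = j then 1 else 0 := by
  -- If `x_i` and `x_l` have the same parity, `M l i` is even and commutes. Otherwise it is odd, and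
  -- passing it changes one twist into the other.
  have sw : ∀ i, tw i (N i j) * tw l (M l i) = tw l (M l i) * tw l (N i j) := by
    intro i
    have h : (sg l * sg i = 1 ∧ ∀ a : R, tw i a = tw l a) ∨
        (sg l * sg i = -1 ∧ ∀ a : R, tw i a = Parity.inv (tw l a)) := by
      fin_cases i <;> fin_cases l <;> simp [Parity.inv_inv]
    have hi : ∀ a : R, Parity.inv (tw l a) = tw l (Parity.inv a) := fun a => by
      fin_cases l <;> rfl
    have hMl := hM l i
    rcases h with ⟨h1, h2⟩ | ⟨h1, h2⟩
    · rw [h1, one_smul] at hMl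
      rw [h2]
      exact (even_comm (by rw [hi, hMl]) _).symm
    · rw [h1, neg_smul, one_smul] at hMl
      rw [h2, ← odd_mul (by rw [hi, hMl, map_neg])]
  simp only [sw, ← map_mul (tw l), ← map_sum]
  rw [Fin.sum_univ_three, hMN]
  split_ifs <;> simp

omit [SuperComm R] in
theorem inv_linear {M : Fin 3 → Fin 3 → R}
    (hM : ∀ i j, Parity.inv (M i j) = (sg i * sg j) • M i j) {w : Fin 3 → Disk R}
    (hw : ∀ i, Parity.inv (w i) = sg i • w i) (j : Fin 3) :
    Parity.inv (∑ i, const (tw i (M i j)) * w i) = sg j • ∑ i, const (tw i (M i j)) * w i := by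
  rw [map_sum, Finset.smul_sum]
  refine Finset.sum_congr rfl fun i _ => ?_
  have e : Parity.inv (tw i (M i j)) = (sg i * sg j) • tw i (M i j) := by
    rw [← map_zsmul (tw i), ← hM]
    fin_cases i <;> rfl
  rw [map_mul, inv_const, e, hw, ← constHom_apply, map_zsmul, constHom_apply, smul_mul_smul_comm]
  congr 1
  fin_cases i <;> simp

/-- Linear substitutions with inverse matrices are inverse. -/
theorem sum_const_mul_sum {M N : Fin 3 → Fin 3 → R}
    (hM : ∀ i j, Parity.inv (M i j) = (sg i * sg j) • M i j)
    (hMN : ∀ i l, M i 0 * N 0 l + M i 1 * N 1 l + M i 2 * N 2 l = if i = l then 1 else 0)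
    (w : Fin 3 → Disk R) (j : Fin 3) :
    ∑ i, const (tw i (N i j)) * ∑ l, const (tw l (M l i)) * w l = w j := by
  calc _ = ∑ i, ∑ l, const (tw i (N i j) * tw l (M l i)) * w l :=
        Finset.sum_congr rfl fun i _ => by
          rw [Finset.mul_sum]
          refine Finset.sum_congr rfl fun l _ => ?_
          rw [← mul_assoc, ← constHom_apply, ← constHom_apply, ← map_mul, constHom_apply]
    _ = ∑ l, const (if l = j then 1 else 0) * w l := by
          rw [Finset.sum_comm]
          refine Finset.sum_congr rfl fun l _ => ?_
          rw [← Finset.sum_mul, ← sum_tw_mul_tw hM hMN l j]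
          simp only [← constHom_apply, map_sum]
    _ = w j := by simp [← constHom_apply]

/-- Linear automorphisms of `R[[1|2]]`. -/
theorem exists_linear {J K : Fin 3 → Fin 3 → R}
    (hJ : ∀ i j, Parity.inv (J i j) = (sg i * sg j) • J i j)
    (hK : ∀ i j, Parity.inv (K i j) = (sg i * sg j) • K i j)
    (hJK : ∀ i l, J i 0 * K 0 l + J i 1 * K 1 l + J i 2 * K 2 l = if i = l then 1 else 0)
    (hKJ : ∀ i l, K i 0 * J 0 l + K i 1 * J 1 l + K i 2 * J 2 l = if i = l then 1 else 0)
    (hB : berezinian (Matrix.of J) = 1) :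
    ∃ T ∈ autBerLinear R, ∀ j, T (gen j) = ∑ i, const (tw i (J i j)) * gen i := by
  -- A left derivative `∂_i` twists the coefficient standing before `gen i`. Twisting it beforehand
  -- makes the Jacobian matrix equal to `M`.
  let L : (Fin 3 → Fin 3 → R) → Fin 3 → Disk R := fun M j => ∑ i, const (tw i (M i j)) * gen i
  have hL : ∀ M : Fin 3 → Fin 3 → R, (∀ i j, Parity.inv (M i j) = (sg i * sg j) • M i j) →
      ∀ j, Parity.inv (L M j) = sg j • L M j := fun M hM j =>
    inv_linear hM (frame R).inv_x j
  have hLm : ∀ M j, L M j ∈ mPow R 1 := fun M j =>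
    sum_mem fun i _ => const_mul_mem _ (gen_mem_mPow i)
  have comp : ∀ (M N : Fin 3 → Fin 3 → R) (hM : ∀ i j, Parity.inv (M i j) = (sg i * sg j) • M i j)
      (hN : ∀ i j, Parity.inv (N i j) = (sg i * sg j) • N i j)
      (_ : ∀ i l, M i 0 * N 0 l + M i 1 * N 1 l + M i 2 * N 2 l = if i = l then 1 else 0),
      ∀ f, subst (hL M hM) (hLm M 0) (subst (hL N hN) (hLm N 0) f) = f := by
    intro M N hM hN hMN f
    have e : (subst (hL M hM) (hLm M 0)).comp (subst (hL N hN) (hLm N 0)) = RingHom.id _ := by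
      have hg : ∀ j, (subst (hL M hM) (hLm M 0)) (subst (hL N hN) (hLm N 0) (gen j)) = gen j := by
        intro j
        rw [subst_gen, map_sum, ← sum_const_mul_sum hM hMN gen j]
        exact Finset.sum_congr rfl fun i _ => by rw [map_mul, subst_const, subst_gen]
      refine ringHom_ext ?_ (fun r => ?_) hg
      · rw [RingHom.comp_apply, hg]
        exact gen_mem_mPow 0
      · rw [RingHom.comp_apply, subst_const, subst_const]
        rfl
    exact congrArg (fun φ : Disk R →+* Disk R => φ f) e
  let T : Disk R ≃+* Disk R := RingEquiv.ofRingHom (subst (hL J hJ) (hLm J 0))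
    (subst (hL K hK) (hLm K 0)) (RingHom.ext (comp J K hJ hK hJK)) (RingHom.ext (comp K J hK hJ hKJ))
  have hT : ∀ f, T f = subst (hL J hJ) (hLm J 0) f := fun _ => rfl
  have hTg : ∀ j, T (gen j) = ∑ i, const (tw i (J i j)) * gen i := by
    intro j
    rw [hT]
    exact subst_gen _ _ j
  refine ⟨T, ⟨⟨⟨fun f => (inv_subst (hL J hJ) (hLm J 0) f).symm,
    fun r => subst_const (hL J hJ) (hLm J 0) r, fun f hf =>
      mem_of_map_gen (F := (T : Disk R →+* Disk R)) (fun i => ?_) hf⟩, ?_⟩,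
    fun j => ⟨_, hTg j⟩⟩, hTg⟩
  · exact (hTg i).symm ▸ hLm J i
  have h := map_berezinian (constHom R) hB
  rw [berJacobian, ← h]
  congr 1
  ext1 i j
  rw [Matrix.of_apply, Matrix.of_apply, hTg, ← frame_d, map_sum, Fin.sum_univ_three]
  simp only [(frame R).d_mul, partialD_const, zero_mul, zero_add, frame_x_ite, constHom_apply]
  fin_cases i <;> simp [inv_const, Parity.inv_inv]

end Disk

end

end SuperCurve

/-! ### Flux and divergence of `exp(X) ∘ T`. -/

namespace SuperCurve
noncomputable section

namespace Disk

section Automorphisms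

variable {R : Type v} [Ring R] [Parity R]

theorem IsAut.symm_const {Φ : Disk R ≃+* Disk R} (hΦ : IsAut Φ) (r : R) :
    Φ.symm (Disk.const r) = Disk.const r := by rw [Φ.symm_apply_eq, hΦ.const]

theorem IsAut.symm_inv {Φ : Disk R ≃+* Disk R} (hΦ : IsAut Φ) (f : Disk R) :
    Φ.symm (Parity.inv f) = Parity.inv (Φ.symm f) := by
  rw [Φ.symm_apply_eq, hΦ.even, Φ.apply_symm_apply]

variable [SuperComm R]

/-- The conjugate of an even vector field by an automorphism. -/
theorem IsAut.isEven_conj {Φ : Disk R ≃+* Disk R} (hΦ : IsAut Φ) {V : Disk R → Disk R}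
    (hV : (frame R).IsEven V) : (frame R).IsEven fun f => Φ (V (Φ.symm f)) := by
  refine isEven_of_derivation (fun f g => ?_) (fun f => ?_) (fun f g => ?_) fun r => ?_
  · rw [map_add, hV.map_add, map_add]
  · rw [← hΦ.even, hV.inv_apply, hΦ.symm_inv]
  · rw [map_mul, hV.map_mul, map_add, map_mul, map_mul, Φ.apply_symm_apply, Φ.apply_symm_apply]
  · rw [hΦ.symm_const, hV.eq]
    simp [partialD_const]

end Automorphisms

/-! ### The Euler field -/

section Euler

variable {k : Type u} {R : Type v} [Field k] [Ring R] [Module k R] [Parity R] [SuperAlg k R]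

variable (k R) in
/-- The Euler field `t ∂_t + θ¹ ∂_{θ¹} + θ² ∂_{θ²}`. -/
def euler : Module.End k (Disk R) := vf k gen

theorem isEven_euler : (frame R).IsEven (euler k R) := isEven_vf (frame R).inv_x

theorem euler_gen (i : Fin 3) : euler k R (gen i) = gen i := vf_gen _ _

theorem euler_const_mul (r : R) (f : Disk R) :
    euler k R (const r * f) = const r * euler k R f := by
  have : SuperComm R := SuperAlg.toSuperComm k
  have h : euler k R (const r) = 0 := by rw [isEven_euler.eq]; simp [partialD_const]
  rw [isEven_euler.map_mul, h, zero_mul, zero_add]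

theorem div_euler : (frame R).div (euler k R) = -1 := by
  have h : ∀ i, euler k R ((frame R).x i) = gen i := euler_gen
  rw [Frame.div, h, h, h, frame_x_ite, frame_x_ite, frame_x_ite]
  simp

theorem coeff_euler (f : Disk R) (n : ℕ) :
    PowerSeries.coeff n (euler k R f).fst.fst = ((n : ℕ) : R) * PowerSeries.coeff n f.fst.fst ∧
    PowerSeries.coeff n (euler k R f).fst.snd = ((n + 1 : ℕ) : R) * PowerSeries.coeff n f.fst.snd ∧
    PowerSeries.coeff n (euler k R f).snd.fst = ((n + 1 : ℕ) : R) * PowerSeries.coeff n f.snd.fst ∧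
    PowerSeries.coeff n (euler k R f).snd.snd =
      ((n + 2 : ℕ) : R) * PowerSeries.coeff n f.snd.snd := by
  have h : ∀ (p : PowerSeries R), PowerSeries.coeff n (PowerSeries.X * dPS p) =
      ((n : ℕ) : R) * PowerSeries.coeff n p := fun p => by
    rcases n with _ | n
    · simp
    · rw [PowerSeries.coeff_succ_X_mul, coeff_dPS]
  rw [euler, vf_apply, frame_d, frame_d, frame_d, partialD_zero, partialD_one, partialD_two,
    gen_zero, gen_one, gen_two]
  refine ⟨?_, ?_, ?_, ?_⟩
  · simp [h]
  · simp [h, add_mul, Parity.inv_inv]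
  · simp [h, add_mul, Parity.inv_inv]
  · simp [h, Parity.inv_inv]
    rw [add_mul, add_assoc, two_mul]

variable [CharZero k]

include k in
omit [Parity R] [SuperAlg k R] in
theorem eq_zero_of_natCast_mul {n : ℕ} (hn : n ≠ 0) {a : R} (h : (n : R) * a = 0) : a = 0 := by
  obtain ⟨m, rfl⟩ := Nat.exists_eq_succ_of_ne_zero hn
  rw [natCast_succ_mul k] at h
  exact (smul_eq_zero.1 h).resolve_left (Nat.cast_ne_zero.2 m.succ_ne_zero)

/-- The Euler field multiplies terms of degree `d` by `d`, which is invertible for `d > 0`;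
membership in `𝔪` excludes degree zero. -/
theorem mem_mPow_of_euler {N : ℕ} {f : Disk R} (hf : f ∈ mPow R 1)
    (h : euler k R f ∈ mPow R N) : f ∈ mPow R N := by
  rw [mem_mPow_iff] at *
  refine ⟨fun n hn => ?_, fun n hn => ?_, fun n hn => ?_, fun n hn => ?_⟩
  · rcases n with _ | n
    · exact hf.1 0 one_pos
    · exact eq_zero_of_natCast_mul (k := k) n.succ_ne_zero
        ((coeff_euler (k := k) f _).1.symm.trans (h.1 _ hn))
  · exact eq_zero_of_natCast_mul (k := k) n.succ_ne_zero
      ((coeff_euler (k := k) f _).2.1.symm.trans (h.2.1 _ hn))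
  · exact eq_zero_of_natCast_mul (k := k) n.succ_ne_zero
      ((coeff_euler (k := k) f _).2.2.1.symm.trans (h.2.2.1 _ hn))
  · exact eq_zero_of_natCast_mul (k := k) (Nat.succ_ne_zero _)
      ((coeff_euler (k := k) f _).2.2.2.symm.trans (h.2.2.2 _ hn))

-- The monomial `θ¹θ²` has degree two, so its coefficient `c` in a degree one element satisfies `2c
-- = c`.
omit [CharZero k] in
theorem tau_eq_zero_of_euler {f : Disk R} (h : euler k R f = f) : tau f = 0 := by
  have h1 := (coeff_euler (k := k) f 0).2.2.2
  rw [h, zero_add, Nat.cast_two, two_mul] at h1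
  exact left_eq_add.1 h1

-- Linear substitutions preserve the degree; both sides agree on constants and generators.
omit [CharZero k] in
theorem euler_comm {T : Disk R ≃+* Disk R} (hT : T ∈ autBerLinear R) (f : Disk R) :
    euler k R (T f) = T (euler k R f) := by
  have : SuperComm R := SuperAlg.toSuperComm k
  have hc : ∀ r : R, euler k R (const r) = 0 := fun r => by
    rw [isEven_euler.eq]; simp [partialD_const]
  have hg : ∀ i, euler k R (T (gen i)) - T (euler k R (gen i)) = 0 := fun i => by
    obtain ⟨a, ha⟩ := hT.2 i
    rw [euler_gen, ha, map_sum]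
    simp only [euler_const_mul, euler_gen, sub_self]
  let D : Disk R → Disk R := fun f => euler k R (T f) - T (euler k R f)
  have hadd : ∀ f g, D (f + g) = D f + D g := fun f g => by simp only [D, map_add]; abel
  have hmul : ∀ f g, D (f * g) = D f * T g + T f * D g := fun f g => by
    simp only [D, map_mul, isEven_euler.map_mul, map_add]
    noncomm_ring
  have h : ∀ p, D (ofPS R p) = 0 := map_ofPS_eq_zero hadd
    (hT.1.1.origin _ (gen_mem_mPow 0)) (fun r => by
      simp only [D]
      rw [hT.1.1.const, hc, map_zero, sub_zero])
    fun f => by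
      rw [hmul]
      simp only [D, hg 0, zero_mul, zero_add]
  rw [← sub_eq_zero]
  change D f = 0
  have hg' : ∀ i, D (gen i) = 0 := hg
  rw [eq_sum_components f]
  simp [hadd, hmul, h, hg']

end Euler

section Tau

variable {k : Type u} {R : Type v} [Field k] [Ring R] [Module k R] [Parity R]

theorem tau_smul (c : k) (f : Disk R) : tau (c • f) = c • tau f := by
  rw [tau_apply, tau_apply, Grassmann.snd_smul, Grassmann.snd_smul]
  rfl

/-- The coefficient of `θ¹θ²` is blind to `𝔪³`. -/
theorem tau_eq_of_isSum {R : Type v} [Ring R] [Parity R] {a : ℕ → Disk R} {s : Disk R}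
    (h : IsSum a s) : tau s = tau (a 0) + tau (a 1) + tau (a 2) := by
  have h3 := tau_eq_zero_of_mem (h 3)
  rwa [map_sub, sub_eq_zero, Finset.sum_range_succ, Finset.sum_range_succ, Finset.sum_range_one,
    map_add, map_add] at h3

end Tau

section Conjugation

variable {k : Type u} {R : Type v} [Field k] [Ring R] [Module k R] [Parity R] [SuperAlg k R]

theorem isEven_adPow {X V : Module.End k (Disk R)} (hX : (frame R).IsEven X)
    (hV : (frame R).IsEven V) (n : ℕ) : (frame R).IsEven (adPow X V n) := by
  have : SuperComm R := SuperAlg.toSuperComm k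
  induction n with
  | zero => exact hV
  | succ n ih => exact hX.bracket ih

theorem div_adPow_succ {X V : Module.End k (Disk R)} (hX : (frame R).IsEven X)
    (hV : (frame R).IsEven V) (n : ℕ) : (frame R).div (adPow X V (n + 1)) =
      X ((frame R).div (adPow X V n)) - adPow X V n ((frame R).div X) := by
  have : SuperComm R := SuperAlg.toSuperComm k
  exact hX.div_bracket (isEven_adPow hX hV n)

omit [SuperAlg k R] in
theorem adPow_mem {X V : Module.End k (Disk R)} (hX : Raises X) (hV : Preserves V) (n : ℕ) {N : ℕ}
    {f : Disk R} (hf : f ∈ mPow R N) : adPow X V n f ∈ mPow R (N + n) := by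
  induction n generalizing N f with
  | zero => exact hV _ _ hf
  | succ n ih =>
    refine sub_mem (hX _ _ (ih hf)) ?_
    have := ih (hX _ _ hf)
    rwa [add_right_comm, add_assoc] at this

theorem IsExp.isAut {X : Module.End k (Disk R)} (hX : (frame R).IsEven X) (hr : Raises X)
    {E : Disk R ≃+* Disk R} (hE : IsExp X E) : IsAut E where
  even f := by
    have hn : ∀ (n : ℕ) f, (X ^ n) (Parity.inv f) = Parity.inv ((X ^ n) f) := by
      intro n
      induction n with
      | zero => exact fun f => rfl
      | succ n ih =>
        intro f
        rw [pow_succ, Module.End.mul_apply, Module.End.mul_apply, ← hX.inv_apply, ih]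
    refine IsSum.unique (isExp_iff.1 hE _) ?_
    change IsSum _ ((Parity.inv (A := Disk R)).toAddMonoidHom (E f))
    convert (isExp_iff.1 hE f).map (Parity.inv (A := Disk R)).toAddMonoidHom
      fun N f hf => inv_mem_mPow hf using 2 with n
    rw [expTerm_apply, hn, ← SuperAlg.inv_smul]
    rfl
  const r := by
    refine IsSum.unique (isExp_iff.1 hE _) ?_
    have h := IsSum.of_eventually_zero (a := fun n => expTerm X n (const r)) fun n hn => by
      obtain ⟨m, rfl⟩ := Nat.exists_eq_succ_of_ne_zero hn
      have : X (const r) = 0 := by rw [hX.eq]; simp [partialD_const]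
      rw [expTerm_apply, pow_succ, Module.End.mul_apply, this, map_zero, smul_zero]
    simpa only [expTerm_zero, Module.End.one_apply] using h
  origin f hf := (isExp_iff.1 hE f).mem_mPow fun n =>
    mPow_mono (Nat.le_add_left _ _) (hr.expTerm_mem n hf)

omit [SuperAlg k R] in
theorem adPow_succ_apply (X V : Module.End k (Disk R)) (n : ℕ) (f : Disk R) :
    adPow X V (n + 1) f = X (adPow X V n f) - adPow X V n (X f) := rfl

variable [CharZero k]

/-- The flux of `exp(X) ∘ T`. -/
theorem tau_exp_comp {X : Module.End k (Disk R)} (hX : (frame R).IsEven X)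
    (hX2 : ∀ i, X (gen i) ∈ mPow R 2) (hdiv : (frame R).div X = 0) {E T : Disk R ≃+* Disk R}
    (hE : IsExp X E) (hT : T ∈ autBerLinear R) :
    tau (E (T (gen 0 * (frame R).d 0 (T.symm (E.symm (gen 0)))))) = tau (X (gen 0)) := by
  have : SuperComm R := SuperAlg.toSuperComm k
  set F := frame R with hF
  let s : Fin 3 → Disk R := ![gen 0, 0, 0]
  have hs : ∀ i, Parity.inv (s i) = sg i • s i := fun i => by
    fin_cases i
    · simpa [s] using (show Parity.inv (gen 0 : Disk R) = gen 0 from F.inv_x0)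
    · simp [s]
    · simp [s]
  have hS : ∀ f, vf k s f = gen 0 * F.d 0 f := fun f => by simp [vf_apply, s, hF]
  have hSe := hT.1.1.isEven_conj (isEven_vf (k := k) hs)
  -- The left side of the claim is `tau` of the `∂_t`-component of `exp(X) V exp(-X)`, where `V` is
  -- the conjugate of `t ∂_t` by `T`. The series of iterated commutators computes it.
  let V : Module.End k (Disk R) := vf k fun i => T (vf k s (T.symm (gen i)))
  have hV : ∀ f, V f = T (vf k s (T.symm f)) := fun f => (hSe.eq f).symm
  have hVe : F.IsEven V := by
    rw [show (V : Disk R → Disk R) = _ from funext hV]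
    exact hSe
  have hVT : ∀ j, V (T (gen j)) = if j = 0 then T (gen 0) else 0 := fun j => by
    rw [hV, T.symm_apply_apply, hS, frame_x_ite]
    by_cases h : j = 0
    · simp [h]
    · simp [h, Ne.symm h]
  have hVd : F.div V = 1 := by
    have := hVe.div_eq (y := fun j => T (gen j)) (κ := ![1, 0, 0]) (fun j => by
      rw [← hT.1.1.even, ← frame_x, F.inv_x, map_zsmul]) hT.1.2 (fun i j => by
      rw [hVT]
      fin_cases j <;> simp)
    simpa using this
  have hVg : ∀ i, V (gen i) ∈ mPow R 1 := fun i => by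
    rw [hV, hS, map_mul]
    have := mul_mem_mPow (hT.1.1.origin _ (gen_mem_mPow 0))
      (mem_mPow_zero (T (F.d 0 (T.symm (gen i)))))
    simpa using this
  have hVp := preserves_of_isEven hVe hVg
  have hr := raises_of_isEven hX hX2
  -- Since `V` is conjugate to `t ∂_t` by a linear map, it commutes with the Euler field, so `V (gen
  -- 0)` is again linear.
  have hVt : tau (V (gen 0)) = 0 := by
    refine tau_eq_zero_of_euler (k := k) ?_
    have hTs : ∀ f, euler k R (T.symm f) = T.symm (euler k R f) := fun f => by
      rw [T.eq_symm_apply, ← euler_comm hT, T.apply_symm_apply]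
    have hd : ∀ f, euler k R (vf k s f) = vf k s (euler k R f) := fun f => by
      have hb := isEven_euler (k := k).bracket (isEven_vf (k := k) hs)
      have h0 : ∀ i, euler k R (vf k s (F.x i)) - vf k s (euler k R (F.x i)) = 0 := fun i => by
        rw [hF, frame_x, euler_gen, vf_gen]
        fin_cases i
        · simp [s, euler_gen]
        · simp [s]
        · simp [s]
      have := hb.eq f
      simp only [← hF, h0, zero_mul, add_zero] at this
      exact sub_eq_zero.1 this
    rw [hV, euler_comm hT, hd, hTs, euler_gen]
  have hsum := isSum_conj_symm hr hVp hE (gen 0)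
  rw [hV, hS] at hsum
  have hdn : ∀ n, F.div (adPow X V (n + 1)) = 0 := fun n => by
    induction n with
    | zero =>
      rw [div_adPow_succ hX hVe, ← hF, hdiv, map_zero, sub_zero]
      change X (F.div V) = 0
      rw [hVd, hX.map_one]
    | succ n ih => rw [div_adPow_succ hX hVe, ← hF, hdiv, map_zero, sub_zero, ih, map_zero]
  -- With `div V = 1` and `div X = 0`, the formula for `top` of a bracket returns the integral of
  -- `X` itself.
  have h1 : tau (adPow X V 1 (gen 0)) = tau (X (gen 0)) := by
    have := hX.top_bracket hVe
    rw [hVd, hdiv, mul_one, mul_zero, sub_zero] at this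
    have h := tau_eq_zero_of_top (f := adPow X V 1 (gen 0) - X (gen 0)) (by
      rw [Frame.top_sub, sub_eq_zero]
      exact this)
    rwa [map_sub, sub_eq_zero] at h
  -- Both `X` and `[X, V]` are divergence free, so their bracket has zero integral.
  have h2 : tau (adPow X V (1 + 1) (gen 0)) = 0 := by
    have := hX.top_bracket (isEven_adPow hX hVe 1)
    rw [hdn 0, hdiv, mul_zero, mul_zero, sub_zero, Frame.top_zero] at this
    rw [show F.x 0 = gen 0 from rfl] at this
    rw [adPow_succ_apply]
    exact tau_eq_zero_of_top this
  rw [tau_eq_of_isSum hsum, tau_smul, tau_smul, tau_smul, h1, h2]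
  change _ • tau (V (gen 0)) + _ + _ = _
  rw [hVt]
  simp

/-- If the automorphism `exp(X) ∘ T` has Berezinian `1`, then `X` is divergence free. -/
theorem div_eq_zero_of_berJacobian {X : Module.End k (Disk R)} (hX : (frame R).IsEven X)
    (hX2 : ∀ i, X (gen i) ∈ mPow R 2) {E T : Disk R ≃+* Disk R}
    (hE : IsExp X E) (hT : T ∈ autBerLinear R)
    (hB : berezinian (Matrix.of fun i j => (frame R).d i (E (T (gen j)))) = 1) :
    (frame R).div X = 0 := by
  have : SuperComm R := SuperAlg.toSuperComm k
  set F := frame R with hF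
  have hr := raises_of_isEven hX hX2
  have hEa := hE.isAut hX hr
  -- The linear map `T` commutes with the Euler field, so the conjugate by `E` alone scales all the
  -- coordinates `E (T (gen j))` with weight `1`. Its divergence is `1 - 1 - 1 = -1`, the same as
  -- that of the Euler field.
  have hW := hEa.isEven_conj (isEven_euler (k := k))
  have hWd : F.div (fun f => E (euler k R (E.symm f))) = -1 := by
    have := hW.div_eq (y := fun j => E (T (gen j))) (κ := ![1, 1, 1]) (fun j => by
      rw [← hEa.even, ← hT.1.1.even, ← frame_x, F.inv_x, map_zsmul, map_zsmul]) hB (fun i j => by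
      rw [E.symm_apply_apply, euler_comm hT, euler_gen]
      fin_cases j <;> simp)
    simpa using this
  have hp : Preserves (euler k R) := preserves_of_isEven isEven_euler fun i => by
    rw [euler_gen]; exact gen_mem_mPow i
  refine eq_zero_of_mem_mPow fun N => ?_
  have base : F.div X ∈ mPow R 1 :=
    sub_mem (sub_mem (partialD_mem_mPow 0 (hX2 0)) (partialD_mem_mPow 1 (hX2 1)))
      (partialD_mem_mPow 2 (hX2 2))
  rcases N with _ | N
  · exact mem_mPow_zero _
  induction N with
  | zero => exact base
  | succ N ih =>
    refine mem_mPow_of_euler (k := k) base ?_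
    set U := adPow X (euler k R) with hU
    -- The divergence of the conjugated field is unchanged, so the higher terms of its series must
    -- cancel. This first one isolates the lowest order part of `div X`.
    have hU1 : F.div (U 1) = -euler k R (F.div X) := by
      rw [hU, div_adPow_succ hX isEven_euler]
      change X (F.div (euler k R)) - euler k R (F.div X) = _
      rw [hF, div_euler, map_neg, hX.map_one, neg_zero, zero_sub]
    have hUn : ∀ n, F.div (U (n + 1)) ∈ mPow R (N + 1) := fun n => by
      induction n with
      | zero =>
        rw [hU1]
        exact neg_mem (hp _ _ ih)
      | succ n ihn =>
        rw [hU, div_adPow_succ hX isEven_euler]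
        exact sub_mem (hr.preserves _ _ ihn) (mPow_mono (by omega) (adPow_mem hr hp (n + 1) ih))
    -- Every further commutator gains one degree over the assumed order `N + 1` of `div X`.
    have hUn' : ∀ n, F.div (U (n + 2)) ∈ mPow R (N + 2) := fun n => by
      rw [hU, div_adPow_succ hX isEven_euler]
      exact sub_mem (hr _ _ (hUn n)) (mPow_mono (by omega) (adPow_mem hr hp (n + 1) ih))
    -- One more term is kept because a derivative loses one degree.
    have hsum := fun i => partialD_mem_mPow i (isSum_conj_symm hr hp hE (gen i) (N + 3))
    have hd := sub_mem (sub_mem (hsum 0) (hsum 1)) (hsum 2)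
    have e : ∑ n ∈ Finset.range (N + 3), (n.factorial : k)⁻¹ • F.div (U n) =
        -1 - euler k R (F.div X)
          + ∑ n ∈ Finset.range (N + 1), ((n + 2).factorial : k)⁻¹ • F.div (U (n + 2)) := by
      rw [Finset.sum_range_succ', Finset.sum_range_succ', hU1]
      have : F.div (U 0) = -1 := div_euler
      rw [this]
      simp
      abel
    have hd' : F.div (fun f => E (euler k R (E.symm f)))
        - ∑ n ∈ Finset.range (N + 3), (n.factorial : k)⁻¹ • F.div (U n) ∈ mPow R (N + 2) := by
      change _ ∈ mPow R (N + 2) at hd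
      convert hd using 1
      simp only [Frame.div, map_sub, map_sum, smul_sub, Finset.sum_sub_distrib, hF, frame_d_smul,
        frame_x, hU]
      abel
    rw [e, hWd] at hd'
    have hs : ∑ n ∈ Finset.range (N + 1), ((n + 2).factorial : k)⁻¹ • F.div (U (n + 2))
      ∈ mPow R (N + 2) := sum_mem fun n _ => smul_mem_mPow _ (hUn' n)
    have := add_mem hd' hs
    convert this using 1
    abel

end Conjugation

end Disk

end

end SuperCurve

/-! ### Logarithms of automorphisms and the description of `S(2)₊`. -/

namespace SuperCurve
noncomputable section

namespace Disk

variable {k : Type u} {R : Type v} [Field k] [Ring R] [Module k R] [Parity R]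

/-- Every word in the difference contains at least one factor `D`, which gains `N + 1` degrees; each
of the other `n` factors gains at least one. -/
theorem pow_add_sub_pow_mem {X D : Module.End k (Disk R)} (hX : Raises X) {N : ℕ}
    (hD : ∀ M, ∀ f ∈ mPow R M, D f ∈ mPow R (M + (N + 1))) (n : ℕ) {M : ℕ} {f : Disk R}
    (hf : f ∈ mPow R M) : ((X + D) ^ (n + 1)) f - (X ^ (n + 1)) f ∈ mPow R (M + (N + 1) + n) := by
  have hXD : Raises (X + D) := fun L g hg =>
    add_mem (hX L g hg) (mPow_mono (by omega) (hD L g hg))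
  induction n with
  | zero =>
    simp only [zero_add, pow_one, LinearMap.add_apply, add_sub_cancel_left]
    exact hD _ _ hf
  | succ n ih =>
    have e : ((X + D) ^ (n + 1 + 1)) f - (X ^ (n + 1 + 1)) f =
        (X + D) (((X + D) ^ (n + 1)) f - (X ^ (n + 1)) f) + D ((X ^ (n + 1)) f) := by
      rw [pow_succ' _ (n + 1), pow_succ' _ (n + 1), Module.End.mul_apply, Module.End.mul_apply,
        map_sub]
      simp only [LinearMap.add_apply]
      abel
    rw [e]
    exact add_mem (hXD _ _ ih) (mPow_mono (by omega) (hD _ _ (hX.pow_mem (n + 1) hf)))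

/-- The linearization of the exponential. -/
theorem exp_add_sub_exp_mem {X D : Module.End k (Disk R)} (hX : Raises X) {N : ℕ}
    (hD : ∀ M, ∀ f ∈ mPow R M, D f ∈ mPow R (M + (N + 1))) {M : ℕ} {f s s' : Disk R}
    (hf : f ∈ mPow R M) (hs : IsSum (fun n => expTerm X n f) s)
    (hs' : IsSum (fun n => expTerm (X + D) n f) s') : s' - s - D f ∈ mPow R (M + N + 2) := by
  have h := sub_mem (hs' (M + N + 2)) (hs (M + N + 2))
  have e : ∑ n ∈ Finset.range (M + N + 2), (expTerm (X + D) n f - expTerm X n f) =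
      ∑ n ∈ Finset.range (M + N), (expTerm (X + D) (n + 2) f - expTerm X (n + 2) f) + D f := by
    rw [Finset.sum_range_succ', Finset.sum_range_succ']
    simp [expTerm]
  have hm : ∑ n ∈ Finset.range (M + N), (expTerm (X + D) (n + 2) f - expTerm X (n + 2) f) ∈
      mPow R (M + N + 2) := sum_mem fun n _ => by
    rw [expTerm_apply, expTerm_apply, ← smul_sub]
    exact smul_mem_mPow _ (mPow_mono (by omega) (pow_add_sub_pow_mem hX hD (n + 1) hf))
  have := add_mem h hm
  rw [eq_sub_of_add_eq e.symm, Finset.sum_sub_distrib] at this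
  convert this using 1
  abel

variable [SuperAlg k R]

omit [SuperAlg k R] in
theorem IsSum.inv {a : ℕ → Disk R} {s : Disk R} (h : IsSum a s) :
    IsSum (fun n => Parity.inv (a n)) (Parity.inv s) :=
  h.map (Parity.inv (A := Disk R)).toAddMonoidHom fun _ _ hf => inv_mem_mPow hf

omit [SuperAlg k R] in
theorem IsSum.zsmul {a : ℕ → Disk R} {s : Disk R} (h : IsSum a s) (c : ℤ) :
    IsSum (fun n => c • a n) (c • s) :=
  h.map (zsmulAddGroupHom c) fun _ _ hf => zsmul_mem hf _

/-- The exponential of an even vector field is even. -/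
theorem inv_exp_gen {X : Module.End k (Disk R)} (hX : (frame R).IsEven X) {i : Fin 3} {s : Disk R}
    (hs : IsSum (fun n => expTerm X n (gen i)) s) : Parity.inv s = sg i • s := by
  have hn : ∀ (n : ℕ) f, (X ^ n) (Parity.inv f) = Parity.inv ((X ^ n) f) := by
    intro n
    induction n with
    | zero => exact fun f => rfl
    | succ n ih =>
      intro f
      rw [pow_succ, Module.End.mul_apply, Module.End.mul_apply, ← hX.inv_apply, ih]
  refine hs.inv.unique ?_
  convert hs.zsmul (sg i) using 2 with n
  rw [expTerm_apply, SuperAlg.inv_smul, ← hn, ← frame_x, (frame R).inv_x, map_zsmul]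
  exact smul_comm _ _ _

theorem vf_raises {v : Fin 3 → Disk R} {N : ℕ} (hv : ∀ i, v i ∈ mPow R (N + 2)) (M : ℕ)
    {f : Disk R} (hf : f ∈ mPow R M) : vf k v f ∈ mPow R (M + (N + 1)) := by
  have h : ∀ i, v i * (frame R).d i f ∈ mPow R (M + (N + 1)) := fun i =>
    mPow_mono (by omega) (mul_mem_mPow (hv i) (partialD_mem_mPow i hf))
  exact add_mem (add_mem (h 0) (h 1)) (h 2)

variable (k) in
/-- Successive approximations of the logarithm of the automorphism that maps the generators
to `v`. -/
def logSeq (v : Fin 3 → Disk R) : ℕ → Fin 3 → Disk R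
  | 0 => 0
  | n + 1 => fun i => logSeq v n i + (v i - msum fun m => expTerm (vf k (logSeq v n)) m (gen i))

/-- Automorphisms that are the identity modulo `𝔪²` are exponentials. -/
theorem exists_log {v : Fin 3 → Disk R} (hv : ∀ i, Parity.inv (v i) = sg i • v i)
    (hv2 : ∀ i, v i - gen i ∈ mPow R 2) : ∃ X : Module.End k (Disk R), (frame R).IsEven X ∧
      (∀ i, X (gen i) ∈ mPow R 2) ∧ ∀ i, IsSum (fun n => expTerm X n (gen i)) (v i) := by
  have : SuperComm R := SuperAlg.toSuperComm k
  let ξ := logSeq k v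
  let g : ℕ → Fin 3 → Disk R := fun n i => msum fun m => expTerm (vf k (ξ n)) m (gen i)
  let a : Fin 3 → ℕ → Disk R := fun i n => v i - g n i
  have hξ : ∀ n i, ξ (n + 1) i = ξ n i + a i n := fun n i => rfl
  have hgs : ∀ n, (∀ i, ξ n i ∈ mPow R 2) → ∀ i,
      IsSum (fun m => expTerm (vf k (ξ n)) m (gen i)) (g n i) := fun n h i =>
    isSum_expTerm (fun M f hf => vf_raises (N := 0) h M hf) _
  -- The error of the `n`-th approximation lies in `𝔪^(n+2)`; the first one is the hypothesis that
  -- the map is the identity modulo `𝔪²`.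
  have inv : ∀ n, (∀ i, Parity.inv (ξ n i) = sg i • ξ n i) ∧ (∀ i, ξ n i ∈ mPow R 2) ∧
      ∀ i, a i n ∈ mPow R (n + 2) := fun n => by
    induction n with
    | zero =>
      have h0 : ∀ i, ξ 0 i = 0 := fun i => rfl
      have hz : ∀ i, ξ 0 i ∈ mPow R 2 := fun i => by rw [h0]; exact zero_mem _
      refine ⟨fun i => by rw [h0, map_zero, smul_zero], hz, fun i => ?_⟩
      have hX : vf k (ξ 0) = 0 := by
        ext1 f
        rw [vf_apply, h0, h0, h0]
        simp
      have h1 := IsSum.of_eventually_zero (a := fun m => expTerm (vf k (ξ 0)) m (gen i))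
        fun m hm => by
          rw [expTerm_apply, hX, zero_pow hm, LinearMap.zero_apply, smul_zero]
      have h2 := (hgs 0 hz i).unique h1
      rw [expTerm_zero, Module.End.one_apply] at h2
      change v i - g 0 i ∈ _
      rw [h2]
      exact hv2 i
    | succ n ih =>
      obtain ⟨h1, h2, h3⟩ := ih
      have hs := hgs n h2
      have hg : ∀ i, Parity.inv (g n i) = sg i • g n i := fun i =>
        inv_exp_gen (isEven_vf (k := k) h1) (hs i)
      have h2' : ∀ i, ξ (n + 1) i ∈ mPow R 2 := fun i =>
        add_mem (h2 i) (mPow_mono (by omega) (h3 i))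
      refine ⟨fun i => ?_, h2', fun i => ?_⟩
      · rw [hξ, map_add, smul_add, h1]
        simp only [a, map_sub, hv, hg, smul_sub]
      · have hs' := hgs (n + 1) h2' i
        have e : vf k (ξ (n + 1)) = vf k (ξ n) + vf k (fun i => a i n) := vf_add _ _
        rw [e] at hs'
        -- Adding the error to the field changes the exponential by the error up to one degree
        -- higher, so the new error has gained a degree.
        have h := exp_add_sub_exp_mem (fun M f hf => vf_raises (N := 0) h2 M hf)
          (N := n) (fun M f hf => vf_raises h3 M hf) (gen_mem_mPow i) (hs i) hs'
        rw [vf_gen] at h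
        have := neg_mem h
        rw [show 1 + n + 2 = n + 1 + 2 by ring] at this
        convert this using 1
        simp only [a]
        abel
  have ha : ∀ i n, a i n ∈ mPow R n := fun i n => mPow_mono (by omega) ((inv n).2.2 i)
  let ζ : Fin 3 → Disk R := fun i => msum (a i)
  have hζ : ∀ i, IsSum (a i) (ζ i) := fun i => isSum_msum (ha i)
  have hζ2 : ∀ i, ζ i ∈ mPow R 2 := fun i => (hζ i).mem_mPow fun n =>
    mPow_mono (by omega) ((inv n).2.2 i)
  have hsum : ∀ n i, ξ n i = ∑ m ∈ Finset.range n, a i m := fun n i => by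
    induction n with
    | zero => rfl
    | succ n ih => rw [hξ, ih, Finset.sum_range_succ]
  have hζe : ∀ i, Parity.inv (ζ i) = sg i • ζ i := fun i => by
    refine (hζ i).inv.unique ?_
    convert (hζ i).zsmul (sg i) using 2 with n
    have h := fun n => (inv n).1 i
    have e : a i n = ξ (n + 1) i - ξ n i := by rw [hξ, add_sub_cancel_left]
    rw [e, map_sub, h, h, smul_sub]
  have hr : Raises (vf k ζ) := fun M f hf => vf_raises (N := 0) hζ2 M hf
  refine ⟨vf k ζ, isEven_vf hζe, fun i => by rw [vf_gen]; exact hζ2 i, fun i => ?_⟩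
  have hs := isSum_expTerm hr (gen (R := R) i)
  convert hs using 1
  rw [← sub_eq_zero]
  refine eq_zero_of_mem_mPow fun N => mPow_mono (show N ≤ N + 2 by omega) ?_
  have hd : ∀ i, ζ i - ξ (N + 2) i ∈ mPow R (N + 2) := fun i => by rw [hsum]; exact hζ i _
  have e : vf k ζ = vf k (ξ (N + 2)) + vf k (ζ - ξ (N + 2)) := by
    rw [← vf_add, add_sub_cancel]
  rw [e] at hs
  -- The limit field differs from the approximation `N + 2` by terms in `𝔪^(N+2)`, so their
  -- exponentials also agree modulo `𝔪^(N+2)`.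
  have h := exp_add_sub_exp_mem (fun M f hf => vf_raises (N := 0) (inv (N + 2)).2.1 M hf)
    (N := N) (fun M f hf => vf_raises hd M hf) (gen_mem_mPow i)
    (hgs (N + 2) (inv (N + 2)).2.1 i) hs
  rw [vf_gen, ← e] at h
  have h3 := (inv (N + 2)).2.2 i
  have := sub_mem (sub_mem (mPow_mono (by omega) h3) (hd i))
    (mPow_mono (show N + 2 ≤ 1 + N + 2 by omega) h)
  convert this using 1
  simp only [a]
  abel

variable [CharZero k]

/-- Vector fields in `S(2)₊`. -/
theorem mem_S2plus_iff {X : Module.End k (Disk R)} : X ∈ S2plus k R ↔ (frame R).IsEven X ∧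
    (∀ i, X (gen i) ∈ mPow R 2) ∧ (frame R).div X = 0 ∧ tau (X (gen 0)) = 0 := by
  constructor
  · rintro ⟨h1, h2, h3⟩
    have he := mem_der_zero_iff.1 h2
    have hd := div_and_top_of_mem_S2 h1 he
    exact ⟨he, fun i => h3 _ (gen_mem_mPow i), hd.1, tau_eq_zero_of_top hd.2⟩
  · rintro ⟨he, h2, hd, ht⟩
    exact ⟨mem_S2_of_div he hd ht, mem_der_zero_iff.2 he,
      fun f hf => raises_of_isEven he h2 1 f hf⟩

end Disk

end

end SuperCurve

/-! ### Taylor expansion at the universal point. -/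

namespace SuperCurve
noncomputable section

namespace Frame

open Disk

variable (k : Type u) {A : Type v} [Field k] [Ring A] [Module k A] [Parity A] (F : Frame A)

/-- The Taylor expansion in the even coordinate. -/
def taylorPS (f : A) : PowerSeries A :=
  PowerSeries.mk fun n => (n.factorial : k)⁻¹ • (F.d 0)^[n] f

/-- The Taylor expansion at the universal point. -/
def taylor (f : A) : Disk A :=
  ⟨⟨taylorPS k F f, Parity.inv (taylorPS k F (F.d 1 f))⟩,
    ⟨Parity.inv (taylorPS k F (F.d 2 f)), taylorPS k F (F.d 2 (F.d 1 f))⟩⟩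

theorem taylorPS_add (f g : A) : F.taylorPS k (f + g) = F.taylorPS k f + F.taylorPS k g := by
  ext n
  simp [taylorPS, iterate_map_add]

theorem taylorPS_neg (f : A) : F.taylorPS k (-f) = -F.taylorPS k f := by
  ext n
  simp [taylorPS, iterate_map_neg]

theorem taylorPS_of_d_eq_zero {f : A} (hf : F.d 0 f = 0) : F.taylorPS k f = PowerSeries.C f := by
  ext n
  rw [taylorPS, PowerSeries.coeff_mk, PowerSeries.coeff_C]
  rcases n with _ | n
  · simp
  · rw [Function.iterate_succ_apply, hf, iterate_map_zero, smul_zero, if_neg n.succ_ne_zero]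

theorem taylorPS_zero : F.taylorPS k 0 = 0 := by
  rw [F.taylorPS_of_d_eq_zero k (map_zero _), map_zero]

theorem inv_taylorPS [SuperAlg k A] (f : A) :
    Parity.inv (F.taylorPS k f) = F.taylorPS k (Parity.inv f) := by
  have h : ∀ n : ℕ, Parity.inv ((F.d 0)^[n] f) = (F.d 0)^[n] (Parity.inv f) := fun n => by
    induction n generalizing f with
    | zero => rfl
    | succ n ih => rw [Function.iterate_succ_apply, Function.iterate_succ_apply, ih, F.inv_d]; simp
  ext n
  rw [coeff_inv, taylorPS, taylorPS, PowerSeries.coeff_mk, PowerSeries.coeff_mk, SuperAlg.inv_smul,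
    h]

variable [CharZero k]

theorem dPS_taylorPS (f : A) : dPS (F.taylorPS k f) = F.taylorPS k (F.d 0 f) := by
  ext n
  have h0 : ((n + 1 : ℕ) : k) ≠ 0 := Nat.cast_ne_zero.2 n.succ_ne_zero
  rw [coeff_dPS, natCast_succ_mul k, taylorPS, taylorPS, PowerSeries.coeff_mk, PowerSeries.coeff_mk,
    Nat.factorial_succ, Nat.cast_mul, mul_inv, smul_smul, ← mul_assoc, mul_inv_cancel₀ h0, one_mul,
    Function.iterate_succ_apply]

/-- The derivatives in `t` of both sides obey the same Leibniz rule, which gives an induction on the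
coefficient for all `f`, `g` at once; the constant coefficients are both `f * g`. -/
theorem taylorPS_mul (f g : A) : F.taylorPS k (f * g) = F.taylorPS k f * F.taylorPS k g := by
  ext n
  induction n generalizing f g with
  | zero => simp [taylorPS]
  | succ n ih =>
    have h1 : PowerSeries.coeff n (dPS (F.taylorPS k (f * g))) =
        PowerSeries.coeff n (dPS (F.taylorPS k f * F.taylorPS k g)) := by
      rw [dPS_taylorPS, dPS_mul, dPS_taylorPS, dPS_taylorPS, F.d_mul, taylorPS_add, map_add,
        map_add, ih, ih, tw_zero]
    rw [coeff_dPS, coeff_dPS, natCast_succ_mul k, natCast_succ_mul k] at h1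
    exact smul_right_cancel (k := k) n h1

variable {k} (hk : ∀ (c : k) a i, F.d i (c • a) = c • F.d i a)

omit [CharZero k] in
include hk in
theorem d_taylorPS_comm (n : ℕ) (i : Fin 3) (f : A) :
    F.d i (PowerSeries.coeff n (F.taylorPS k f)) = PowerSeries.coeff n (F.taylorPS k (F.d i f)) := by
  have h : ∀ n : ℕ, F.d i ((F.d 0)^[n] f) = (F.d 0)^[n] (F.d i f) := fun n => by
    induction n generalizing f with
    | zero => rfl
    | succ n ih => rw [Function.iterate_succ_apply, Function.iterate_succ_apply, ih, F.d_comm]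
  rw [taylorPS, taylorPS, PowerSeries.coeff_mk, PowerSeries.coeff_mk, hk, h]

variable [SuperAlg k A]

variable (k) in
/-- The Taylor expansion as a ring homomorphism. -/
def taylorHom : A →+* Disk A where
  toFun := F.taylor k
  map_one' := by
    have h := fun i => F.d_one i
    refine ext4 ?_ ?_ ?_ ?_ <;>
      simp [taylor, h, taylorPS_zero, F.taylorPS_of_d_eq_zero k (h 0)]
  map_zero' := by
    refine ext4 ?_ ?_ ?_ ?_ <;> simp [taylor, taylorPS_zero]
  map_add' f g := by
    refine ext4 ?_ ?_ ?_ ?_ <;> simp [taylor, taylorPS_add]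
  map_mul' f g := by
    refine ext4 ?_ ?_ ?_ ?_
    · exact F.taylorPS_mul k f g
    · simp [taylor, F.d_mul, taylorPS_add, taylorPS_mul, inv_taylorPS, Parity.inv_inv]
      abel
    · simp [taylor, F.d_mul, taylorPS_add, taylorPS_mul, inv_taylorPS, Parity.inv_inv]
      abel
    · have h : F.d 2 (Parity.inv f) = -Parity.inv (F.d 2 f) := by simp [F.inv_d]
      simp [taylor, F.d_mul, taylorPS_add, taylorPS_mul, inv_taylorPS, Parity.inv_inv, h,
        taylorPS_neg]
      abel

theorem taylorHom_apply (f : A) : F.taylorHom k f = F.taylor k f := rfl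

omit [CharZero k] in
theorem inv_taylor (f : A) : Parity.inv (F.taylor k f) = F.taylor k (Parity.inv f) := by
  have h1 : F.d 1 (Parity.inv f) = -Parity.inv (F.d 1 f) := by simp [F.inv_d]
  have h2 : F.d 2 (Parity.inv f) = -Parity.inv (F.d 2 f) := by simp [F.inv_d]
  have h3 : F.d 2 (Parity.inv (F.d 1 f)) = -Parity.inv (F.d 2 (F.d 1 f)) := by simp [F.inv_d]
  refine ext4 ?_ ?_ ?_ ?_ <;>
    simp [taylor, inv_taylorPS, h1, h2, h3, taylorPS_neg]

/-- Differentiating `f(x + (t|τ))` in the displacement or in `x` is the same. Jacobian matrices on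
`A` are thus carried to Jacobian matrices on the disk. -/
theorem partialD_taylor (i : Fin 3) (f : A) :
    (frame A).d i (F.taylor k f) = F.taylor k (F.d i f) := by
  have : SuperComm A := SuperAlg.toSuperComm k
  have z1 := F.d_d_self (i := 1) (by decide)
  have z2 := F.d_d_self (i := 2) (by decide)
  have z3 := fun a => F.d_anti 1 2 a (by decide) (by decide)
  rw [frame_d]
  fin_cases i
  · have c := F.d_comm
    refine ext4 ?_ ?_ ?_ ?_ <;> simp [partialD_zero, taylor, dPS_taylorPS, dPS_inv, c]
  · refine ext4 ?_ ?_ ?_ ?_ <;>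
      simp [partialD_one, taylor, z1, taylorPS_zero, Parity.inv_inv]
  · refine ext4 ?_ ?_ ?_ ?_ <;>
      simp [partialD_two, taylor, z2, z3, taylorPS_zero, taylorPS_neg, Parity.inv_inv]

-- This links the formal coefficient `tau` with the Berezin integral that defines the flux.
omit [CharZero k] [SuperAlg k A] in
theorem tau_taylor (f : A) : tau (F.taylor k f) = F.top f := by
  simp [tau_apply, taylor, taylorPS, top]

-- First-order Taylor approximation; the twist appears because the odd displacement stands to the
-- right of its coefficient.
omit [CharZero k] in
theorem taylor_sub_linear_mem (f : A) :
    F.taylor k f - const f - ∑ i, const (tw i (F.d i f)) * gen i ∈ mPow A 2 := by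
  rw [Fin.sum_univ_three]
  refine mem_mPow_iff.2 ⟨fun n hn => ?_, fun n hn => ?_, fun n hn => ?_, fun n hn => by omega⟩
  · interval_cases n
    · simp [taylor, taylorPS, const, gen_zero, gen_one, gen_two]
    · simp [taylor, taylorPS, const, gen_zero, gen_one, gen_two, PowerSeries.coeff_C]
  · obtain rfl : n = 0 := by omega
    simp [taylor, inv_taylorPS, const, gen_zero, gen_one, gen_two]
    simp [taylorPS]
  · obtain rfl : n = 0 := by omega
    simp [taylor, inv_taylorPS, const, gen_zero, gen_one, gen_two]
    simp [taylorPS]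

end Frame

end

end SuperCurve

/-! ### A change of coordinates is in `Aut^Δ` exactly when its flux vanishes. -/

namespace SuperCurve
noncomputable section

namespace Frame

open Disk

variable {A : Type v} [Ring A] [Parity A] (F G : Frame A)

theorem inv_d_x (i j : Fin 3) :
    Parity.inv (F.d i (G.x j)) = (sg i * sg j) • F.d i (G.x j) := by
  rw [F.inv_d, G.inv_x, map_zsmul, smul_smul]

theorem isEven_d_zero : F.IsEven (F.d 0) where
  inv_apply a := by rw [F.inv_d, sg_zero, one_smul]
  eq a := by simp [F.d_x]

variable {F G} {k : Type u} [Field k] [CharZero k] [Module k A] [SuperAlg k A]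

theorem sum_d_x_mul_d_x (h : ∀ i f, F.d i f =
      F.d i (G.x 0) * G.d 0 f + F.d i (G.x 1) * G.d 1 f + F.d i (G.x 2) * G.d 2 f) (i l : Fin 3) :
    F.d i (G.x 0) * G.d 0 (F.x l) + F.d i (G.x 1) * G.d 1 (F.x l) + F.d i (G.x 2) * G.d 2 (F.x l) =
      if i = l then 1 else 0 := by
  rw [← h, F.d_x]

theorem inv_taylor_sub_const (j : Fin 3) :
    Parity.inv (F.taylor k (G.x j) - const (G.x j)) =
      sg j • (F.taylor k (G.x j) - const (G.x j)) := by
  rw [map_sub, inv_taylor, inv_const, G.inv_x, ← taylorHom_apply, ← taylorHom_apply,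
    ← constHom_apply, ← constHom_apply, map_zsmul, map_zsmul, smul_sub]

/-- The flux of an automorphism that represents a change of coordinates. -/
theorem tau_changeOfCoords (h : ∀ i f, F.d i f =
      F.d i (G.x 0) * G.d 0 f + F.d i (G.x 1) * G.d 1 f + F.d i (G.x 2) * G.d 2 f)
    (ht : F.top (G.d 0 (F.x 0)) = 0) {Φ : Disk A ≃+* Disk A} (hΦ : IsAut Φ)
    (hg : ∀ j, Φ (gen j) = F.taylor k (G.x j) - const (G.x j)) :
    tau (Φ (gen 0 * (frame A).d 0 (Φ.symm (gen 0)))) = F.top (G.x 0 * G.d 0 (F.x 0)) := by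
  have : SuperComm A := SuperAlg.toSuperComm k
  -- The field `∂_t` transported by `Φ`. Its values on the elements `Φ (gen j)` are known; inverting
  -- their Jacobian matrix identifies its `∂_t`-component with the expansion of `∂_{y₀} x₀`.
  let W : Disk A → Disk A := fun f => Φ ((frame A).d 0 (Φ.symm f))
  have hW : (frame A).IsEven W := hΦ.isEven_conj (frame A).isEven_d_zero
  have hWw : ∀ j, W (F.taylor k (G.x j) - const (G.x j)) = if 0 = j then 1 else 0 := fun j => by
    change Φ ((frame A).d 0 (Φ.symm _)) = _
    rw [← hg, Φ.symm_apply_apply, frame_x_ite]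
    split_ifs <;> simp
  have hd : ∀ i j, (frame A).d i (F.taylor k (G.x j) - const (G.x j)) =
      F.taylorHom k (F.d i (G.x j)) := fun i j => by
    rw [map_sub, partialD_const, sub_zero, partialD_taylor, taylorHom_apply]
  have hsum : ∀ j, (if 0 = j then 1 else 0) = W (gen 0) * F.taylorHom k (F.d 0 (G.x j)) +
      W (gen 1) * F.taylorHom k (F.d 1 (G.x j)) + W (gen 2) * F.taylorHom k (F.d 2 (G.x j)) := by
    intro j
    rw [← hWw, hW.eq, hd, hd, hd, frame_x, frame_x, frame_x]
  have hK : ∀ i, F.taylorHom k (F.d i (G.x 0)) * F.taylorHom k (G.d 0 (F.x 0)) +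
      F.taylorHom k (F.d i (G.x 1)) * F.taylorHom k (G.d 1 (F.x 0)) +
      F.taylorHom k (F.d i (G.x 2)) * F.taylorHom k (G.d 2 (F.x 0)) = if i = 0 then 1 else 0 := by
    intro i
    rw [← map_mul, ← map_mul, ← map_mul, ← map_add, ← map_add, sum_d_x_mul_d_x h]
    split_ifs <;> simp
  have hW0 : W (gen 0) = F.taylorHom k (G.d 0 (F.x 0)) := by
    have e : ∀ (a b : Fin 3 → Disk A) (p : Fin 3 → Fin 3 → Disk A),
        a 0 * (p 0 0 * b 0 + p 0 1 * b 1 + p 0 2 * b 2)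
          + a 1 * (p 1 0 * b 0 + p 1 1 * b 1 + p 1 2 * b 2)
          + a 2 * (p 2 0 * b 0 + p 2 1 * b 1 + p 2 2 * b 2) =
        (a 0 * p 0 0 + a 1 * p 1 0 + a 2 * p 2 0) * b 0
          + (a 0 * p 0 1 + a 1 * p 1 1 + a 2 * p 2 1) * b 1
          + (a 0 * p 0 2 + a 1 * p 1 2 + a 2 * p 2 2) * b 2 := fun a b p => by
      simp only [mul_add, add_mul, mul_assoc]
      abel
    have := e (fun i => W (gen i)) (fun j => F.taylorHom k (G.d j (F.x 0)))
      fun i j => F.taylorHom k (F.d i (G.x j))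
    simp only [hK, ← hsum] at this
    simpa using this
  have hc : ∀ (r : A) f, tau (const r * f) = r * tau f := fun r f => by simp [tau_apply, const]
  rw [map_mul, hg]
  change tau (_ * W (gen 0)) = _
  -- The subtracted constant `y₀` contributes `y₀ · top(∂_{y₀} x₀)`, which is zero by `ht`.
  rw [hW0, sub_mul, map_sub, hc, ← taylorHom_apply, ← map_mul, taylorHom_apply, taylorHom_apply,
    tau_taylor, tau_taylor, ht, mul_zero, sub_zero]

/-- A change of coordinates is in `Aut^Δ` if and only if its flux vanishes. -/
theorem exists_mem_autDelta_iff (h : ∀ i f, F.d i f =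
      F.d i (G.x 0) * G.d 0 f + F.d i (G.x 1) * G.d 1 f + F.d i (G.x 2) * G.d 2 f)
    (h' : ∀ i f, G.d i f =
      G.d i (F.x 0) * F.d 0 f + G.d i (F.x 1) * F.d 1 f + G.d i (F.x 2) * F.d 2 f)
    (hB : berezinian (Matrix.of fun i j => F.d i (G.x j)) = 1)
    (ht : F.top (G.d 0 (F.x 0)) = 0) :
    (∃ Φ ∈ autDelta k A, ∀ j, Φ (gen j) = F.taylor k (G.x j) - const (G.x j)) ↔
      F.top (G.x 0 * G.d 0 (F.x 0)) = 0 := by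
  have : SuperComm A := SuperAlg.toSuperComm k
  constructor
  · rintro ⟨Φ, ⟨X, hX, T, hT, E, hE, hXE, hΦ⟩, hg⟩
    obtain ⟨hXe, hX2, hdiv, hX0⟩ := mem_S2plus_iff.1 hX
    obtain rfl : Φ = T.trans E := RingEquiv.ext hΦ
    have hA : IsAut (T.trans E) :=
      ⟨fun f => by simp [hT.1.1.even, hE.even], fun r => by simp [hT.1.1.const, hE.const],
        fun f hf => hE.origin _ (hT.1.1.origin f hf)⟩
    rw [← tau_changeOfCoords h ht hA hg, ← hX0]
    exact tau_exp_comp hXe hX2 hdiv hXE hT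
  · intro hf
    let J : Fin 3 → Fin 3 → A := fun i j => F.d i (G.x j)
    let K : Fin 3 → Fin 3 → A := fun i j => G.d i (F.x j)
    have hJ : ∀ i j, Parity.inv (J i j) = (sg i * sg j) • J i j := F.inv_d_x G
    have hK : ∀ i j, Parity.inv (K i j) = (sg i * sg j) • K i j := G.inv_d_x F
    have hJK : ∀ i l, J i 0 * K 0 l + J i 1 * K 1 l + J i 2 * K 2 l = if i = l then 1 else 0 :=
      sum_d_x_mul_d_x h
    have hKJ : ∀ i l, K i 0 * J 0 l + K i 1 * J 1 l + K i 2 * J 2 l = if i = l then 1 else 0 :=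
      sum_d_x_mul_d_x h'
    obtain ⟨T, hT, hTg⟩ := exists_linear hJ hK hJK hKJ hB
    let w : Fin 3 → Disk A := fun j => F.taylor k (G.x j) - const (G.x j)
    -- With `T` the linear part, the remaining factor `E` must satisfy `E (T (gen j)) = w j`.
    -- Applying the inverse matrix gives its values `v`, which are the generators modulo `𝔪²`.
    let v : Fin 3 → Disk A := fun l => ∑ j, const (tw j (K j l)) * w j
    have hv : ∀ l, Parity.inv (v l) = sg l • v l := inv_linear hK inv_taylor_sub_const
    have hv2 : ∀ l, v l - gen l ∈ mPow A 2 := fun l => by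
      rw [← sum_const_mul_sum hJ hJK gen l, ← Finset.sum_sub_distrib]
      refine sum_mem fun j _ => ?_
      rw [← mul_sub]
      exact const_mul_mem _ (taylor_sub_linear_mem F (G.x j))
    obtain ⟨X, hXe, hX2, hXs⟩ := exists_log (k := k) hv hv2
    have hr := raises_of_isEven hXe hX2
    obtain ⟨E, hE⟩ := exists_isExp hr hXe.map_mul
    have hEa := hE.isAut hXe hr
    have hEg : ∀ l, E (gen l) = v l := fun l => (isExp_iff.1 hE _).unique (hXs l)
    have hg : ∀ j, E (T (gen j)) = F.taylor k (G.x j) - const (G.x j) := fun j => by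
      rw [hTg, map_sum]
      refine .trans ?_ (sum_const_mul_sum hK hKJ w j)
      exact Finset.sum_congr rfl fun i _ => by rw [map_mul, hEa.const, hEg]
    have hdiv := div_eq_zero_of_berJacobian hXe hX2 hE hT (by
      rw [← map_berezinian (F.taylorHom k) hB]
      congr 1
      ext1 i j
      rw [Matrix.of_apply, hg, map_sub, partialD_const, sub_zero, partialD_taylor]
      rfl)
    have hA : IsAut (T.trans E) :=
      ⟨fun f => by simp [hT.1.1.even, hEa.even], fun r => by simp [hT.1.1.const, hEa.const],
        fun f hf => hEa.origin _ (hT.1.1.origin f hf)⟩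
    have hX0 : tau (X (gen 0)) = 0 := by
      rw [← tau_exp_comp hXe hX2 hdiv hE hT, ← hf]
      exact tau_changeOfCoords h ht hA hg
    exact ⟨T.trans E, ⟨X, mem_S2plus_iff.2 ⟨hXe, hX2, hdiv, hX0⟩, T, hT, E, hEa, hE,
      fun f => rfl⟩, hg⟩

end Frame

open SuperSpace

variable {k : Type u} [Field k] [CharZero k] {C S : SuperSpace k} {π : Hom C S}

/-- The two expansions take the odd and the even derivatives in opposite orders, and these commute.
-/
theorem Coords.taylor_eq {U : Opens C.top} (x : Coords π U) (f : C.Sec U) :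
    x.taylor f = x.frame.taylor k f := by
  have hk : ∀ (c : k) a i, x.frame.d i (c • a) = c • x.frame.d i a := fun c a i =>
    ((x.partialD i).app U le_rfl).map_smul c a
  have h := fun n i f => x.frame.d_taylorPS_comm (k := k) hk n i f
  refine Disk.ext4 rfl ?_ ?_ ?_ <;> ext n
  · rw [Frame.taylor, coeff_inv, ← h]
    rfl
  · rw [Frame.taylor, coeff_inv, ← h]
    rfl
  · rw [Frame.taylor, ← h, ← h]
    rfl

/-- The change between compatible coordinates is in `Aut^Δ` if and only if its flux vanishes. -/
theorem BerSection.Compatible.changeInAutDelta_iff {Δ : BerSection π} {U : Opens C.top}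
    (x y : Δ.Compatible U) : x.1.ChangeInAutDelta y.1 ↔ x.1.flux y.1 = 0 := by
  rw [Coords.ChangeInAutDelta]
  simp only [Coords.taylor_eq]
  exact Frame.exists_mem_autDelta_iff (F := x.1.frame) (G := y.1.frame) (k := k) (x.1.frame_d_eq y.1) (y.1.frame_d_eq x.1)
    (x.berJacobian_eq_one y) (x.top_partialD_zero y)

end

end SuperCurve

/-! ### Gluing of fluxes and the trivialization of the torsor. -/

namespace SuperCurve
noncomputable section

open SuperSpace

variable {k : Type u} [Field k] {C S : SuperSpace k} {π : Hom C S}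

section Gluing

variable {U : Opens C.top}

theorem eq_of_locally_eq {f g : C.Sec U}
    (h : ∀ p ∈ U, ∃ (N : Opens C.top) (hN : N ≤ U), p ∈ N ∧ res hN f = res hN g) : f = g := by
  choose N hN hp hfg using h
  refine C.sheaf.eq_of_locally_eq' (fun p : U => N p.1 p.2) U (fun p => homOfLE (hN p.1 p.2))
    (fun p hpU => ?_) f g fun p => hfg p.1 p.2
  exact Opens.mem_iSup.2 ⟨⟨p, hpU⟩, hp p hpU⟩

theorem exists_gluing (N : ∀ p ∈ U, Opens C.top) (hN : ∀ p hp, N p hp ≤ U)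
    (hp : ∀ p hp, p ∈ N p hp) (f : ∀ p hp, C.Sec (N p hp))
    (hf : ∀ p hp q hq, res (inf_le_left : N p hp ⊓ N q hq ≤ _) (f p hp) =
      res (inf_le_right : N p hp ⊓ N q hq ≤ _) (f q hq)) :
    ∃ g : C.Sec U, ∀ p hp, res (hN p hp) g = f p hp := by
  obtain ⟨g, hg, -⟩ := C.sheaf.existsUnique_gluing' (fun p : U => N p.1 p.2) U
    (fun p => homOfLE (hN p.1 p.2)) (fun p hpU => Opens.mem_iSup.2 ⟨⟨p, hpU⟩, hp p hpU⟩)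
    (fun p => f p.1 p.2) fun p q => hf p.1 p.2 q.1 q.2
  exact ⟨g, fun p hp => hg ⟨p, hp⟩⟩

theorem mem_relativeConstants_of_locally {f : C.Sec U}
    (h : ∀ p ∈ U, ∃ (N : Opens C.top) (hN : N ≤ U), p ∈ N ∧ res hN f ∈ relativeConstants π N) :
    f ∈ relativeConstants π U := by
  refine ⟨hasParity_zero_iff.2 (eq_of_locally_eq fun p hp => ?_), fun V hV j D =>
    eq_of_locally_eq fun p hp => ?_⟩
  · obtain ⟨N, hN, hpN, hf⟩ := h p hp
    refine ⟨N, hN, hpN, ?_⟩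
    rw [res_inv]
    exact hasParity_zero_iff.1 hf.1
  · obtain ⟨N, hN, hpN, hf⟩ := h p (hV hp)
    refine ⟨V ⊓ N, inf_le_left, ⟨hp, hpN⟩, ?_⟩
    rw [← D.app_res V _ le_rfl inf_le_left, map_zero, res_res]
    have h2 := hf.2 (V ⊓ N) inf_le_right j (D.restrict inf_le_left)
    rw [res_res] at h2
    exact h2

end Gluing

variable [CharZero k] {Δ : BerSection π}

/-- The coordinates `x` and `y` have flux `c` near `p`. -/
def BerSection.Compatible.FluxNear {U V W : Opens C.top} (x : Δ.Compatible V)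
    (y : Δ.Compatible W) (c : C.Sec U) (p : C.top) : Prop :=
  ∃ (N : Opens C.top) (hV : N ≤ V) (hW : N ≤ W) (hU : N ≤ U), p ∈ N ∧
    (x.restrict hV).1.flux (y.restrict hW).1 = res hU c

namespace BerSection.Compatible

theorem restrict_flux {U V N : Opens C.top} (x : Δ.Compatible U) (y : Δ.Compatible V)
    (h1 : N ≤ U) (h2 : N ≤ V) {N' : Opens C.top} (h : N' ≤ N) :
    res h ((x.restrict h1).1.flux (y.restrict h2).1) =
      (x.restrict (h.trans h1)).1.flux (y.restrict (h.trans h2)).1 := by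
  have e := (x.restrict h1).1.flux_restrict (y.restrict h2).1 h
  rw [← e]
  have a : ∀ {U : Opens C.top} (x : Δ.Compatible U) (h1 : N ≤ U),
      (x.restrict h1).1.restrict h = (x.restrict (h.trans h1)).1 := fun x h1 => by
    simp only [restrict, Coords.restrict, res_res]
    rfl
  rw [a, a]

/-- The cocycle relation for coordinates with different domains, compared on a common neighbourhood
of `p`. -/
theorem FluxNear.trans {U V W X : Opens C.top} {x : Δ.Compatible V} {y : Δ.Compatible W}
    {z : Δ.Compatible X} {c d : C.Sec U} {p : C.top} (h1 : x.FluxNear y c p)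
    (h2 : y.FluxNear z d p) : x.FluxNear z (c + d) p := by
  obtain ⟨N, hV, hW, hU, hp, h⟩ := h1
  obtain ⟨N', hV', hW', hU', hp', h'⟩ := h2
  refine ⟨N ⊓ N', inf_le_left.trans hV, inf_le_right.trans hW', inf_le_left.trans hU, ⟨hp, hp'⟩, ?_⟩
  rw [← flux_add_flux _ (y.restrict (inf_le_left.trans hW)), map_add,
    ← restrict_flux x y hV hW inf_le_left, h, res_res]
  have h3 := restrict_flux y z hV' hW' (inf_le_right : N ⊓ N' ≤ N')
  rw [h', res_res] at h3
  rw [← h3]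

theorem FluxNear.symm {U V W : Opens C.top} {x : Δ.Compatible V} {y : Δ.Compatible W}
    {c : C.Sec U} {p : C.top} (h1 : x.FluxNear y c p) : y.FluxNear x (-c) p := by
  obtain ⟨N, hV, hW, hU, hp, h⟩ := h1
  exact ⟨N, hW, hV, hU, hp, by rw [flux_symm, h, map_neg]⟩

theorem FluxNear.mono {U U' V W : Opens C.top} {x : Δ.Compatible V} {y : Δ.Compatible W}
    {c : C.Sec U} {p : C.top} (h : x.FluxNear y c p) (hU : U' ≤ U) (hp : p ∈ U') :
    x.FluxNear y (res hU c) p := by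
  obtain ⟨N, hV, hW, hU', hpN, h⟩ := h
  refine ⟨N ⊓ U', inf_le_left.trans hV, inf_le_left.trans hW, inf_le_right, ⟨hpN, hp⟩, ?_⟩
  rw [← restrict_flux x y hV hW inf_le_left, h, res_res, res_res]

theorem FluxNear.of_res {U U' V W : Opens C.top} {x : Δ.Compatible V} {y : Δ.Compatible W}
    {c : C.Sec U} {p : C.top} {hU : U' ≤ U} (h : x.FluxNear y (res hU c) p) :
    x.FluxNear y c p := by
  obtain ⟨N, hV, hW, hU', hpN, h⟩ := h
  exact ⟨N, hV, hW, hU'.trans hU, hpN, by rw [h, res_res]⟩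

theorem FluxNear.zero_change {U U' V W : Opens C.top} {x : Δ.Compatible V} {y : Δ.Compatible W}
    {p : C.top} (h : x.FluxNear y (0 : C.Sec U) p) (hp : p ∈ U') :
    x.FluxNear y (0 : C.Sec U') p := by
  obtain ⟨N, hV, hW, hU, hpN, h⟩ := h
  refine ⟨N ⊓ U', inf_le_left.trans hV, inf_le_left.trans hW, inf_le_right, ⟨hpN, hp⟩, ?_⟩
  rw [← restrict_flux x y hV hW inf_le_left, h, map_zero, map_zero, map_zero]

theorem fluxNear_self {V U : Opens C.top} (x : Δ.Compatible V) {p : C.top} (hV : p ∈ V)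
    (hU : p ∈ U) : x.FluxNear x (0 : C.Sec U) p :=
  ⟨V ⊓ U, inf_le_left, inf_le_left, inf_le_right, ⟨hV, hU⟩, by rw [Coords.flux_self, map_zero]⟩

theorem fluxNear_restrict {V W U : Opens C.top} (x : Δ.Compatible V) (h : W ≤ V) {p : C.top}
    (hW : p ∈ W) (hU : p ∈ U) : x.FluxNear (x.restrict h) (0 : C.Sec U) p := by
  have e : ∀ {N : Opens C.top} (hN : N ≤ W),
      (x.restrict h).restrict hN = x.restrict (hN.trans h) := fun hN => by
    simp only [restrict, Coords.restrict, res_res]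
    rfl
  exact ⟨W ⊓ U, inf_le_left.trans h, inf_le_left, inf_le_right, ⟨hW, hU⟩, by
    rw [e, Coords.flux_self, map_zero]⟩

theorem fluxNear_shift {V : Opens C.top} (x : Δ.Compatible V) (c : relativeConstants π V)
    {p : C.top} (hp : p ∈ V) : x.FluxNear (x.shift c) c.1 p := by
  refine ⟨V, le_rfl, le_rfl, le_rfl, hp, ?_⟩
  have := x.1.flux_restrict (x.shift c).1 (le_refl V)
  exact this.trans (congrArg _ (x.1.flux_shift c))

theorem FluxNear.locally_eq {U V W : Opens C.top} {x : Δ.Compatible V} {y : Δ.Compatible W}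
    {c d : C.Sec U} {p : C.top} (h1 : x.FluxNear y c p) (h2 : x.FluxNear y d p) :
    ∃ (N : Opens C.top) (hN : N ≤ U), p ∈ N ∧ res hN c = res hN d := by
  obtain ⟨N, hV, hW, hU, hp, h⟩ := h1
  obtain ⟨N', hV', hW', hU', hp', h'⟩ := h2
  refine ⟨N ⊓ N', inf_le_left.trans hU, ⟨hp, hp'⟩, ?_⟩
  have e := restrict_flux x y hV hW (inf_le_left : N ⊓ N' ≤ N)
  have e' := restrict_flux x y hV' hW' (inf_le_right : N ⊓ N' ≤ N')
  rw [h, res_res] at e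
  rw [h', res_res] at e'
  rw [e, e']

theorem flux_eq_of_fluxNear {U : Opens C.top} {x y : Δ.Compatible U} {c : C.Sec U}
    (h : ∀ p ∈ U, x.FluxNear y c p) : x.1.flux y.1 = c := by
  refine eq_of_locally_eq fun p hp => ?_
  refine FluxNear.locally_eq (x := x) (y := y) ⟨U, le_rfl, le_rfl, le_rfl, hp, ?_⟩ (h p hp)
  exact x.1.flux_restrict y.1 le_rfl

/-- Two coordinate systems represent the same point of the fibre if their flux vanishes. -/
theorem germ_eq_iff {U V W : Opens C.top} (x : Δ.Compatible V) (y : Δ.Compatible W) {p : C.top}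
    (hU : p ∈ U) (hV : p ∈ V) (hW : p ∈ W) :
    x.germ hV = y.germ hW ↔ x.FluxNear y (0 : C.Sec U) p := by
  constructor
  · intro h
    -- Equality in the quotient only provides the generated equivalence relation. By the cocycle
    -- relation, vanishing flux is itself an equivalence relation and contains the generators.
    have h2 := Quot.eqvGen_exact h
    have key : ∀ a b : CoordsAt Δ p, Relation.EqvGen CoordsAt.Rel a b →
        a.2.FluxNear b.2 (0 : C.Sec U) p := by
      intro a b hab
      induction hab with
      | rel a b h =>
        obtain ⟨N, ha, hb, hp, h⟩ := h
        refine FluxNear.zero_change (U := N) ⟨N, ha, hb, le_rfl, hp, ?_⟩ hU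
        rw [map_zero]
        exact (changeInAutDelta_iff _ _).1 h
      | refl a => exact fluxNear_self _ a.1.2 hU
      | symm a b _ ih => simpa using ih.symm
      | trans a b c _ _ ih1 ih2 => simpa using ih1.trans ih2
    exact key _ _ h2
  · rintro ⟨N, hV', hW', _, hp, h⟩
    rw [map_zero] at h
    exact Quot.sound ⟨N, hV', hW', hp, (changeInAutDelta_iff _ _).2 h⟩

end BerSection.Compatible

open BerSection.Compatible

/-- One global section, the image of `0`, is enough: the compatible coordinates that represent it
form the atlas, and two of them have flux zero near every common point. -/
theorem isS2SuperCurve_of_isTrivialTorsor (h : IsTrivialTorsor Δ) : IsS2SuperCurve Δ := by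
  obtain ⟨e, -⟩ := h
  let s := e ⊤ 0
  refine ⟨{a | ∀ p (hp : p ∈ a.1), s.1 p trivial = a.2.germ hp}, fun p => ?_, fun a ha b hb => ?_⟩
  · obtain ⟨V, x, hp, hx⟩ := s.2 p trivial
    exact ⟨⟨V, x⟩, fun q hq => hx q hq trivial, hp⟩
  · refine (changeInAutDelta_iff (a.2.restrict inf_le_left) (b.2.restrict inf_le_right)).2 ?_
    refine flux_eq_of_fluxNear fun p hp => ?_
    have h0 := (germ_eq_iff (U := a.1 ⊓ b.1) a.2 b.2 hp hp.1 hp.2).1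
      ((ha p hp.1).symm.trans (hb p hp.2))
    have h1 := (fluxNear_restrict (U := a.1 ⊓ b.1) a.2 inf_le_left hp hp).symm
    have h2 := fluxNear_restrict (U := a.1 ⊓ b.1) b.2 inf_le_right hp hp
    simpa using (h1.trans h0).trans h2

section Atlas

variable {𝒜 : Set (Σ U : Opens C.top, Δ.Compatible U)}

theorem fluxNear_of_atlas (h𝒜 : ∀ a ∈ 𝒜, ∀ b ∈ 𝒜,
      (a.2.restrict (inf_le_left : a.1 ⊓ b.1 ≤ a.1)).1.ChangeInAutDelta
        (b.2.restrict (inf_le_right : a.1 ⊓ b.1 ≤ b.1)).1)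
    {a b : Σ U : Opens C.top, Δ.Compatible U} (ha : a ∈ 𝒜) (hb : b ∈ 𝒜) {U : Opens C.top}
    {p : C.top} (hpa : p ∈ a.1) (hpb : p ∈ b.1) (hU : p ∈ U) :
    a.2.FluxNear b.2 (0 : C.Sec U) p := by
  refine FluxNear.zero_change (U := a.1 ⊓ b.1)
    ⟨a.1 ⊓ b.1, inf_le_left, inf_le_right, le_rfl, ⟨hpa, hpb⟩, ?_⟩ hU
  rw [map_zero]
  exact (changeInAutDelta_iff _ _).1 (h𝒜 a ha b hb)

/-- The shift by `c` of a chart around `p`. -/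
def shiftedChart (a : Σ U : Opens C.top, Δ.Compatible U) {U : Opens C.top}
    (c : relativeConstants π U) : Δ.Compatible (a.1 ⊓ U) :=
  (a.2.restrict inf_le_left).shift (restrictConstant inf_le_right c)

theorem fluxNear_shiftedChart (a : Σ U : Opens C.top, Δ.Compatible U) {U : Opens C.top}
    (c : relativeConstants π U) {p : C.top} (hp : p ∈ a.1 ⊓ U) :
    a.2.FluxNear (shiftedChart a c) c.1 p := by
  have h1 := fluxNear_restrict (U := U) a.2 inf_le_left hp hp.2
  have h2 : (a.2.restrict inf_le_left).FluxNear (shiftedChart a c) c.1 p :=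
    FluxNear.of_res (hU := inf_le_right)
      (fluxNear_shift (a.2.restrict inf_le_left) (restrictConstant inf_le_right c) hp)
  simpa using h1.trans h2

/-- Fluxes between charts of the atlas vanish, so the flux of arbitrary coordinates relative to the
atlas does not depend on the chart. A constant `c` corresponds to the section of flux `c`,
represented by shifted charts. -/
theorem isTrivialTorsor_of_isS2SuperCurve (h : IsS2SuperCurve Δ) : IsTrivialTorsor Δ := by
  obtain ⟨𝒜, hcov, h𝒜⟩ := h
  choose ch hch hmem using hcov
  have hA : ∀ {U : Opens C.top} {p q : C.top}, p ∈ (ch q).1 → p ∈ U →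
      (ch p).2.FluxNear (ch q).2 (0 : C.Sec U) p := fun hp hU =>
    fluxNear_of_atlas h𝒜 (hch _) (hch _) (hmem _) hp hU
  -- a point of the fibre is determined by its flux relative to the chart around it
  have hB : ∀ {U W : Opens C.top} (c : relativeConstants π U) {p : C.top} (hU : p ∈ U)
      (y : Δ.Compatible W) (hW : p ∈ W), (shiftedChart (ch p) c).germ ⟨hmem p, hU⟩ = y.germ hW ↔
        (ch p).2.FluxNear y c.1 p := by
    intro U W c p hU y hW
    have h1 := fluxNear_shiftedChart (ch p) c ⟨hmem p, hU⟩
    refine (germ_eq_iff (U := U) (shiftedChart (ch p) c) y hU ⟨hmem p, hU⟩ hW).trans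
      ⟨fun h => by simpa using h1.trans h, fun h => by simpa using h1.symm.trans h⟩
  refine ⟨fun U c => ⟨fun p hp => (shiftedChart (ch p) c).germ ⟨hmem p, hp⟩, fun p hp =>
    ⟨(ch p).1 ⊓ U, shiftedChart (ch p) c, ⟨hmem p, hp⟩, fun q hV hU => ?_⟩⟩,
    fun U => ⟨fun c d hcd => ?_, fun t => ?_⟩, fun U V hV c => ?_, fun U c d p hp => ?_⟩
  · exact (hB c hU _ hV).2 (by simpa using (hA hV.1 hU).trans (fluxNear_shiftedChart (ch p) c hV))
  · refine Subtype.ext (eq_of_locally_eq fun p hp => ?_)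
    have h1 := congrFun (congrFun (congrArg Subtype.val hcd) p) hp
    exact ((hB c hp _ _).1 h1).locally_eq (fluxNear_shiftedChart (ch p) d ⟨hmem p, hp⟩)
  · have ht := t.2
    choose V y hpV hy using ht
    let N : ∀ p ∈ U, Opens C.top := fun p hp => (ch p).1 ⊓ V p hp ⊓ U
    have hNc : ∀ p hp, N p hp ≤ (ch p).1 := fun p hp => inf_le_left.trans inf_le_left
    have hNV : ∀ p hp, N p hp ≤ V p hp := fun p hp => inf_le_left.trans inf_le_right
    have hNU : ∀ p hp, N p hp ≤ U := fun p hp => inf_le_right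
    let f : ∀ p hp, C.Sec (N p hp) := fun p hp =>
      ((ch p).2.restrict (hNc p hp)).1.flux ((y p hp).restrict (hNV p hp)).1
    have hfN : ∀ p hp q, q ∈ N p hp → (ch p).2.FluxNear (y p hp) (f p hp) q := fun p hp q hq =>
      ⟨N p hp, hNc p hp, hNV p hp, le_rfl, hq, (res_self _).symm⟩
    -- Surjectivity: the fluxes of local representatives of the section agree on overlaps. Neither
    -- the change of chart nor the change of representative of the same class contributes.
    obtain ⟨g, hg⟩ := exists_gluing N hNU (fun p hp => ⟨⟨hmem p, hpV p hp⟩, hp⟩) f (by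
      intro p hp q hq
      refine eq_of_locally_eq fun r hr => ?_
      have h1 := (hfN p hp r hr.1).mono (inf_le_left : N p hp ⊓ N q hq ≤ _) hr
      have h2 := (hfN q hq r hr.2).mono (inf_le_right : N p hp ⊓ N q hq ≤ _) hr
      have h3 : (ch p).2.FluxNear (ch q).2 (0 : C.Sec (N p hp ⊓ N q hq)) r :=
        fluxNear_of_atlas h𝒜 (hch _) (hch _) (hNc p hp hr.1) (hNc q hq hr.2) hr
      have h4 := (germ_eq_iff (U := N p hp ⊓ N q hq) (y q hq) (y p hp) hr (hNV q hq hr.2)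
        (hNV p hp hr.1)).1 ((hy q hq r _ (hNU p hp hr.1)).symm.trans (hy p hp r _ _))
      have h5 := (h3.trans h2).trans h4
      rw [zero_add, add_zero] at h5
      exact h1.locally_eq h5)
    have hgm : g ∈ relativeConstants π U := mem_relativeConstants_of_locally fun p hp =>
      ⟨N p hp, hNU p hp, ⟨⟨hmem p, hpV p hp⟩, hp⟩, by rw [hg]; exact flux_mem _ _⟩
    refine ⟨⟨g, hgm⟩, Subtype.ext (funext fun p => funext fun hp => ?_)⟩
    rw [hy p hp p (hpV p hp) hp]
    refine (hB _ hp _ _).2 (FluxNear.of_res (hU := hNU p hp) ?_)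
    change (ch p).2.FluxNear (y p hp) (res _ g) p
    rw [hg]
    exact hfN p hp p ⟨⟨hmem p, hpV p hp⟩, hp⟩
  · refine Subtype.ext (funext fun p => funext fun hp => ?_)
    exact (hB _ hp _ _).2 ((fluxNear_shiftedChart (ch p) c ⟨hmem p, hV hp⟩).mono hV hp)
  -- Near `p` the single chart `ch p`, shifted by `d` and then by `c`, represents both sections;
  -- `hA` compares it with the charts `ch q` used to define their values at nearby points.
  · refine ⟨(ch p).1 ⊓ U, inf_le_right, shiftedChart (ch p) d,
      (shiftedChart (ch p) d).shift (restrictConstant inf_le_right c), ⟨hmem p, hp⟩,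
      fun q hq => ?_, rfl, rfl, rfl⟩
    have h1 : (ch q).2.FluxNear (shiftedChart (ch p) d) d.1 q := by
      simpa using (hA hq.1 hq.2).trans (fluxNear_shiftedChart (ch p) d hq)
    have h2 : (shiftedChart (ch p) d).FluxNear
        ((shiftedChart (ch p) d).shift (restrictConstant inf_le_right c)) c.1 q :=
      FluxNear.of_res (hU := inf_le_right) (fluxNear_shift _ _ hq)
    refine ⟨(hB _ hq.2 _ _).2 h1, (hB _ hq.2 _ _).2 ?_⟩
    have h3 := h1.trans h2
    rwa [add_comm] at h3

end Atlas

end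

end SuperCurve

theorem mainTheorem3 {k : Type u} [Field k] [CharZero k] {C S : SuperCurve.SuperSpace k}
    (π : SuperCurve.SuperSpace.Hom C S) (hπ : SuperCurve.IsSuperCurve π)
    (Δ : SuperCurve.BerSection π) (hΔ : Δ.Nonvanishing) :
    SuperCurve.IsS2SuperCurve Δ ↔ SuperCurve.IsTrivialTorsor Δ :=
  ⟨SuperCurve.isTrivialTorsor_of_isS2SuperCurve, SuperCurve.isS2SuperCurve_of_isTrivialTorsor⟩
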